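/- Let $d\ge 1$, let $\mathbb T^d=\mathbb R^d/\mathbb Z^d$, and assume: $0\le\alpha<1$; $V:\mathbb T^d\times(0,\infty)\to\mathbb R$ is $C^\infty$, bounded with bounded derivatives of all orders, and non-decreasing in its second variable $m$; and $b\in C^\infty(\mathbb T^d;\mathbb R^d)$. Put $V_0(m)=\arctan m$ and, for $\lambda\in[0,1]$, $$F(\lambda,u,m)=\begin{pmatrix}u-\Delta u+\dfrac{|Du|^2}{2m^\alpha}+\lambda\, b\cdot Du-\lambda V(x,m)-(1-\lambda)V_0(m)\\[2mm] m-\Delta m-\operatorname{div}(m^{1-\alpha}Du)-\lambda\operatorname{div}(bm)-1\end{pmatrix}.$$ For $k\in\mathbb N$ let $E^k=H^k(\mathbb T^d)\times H^k(\mathbb T^d)$ (real-valued functions, $H^0=L^2$). Let $k_0\in\mathbb N$ with $k_0>d/2$, let $\lambda_0\in[0,1]$, and let $(u,m)\in E^{k_0+2}$ be a classical ($C^2$) solution, with $m>0$ on $\mathbb T^d$, of $F(\lambda_0,u,m)=0$. Let $\mathcal L_{\lambda_0}$ be the linearization of $F(\lambda_0,\cdot,\cdot)$ at $(u,m)$,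 that is, $$\mathcal L_{\lambda_0}(v,f)=\begin{pmatrix}v-\Delta v+\dfrac{Du\cdot Dv}{m^\alpha}-\dfrac{\alpha|Du|^2 f}{2m^{\alpha+1}}+\lambda_0\, b\cdot Dv-\big(\lambda_0D_mV(x,m)+(1-\lambda_0)V_0'(m)\big)f\\[2mm] f-\Delta f-\operatorname{div}(m^{1-\alpha}Dv)-(1-\alpha)\operatorname{div}(m^{-\alpha}f\,Du)-\lambda_0\operatorname{div}(bf)\end{pmatrix},$$ where the derivatives of $v$ and $f$ are weak derivatives. Then for every integer $k\ge2$, $\mathcal L_{\lambda_0}$ is an isomorphism from $E^{k+2}$ onto $E^k$, i.e. a bounded linear bijection with bounded inverse. -/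

import Mathlib

open MeasureTheory Set
open scoped ContDiff ComplexConjugate

namespace MFG

/-! ### The flat torus, classical calculus on it -/

/-- The standard `d`-dimensional torus `ℝ^d / ℤ^d`. -/
abbrev Torus (d : ℕ) : Type := UnitAddTorus (Fin d)

/-- The quotient map `ℝ^d → ℝ^d / ℤ^d`. -/
def toTorus {d : ℕ} (y : Fin d → ℝ) : Torus d := fun i => (y i : UnitAddCircle)

/-- Lebesgue (normalized Haar) measure on the torus. -/
noncomputable def torusMeasure (d : ℕ) : Measure (Torus d) :=
  Measure.pi fun _ => AddCircle.haarAddCircle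

instance instIsProbabilityMeasureTorus (d : ℕ) : IsProbabilityMeasure (torusMeasure d) := by
  unfold torusMeasure; infer_instance

/-- `φ` is of class `C^n` on the torus: its periodic lift to `ℝ^d` is of class `C^n`. -/
def TorusContDiff {d : ℕ} (n : WithTop ℕ∞) (φ : Torus d → ℝ) : Prop :=
  ContDiff ℝ n fun y : Fin d → ℝ => φ (toTorus y)

/-- The classical partial derivative `∂_i φ` of a function on the torus. -/
noncomputable def pderiv {d : ℕ} (i : Fin d) (φ : Torus d → ℝ) (x : Torus d) : ℝ :=
  deriv (fun t : ℝ => φ (x + Pi.single i (t : UnitAddCircle))) 0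

/-- The classical Laplacian. -/
noncomputable def lap {d : ℕ} (φ : Torus d → ℝ) (x : Torus d) : ℝ :=
  ∑ i, pderiv i (pderiv i φ) x

/-- The classical divergence of the vector field `X = (X_1, …, X_d)`. -/
noncomputable def divergence {d : ℕ} (X : Fin d → Torus d → ℝ) (x : Torus d) : ℝ :=
  ∑ i, pderiv i (X i) x

/-- The squared length `|Dφ|²` of the classical gradient. -/
noncomputable def gradSq {d : ℕ} (φ : Torus d → ℝ) (x : Torus d) : ℝ :=
  ∑ i, pderiv i φ x ^ 2

/-! ### `L²(𝕋^d)`, weak derivatives and the Sobolev spaces `H^k(𝕋^d)` -/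

/-- The real Hilbert space `L²(𝕋^d)`. -/
abbrev L2 (d : ℕ) : Type := Lp ℝ 2 (torusMeasure d)

/-- `g` is the weak `i`-th partial derivative of `u`. -/
def HasWeakPDeriv {d : ℕ} (i : Fin d) (u g : L2 d) : Prop :=
  ∀ φ : Torus d → ℝ, TorusContDiff ∞ φ →
    ∫ x, u x * pderiv i φ x ∂(torusMeasure d) = -∫ x, g x * φ x ∂(torusMeasure d)

open Classical in
/-- The weak partial derivative of `u` (with the value `0` if `u` has none in `L²`). -/
noncomputable def wpderiv {d : ℕ} (i : Fin d) (u : L2 d) : L2 d :=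
  if h : ∃ g, HasWeakPDeriv i u g then h.choose else 0

/-- Membership in `H^k(𝕋^d)`: all weak derivatives of order at most `k` exist in `L²`. -/
def MemH {d : ℕ} : ℕ → L2 d → Prop
  | 0, _ => True
  | k + 1, u => ∀ i, ∃ g, HasWeakPDeriv i u g ∧ MemH k g

/-- The inner product of `H^k(𝕋^d)`: the sum, over all words `i₁ … i_j` of length `j ≤ k`, of the
`L²` inner products of `∂_{i₁} ⋯ ∂_{i_j} u` and `∂_{i₁} ⋯ ∂_{i_j} v`. -/
noncomputable def innerH {d : ℕ} : ℕ → L2 d → L2 d → ℝ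
  | 0, u, v => inner ℝ u v
  | k + 1, u, v => inner ℝ u v + ∑ i, innerH k (wpderiv i u) (wpderiv i v)

section WeakDerivativeFacts

variable {d : ℕ}

theorem continuous_toTorus : Continuous (toTorus (d := d)) := by
  unfold toTorus
  exact continuous_pi fun i => (AddCircle.continuous_mk' (1 : ℝ)).comp (continuous_apply i)

theorem toTorus_isQuotientMap : Topology.IsQuotientMap (toTorus (d := d)) := by
  have ho : IsOpenMap (toTorus (d := d)) := by
    have := IsOpenMap.piMap (f := fun (_ : Fin d) (t : ℝ) => (t : UnitAddCircle))
      (fun _ => QuotientAddGroup.isOpenMap_coe) (by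
        refine Filter.Eventually.of_forall fun i => ?_
        exact QuotientAddGroup.mk_surjective)
    exact this
  refine ho.isQuotientMap continuous_toTorus ?_
  intro x
  choose y hy using fun i => QuotientAddGroup.mk_surjective (x i)
  exact ⟨y, funext hy⟩

theorem TorusContDiff.continuous {n : WithTop ℕ∞} {φ : Torus d → ℝ} (h : TorusContDiff n φ) :
    Continuous φ :=
  toTorus_isQuotientMap.continuous_iff.2 (ContDiff.continuous h)

theorem toTorus_add_single (y : Fin d → ℝ) (i : Fin d) (t : ℝ) :
    toTorus y + Pi.single i (t : UnitAddCircle) = toTorus (y + t • Pi.single i 1) := by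
  funext j
  by_cases hj : j = i
  · subst hj; simp [toTorus]
  · simp [toTorus, hj]

theorem TorusContDiff.pderiv_eq {n : WithTop ℕ∞} {φ : Torus d → ℝ} (h : TorusContDiff n φ)
    (hn : n ≠ 0) (i : Fin d) (y : Fin d → ℝ) :
    pderiv i φ (toTorus y) = fderiv ℝ (fun z => φ (toTorus z)) y (Pi.single i 1) := by
  unfold pderiv
  simp only [toTorus_add_single]
  have h1 : HasFDerivAt (fun z => φ (toTorus z)) (fderiv ℝ (fun z => φ (toTorus z)) y) y :=
    ((ContDiff.differentiable h hn) y).hasFDerivAt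
  exact (h1.hasLineDerivAt (Pi.single i 1)).deriv

theorem TorusContDiff.pderiv_smooth {φ : Torus d → ℝ} (h : TorusContDiff ∞ φ) (i : Fin d) :
    TorusContDiff ∞ (pderiv i φ) := by
  unfold TorusContDiff
  simp only [h.pderiv_eq (by simp) i]
  exact (ContDiff.fderiv_right (m := ∞) h (by simp)).clm_apply contDiff_const

theorem integrable_mul_continuous (u : L2 d) {φ : Torus d → ℝ} (h : Continuous φ) :
    Integrable (fun x => u x * φ x) (torusMeasure d) := by
  have h2 : MemLp φ 2 (torusMeasure d) :=
    MemLp.of_bound h.aestronglyMeasurable ‖(⟨φ, h⟩ : C(Torus d, ℝ))‖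
      (Filter.Eventually.of_forall fun x => ContinuousMap.norm_coe_le_norm ⟨φ, h⟩ x)
  exact (Lp.memLp u).integrable_mul h2

theorem HasWeakPDeriv.add {i : Fin d} {u v g h : L2 d} (hu : HasWeakPDeriv i u g)
    (hv : HasWeakPDeriv i v h) : HasWeakPDeriv i (u + v) (g + h) := by
  intro φ hφ
  have key : ∀ (a b : L2 d) (ψ : Torus d → ℝ), Continuous ψ →
      ∫ x, (a + b : L2 d) x * ψ x ∂(torusMeasure d)
        = ∫ x, a x * ψ x ∂(torusMeasure d) + ∫ x, b x * ψ x ∂(torusMeasure d) := by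
    intro a b ψ hψ
    rw [← integral_add (integrable_mul_continuous a hψ) (integrable_mul_continuous b hψ)]
    refine integral_congr_ae ?_
    filter_upwards [Lp.coeFn_add a b] with x hx
    rw [hx, Pi.add_apply, add_mul]
  rw [key u v _ (hφ.pderiv_smooth i).continuous, key g h _ hφ.continuous, hu φ hφ, hv φ hφ]
  ring

theorem HasWeakPDeriv.smul {i : Fin d} {u g : L2 d} (c : ℝ) (hu : HasWeakPDeriv i u g) :
    HasWeakPDeriv i (c • u) (c • g) := by
  intro φ hφ
  have key : ∀ (a : L2 d) (ψ : Torus d → ℝ),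
      ∫ x, (c • a : L2 d) x * ψ x ∂(torusMeasure d) = c * ∫ x, a x * ψ x ∂(torusMeasure d) := by
    intro a ψ
    rw [← integral_const_mul]
    refine integral_congr_ae ?_
    filter_upwards [Lp.coeFn_smul c a] with x hx
    rw [hx, Pi.smul_apply, smul_eq_mul, mul_assoc]
  rw [key, key, hu φ hφ]
  ring

theorem mFourier_lift_contDiff (n : Fin d → ℤ) :
    ContDiff ℝ ∞ fun y : Fin d → ℝ => UnitAddTorus.mFourier n (toTorus y) := by
  have : (fun y : Fin d → ℝ => UnitAddTorus.mFourier n (toTorus y))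
      = fun y => ∏ i, Complex.exp (2 * Real.pi * Complex.I * n i * (y i : ℂ)) := by
    funext y
    simp [UnitAddTorus.mFourier, toTorus]
  rw [this]
  refine contDiff_prod fun i _ => ?_
  refine ContDiff.cexp ?_
  refine contDiff_const.mul ?_
  exact Complex.ofRealCLM.contDiff.comp (contDiff_apply ℝ ℝ i)

theorem eq_zero_of_forall_smooth (g : L2 d)
    (h : ∀ φ : Torus d → ℝ, TorusContDiff ∞ φ → ∫ x, g x * φ x ∂(torusMeasure d) = 0) :
    g = 0 := by
  have hG : MemLp (fun x => ((g x : ℝ) : ℂ)) 2 (torusMeasure d) := (Lp.memLp g).ofReal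
  have hcoef : ∀ n : Fin d → ℤ,
      ∫ x, UnitAddTorus.mFourier (-n) x * ((g x : ℝ) : ℂ) ∂(torusMeasure d) = 0 := by
    intro n
    have hsm := mFourier_lift_contDiff (-n)
    have hre := h (fun x => (UnitAddTorus.mFourier (-n) x).re)
      (Complex.reCLM.contDiff.comp hsm)
    have him := h (fun x => (UnitAddTorus.mFourier (-n) x).im)
      (Complex.imCLM.contDiff.comp hsm)
    have hint : Integrable (fun x => UnitAddTorus.mFourier (-n) x * ((g x : ℝ) : ℂ))
        (torusMeasure d) := by
      refine Integrable.bdd_mul (c := ‖UnitAddTorus.mFourier (-n)‖)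
        (hG.integrable (by norm_num)) ?_ ?_
      · exact (UnitAddTorus.mFourier (-n)).continuous.aestronglyMeasurable
      · exact Filter.Eventually.of_forall fun x => ContinuousMap.norm_coe_le_norm _ x
    apply Complex.ext
    · rw [← Complex.reCLM_apply, ← ContinuousLinearMap.integral_comp_comm _ hint]
      simpa [mul_comm] using hre
    · rw [← Complex.imCLM_apply, ← ContinuousLinearMap.integral_comp_comm _ hint]
      simpa [mul_comm] using him
  have hzero : hG.toLp _ = (0 : Lp ℂ 2 (torusMeasure d)) := by
    have hr : UnitAddTorus.mFourierBasis.repr (hG.toLp _) = 0 := by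
      ext n
      refine (UnitAddTorus.mFourierBasis_repr (hG.toLp _) n).trans ?_
      refine Eq.trans ?_ (hcoef n)
      change ∫ t, UnitAddTorus.mFourier (-n) t • (hG.toLp _ : Lp ℂ 2 (torusMeasure d)) t
        ∂(torusMeasure d) = _
      refine integral_congr_ae ?_
      have hc := hG.coeFn_toLp
      filter_upwards [hc] with x hx
      rw [hx, smul_eq_mul]
    exact (LinearIsometryEquiv.map_eq_zero_iff _).1 hr
  have h0 : (fun x => ((g x : ℝ) : ℂ)) =ᵐ[torusMeasure d] 0 :=
    hG.coeFn_toLp.symm.trans (hzero ▸ Lp.coeFn_zero ℂ 2 (torusMeasure d))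
  refine (Lp.eq_zero_iff_ae_eq_zero).2 ?_
  filter_upwards [h0] with x hx
  simpa using hx

theorem HasWeakPDeriv.unique {i : Fin d} {u g h : L2 d} (hg : HasWeakPDeriv i u g)
    (hh : HasWeakPDeriv i u h) : g = h := by
  have hz : HasWeakPDeriv i (u + (-1 : ℝ) • u) (g + (-1 : ℝ) • h) := hg.add (hh.smul (-1))
  rw [show u + (-1 : ℝ) • u = 0 by simp] at hz
  have h1 : g + (-1 : ℝ) • h = 0 := by
    refine eq_zero_of_forall_smooth _ fun φ hφ => ?_
    have h2 := hz φ hφ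
    have h3 : ∫ x, (0 : L2 d) x * pderiv i φ x ∂(torusMeasure d) = 0 := by
      rw [← integral_zero (Torus d) ℝ (μ := torusMeasure d)]
      refine integral_congr_ae ?_
      filter_upwards [Lp.coeFn_zero ℝ 2 (torusMeasure d)] with x hx
      rw [hx, Pi.zero_apply, zero_mul]
    linarith
  rw [neg_one_smul, ← sub_eq_add_neg] at h1
  exact sub_eq_zero.1 h1

theorem HasWeakPDeriv.wpderiv_eq {i : Fin d} {u g : L2 d} (hg : HasWeakPDeriv i u g) :
    wpderiv i u = g := by
  have hex : ∃ g, HasWeakPDeriv i u g := ⟨g, hg⟩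
  rw [wpderiv, dif_pos hex]
  exact hex.choose_spec.unique hg

theorem MemH.zero_mem (k : ℕ) : MemH k (0 : L2 d) := by
  induction k with
  | zero => trivial
  | succ k ih =>
    intro i
    refine ⟨0, ?_, ih⟩
    intro φ _
    have h0 : ∀ ψ : Torus d → ℝ, ∫ x, (0 : L2 d) x * ψ x ∂(torusMeasure d) = 0 := by
      intro ψ
      rw [← integral_zero (Torus d) ℝ (μ := torusMeasure d)]
      refine integral_congr_ae ?_
      filter_upwards [Lp.coeFn_zero ℝ 2 (torusMeasure d)] with x hx
      rw [hx, Pi.zero_apply, zero_mul]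
    rw [h0, h0, neg_zero]

theorem MemH.add {k : ℕ} {u v : L2 d} (hu : MemH k u) (hv : MemH k v) : MemH k (u + v) := by
  induction k generalizing u v with
  | zero => trivial
  | succ k ih =>
    intro i
    obtain ⟨g, hg, hg'⟩ := hu i
    obtain ⟨h, hh, hh'⟩ := hv i
    exact ⟨g + h, hg.add hh, ih hg' hh'⟩

theorem MemH.smul {k : ℕ} (c : ℝ) {u : L2 d} (hu : MemH k u) : MemH k (c • u) := by
  induction k generalizing u with
  | zero => trivial
  | succ k ih =>
    intro i
    obtain ⟨g, hg, hg'⟩ := hu i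
    exact ⟨c • g, hg.smul c, ih hg'⟩

theorem innerH_symm (k : ℕ) (u v : L2 d) : innerH k u v = innerH k v u := by
  induction k generalizing u v with
  | zero => exact real_inner_comm _ _
  | succ k ih =>
    simp only [innerH]
    rw [real_inner_comm]
    simp only [ih]

theorem innerH_self_nonneg (k : ℕ) (u : L2 d) : inner ℝ u u ≤ innerH k u u := by
  induction k generalizing u with
  | zero => exact le_rfl
  | succ k ih =>
    simp only [innerH]
    have : 0 ≤ ∑ i, innerH k (wpderiv i u) (wpderiv i u) :=
      Finset.sum_nonneg fun i _ => real_inner_self_nonneg.trans (ih _)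
    linarith

theorem innerH_add_left {k : ℕ} {u v : L2 d} (w : L2 d) (hu : MemH k u) (hv : MemH k v) :
    innerH k (u + v) w = innerH k u w + innerH k v w := by
  induction k generalizing u v w with
  | zero => exact inner_add_left _ _ _
  | succ k ih =>
    have h : ∀ i, innerH k (wpderiv i (u + v)) (wpderiv i w)
        = innerH k (wpderiv i u) (wpderiv i w) + innerH k (wpderiv i v) (wpderiv i w) := by
      intro i
      obtain ⟨g, hg, hg'⟩ := hu i
      obtain ⟨h, hh, hh'⟩ := hv i
      rw [(hg.add hh).wpderiv_eq, hg.wpderiv_eq, hh.wpderiv_eq, ih _ hg' hh']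
    simp only [innerH, h, inner_add_left, Finset.sum_add_distrib]
    ring

theorem innerH_smul_left {k : ℕ} (c : ℝ) {u : L2 d} (w : L2 d) (hu : MemH k u) :
    innerH k (c • u) w = c * innerH k u w := by
  induction k generalizing u w with
  | zero => exact real_inner_smul_left _ _ _
  | succ k ih =>
    have h : ∀ i, innerH k (wpderiv i (c • u)) (wpderiv i w)
        = c * innerH k (wpderiv i u) (wpderiv i w) := by
      intro i
      obtain ⟨g, hg, hg'⟩ := hu i
      rw [(hg.smul c).wpderiv_eq, hg.wpderiv_eq, ih _ hg']
    simp only [innerH, h, real_inner_smul_left, ← Finset.mul_sum]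
    ring

end WeakDerivativeFacts

/-- `H^k(𝕋^d)` as a linear subspace of `L²(𝕋^d)`. -/
def sobolevSubmodule (d k : ℕ) : Submodule ℝ (L2 d) where
  carrier := {u | MemH k u}
  zero_mem' := MemH.zero_mem k
  add_mem' := MemH.add
  smul_mem' := fun c _ hu => MemH.smul c hu

/-- The Sobolev space `H^k(𝕋^d) = W^{k,2}(𝕋^d)`. It carries its own norm (not the one of `L²`),
coming from the inner product `innerH k`. -/
def H (d k : ℕ) : Type := sobolevSubmodule d k

noncomputable instance instAddCommGroupH (d k : ℕ) : AddCommGroup (H d k) :=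
  inferInstanceAs (AddCommGroup (sobolevSubmodule d k))

noncomputable instance instModuleH (d k : ℕ) : Module ℝ (H d k) :=
  inferInstanceAs (Module ℝ (sobolevSubmodule d k))

/-- The element of `L²` underlying an element of `H^k`. -/
def H.toL2 {d k : ℕ} (u : H d k) : L2 d := Subtype.val u

@[reducible] noncomputable def coreH (d k : ℕ) : InnerProductSpace.Core ℝ (H d k) where
  inner u v := innerH k u.toL2 v.toL2
  conj_inner_symm u v := innerH_symm k _ _
  re_inner_nonneg u := real_inner_self_nonneg.trans (innerH_self_nonneg k u.toL2)
  add_left u v w := innerH_add_left w.toL2 u.property v.property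
  smul_left u v c := innerH_smul_left c v.toL2 u.property
  definite u hu := by
    have h1 : inner ℝ u.toL2 u.toL2 ≤ 0 := (innerH_self_nonneg k u.toL2).trans_eq hu
    exact Subtype.ext (inner_self_eq_zero.1 (le_antisymm h1 real_inner_self_nonneg))

noncomputable instance instNormedAddCommGroupH (d k : ℕ) : NormedAddCommGroup (H d k) :=
  (coreH d k).toNormedAddCommGroup

noncomputable instance instInnerProductSpaceH (d k : ℕ) : InnerProductSpace ℝ (H d k) :=
  InnerProductSpace.ofCore (coreH d k).toCore

/-- `E^k = H^k(𝕋^d) × H^k(𝕋^d)`. -/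
abbrev E (d k : ℕ) : Type := H d k × H d k

/-- A function on the torus represents an element of `H^k(𝕋^d)`. -/
def RepresentsH {d : ℕ} (k : ℕ) (u : Torus d → ℝ) : Prop :=
  ∃ U : H d k, U.toL2 =ᵐ[torusMeasure d] u

/-! ### The data, the continuation map and its linearization -/

/-- The standing assumptions on the congestion exponent `α`, the potential
`V : 𝕋^d × (0, ∞) → ℝ` and the vector field `b` on `𝕋^d`. -/
structure IsData {d : ℕ} (α : ℝ) (V : Torus d → ℝ → ℝ) (b : Fin d → Torus d → ℝ) : Prop where
  alpha_nonneg : 0 ≤ α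
  alpha_lt_one : α < 1
  V_smooth : ContDiffOn ℝ ∞ (fun p : (Fin d → ℝ) × ℝ => V (toTorus p.1) p.2) (univ ×ˢ Ioi 0)
  /-- `V` and its derivatives of all orders are bounded. -/
  V_bounded : ∀ n : ℕ, ∃ C : ℝ, ∀ p ∈ (univ : Set (Fin d → ℝ)) ×ˢ Ioi (0 : ℝ),
    ‖iteratedFDeriv ℝ n (fun q : (Fin d → ℝ) × ℝ => V (toTorus q.1) q.2) p‖ ≤ C
  V_mono : ∀ x, MonotoneOn (V x) (Ioi 0)
  b_smooth : ∀ i, TorusContDiff ∞ (b i)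

/-- The continuation map `F(lam, u, m)`, for functions `u`, `m` of class `C²`; here
`V₀ = arctan`. -/
noncomputable def contMap {d : ℕ} (α : ℝ) (V : Torus d → ℝ → ℝ) (b : Fin d → Torus d → ℝ)
    (lam : ℝ) (u m : Torus d → ℝ) (x : Torus d) : ℝ × ℝ :=
  (u x - lap u x + gradSq u x / (2 * m x ^ α) + lam * (∑ i, b i x * pderiv i u x)
      - lam * V x (m x) - (1 - lam) * Real.arctan (m x),
   m x - lap m x - divergence (fun i y => m y ^ (1 - α) * pderiv i u y) x
      - lam * divergence (fun i y => b i y * m y) x - 1)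

/-- `(u, m)` is a classical solution, in `E^{k₀+2}` and with `m > 0`, of `F(lam, u, m) = 0`. -/
structure IsSolution {d : ℕ} (k₀ : ℕ) (α : ℝ) (V : Torus d → ℝ → ℝ) (b : Fin d → Torus d → ℝ)
    (lam : ℝ) (u m : Torus d → ℝ) : Prop where
  u_C2 : TorusContDiff 2 u
  m_C2 : TorusContDiff 2 m
  u_mem : RepresentsH (k₀ + 2) u
  m_mem : RepresentsH (k₀ + 2) m
  m_pos : ∀ x, 0 < m x
  eq_zero : ∀ x, contMap α V b lam u m x = 0

open Classical in
/-- The product `a · w` of a function `a` and `w ∈ L²`, as an element of `L²` (every bounded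
measurable `a` is admissible; the value is `0` if the product is not in `L²`). -/
noncomputable def mulL2 {d : ℕ} (a : Torus d → ℝ) (w : L2 d) : L2 d :=
  if h : MemLp (fun x => a x * w x) 2 (torusMeasure d) then h.toLp _ else 0

/-- The weak Laplacian. -/
noncomputable def wlap {d : ℕ} (v : L2 d) : L2 d := ∑ i, wpderiv i (wpderiv i v)

/-- The weak divergence. -/
noncomputable def wdiv {d : ℕ} (X : Fin d → L2 d) : L2 d := ∑ i, wpderiv i (X i)

/-- First component of the linearization `𝓛` of `F(lam, ·, ·)` at `(u, m)`:
`v - Δv + m^{-α} Du·Dv - α |Du|² f / (2 m^{α+1}) + lam b·Dv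
  - (lam D_mV(x, m) + (1 - lam) V₀'(m)) f`. -/
noncomputable def linFst {d : ℕ} (α : ℝ) (V : Torus d → ℝ → ℝ) (b : Fin d → Torus d → ℝ)
    (lam : ℝ) (u m : Torus d → ℝ) (v f : L2 d) : L2 d :=
  v - wlap v
    + ∑ i, mulL2 (fun x => pderiv i u x / m x ^ α) (wpderiv i v)
    - mulL2 (fun x => α * gradSq u x / (2 * m x ^ (α + 1))) f
    + lam • ∑ i, mulL2 (b i) (wpderiv i v)
    - mulL2 (fun x => lam * deriv (V x) (m x) + (1 - lam) * deriv Real.arctan (m x)) f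

/-- Second component of the linearization `𝓛` of `F(lam, ·, ·)` at `(u, m)`:
`f - Δf - div(m^{1-α} Dv) - (1 - α) div(m^{-α} f Du) - lam div(b f)`. -/
noncomputable def linSnd {d : ℕ} (α : ℝ) (b : Fin d → Torus d → ℝ)
    (lam : ℝ) (u m : Torus d → ℝ) (v f : L2 d) : L2 d :=
  f - wlap f
    - wdiv (fun i => mulL2 (fun x => m x ^ (1 - α)) (wpderiv i v))
    - (1 - α) • wdiv (fun i => mulL2 (fun x => m x ^ (-α) * pderiv i u x) f)
    - lam • wdiv (fun i => mulL2 (b i) f)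

end MFG

/-!
The linearization is triangular up to lower order terms, so that it is an isomorphism as soon as it
is injective, and injectivity is the uniqueness argument for mean-field games.

*Fourier side.* A real function `u ∈ L²` is described by its Fourier coefficients `fc u n`. Weak
derivatives become multiplication by `2πi nᵢ` (`hasWeakPDeriv_iff`), and `u ∈ H^k` means that
`∑ (1 + |2πn|²)^k |fc u n|²` converges (`memH_iff`). For `s > d/2` the sum `∑ (1 + |2πn|²)^{-s}`
is finite, and Young's inequality for convolutions gives `H^s · H^j ⊆ H^j` for `j ≤ s`
(`MemH.mulL2`).

*Regularity of `(u, m)`.* Multiplication and the chain rule show that `G(x, m(x))` inherits the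
Sobolev regularity of `m` (`SobCont.comp`). The two equations of the nonlinear system then gain one
derivative at a time, first for `u` and then for `m`, so `u` and `m` lie in every `H^s`
(`IsSolution.sobCont`). Hence all coefficients of the linearization act on every `H^k`.

*Fredholm alternative.* With `R = (1 - Δ)⁻¹` and the unknowns `v = R p`, `f = R q`, the linearized
operator becomes `(p, q) ↦ (p, q + m^{1-α} p)` plus a compact operator on `L² × L²` which gains one
derivative (`sysFst_resolvent`, `sysSnd_resolvent`). If it is injective, it is bijective on
`L² × L²`, and the gain of derivatives makes its inverse map `E^k` into `E^{k+2}`; boundedness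
follows from the closed graph theorem and completeness of `H^k`
(`exists_continuousLinearEquiv`).

*Injectivity.* For `(v, f)` in the kernel, the first equation tested with `f` and the second one
tested with `v` have the same second-order terms. Their difference is the integral of a
quadratic form in `(Dv, f)` which dominates `(1 - α/2) m^{1-α} |Dv|²`, because `0 ≤ α < 1` and
`V` and `arctan` are non-decreasing (`lin_quadratic_form`). So `Dv = 0`, then `v = 0` by the first
equation, and the second one becomes `f - Δf - div(c f) = 0`. Testing it with a smooth approximation
of the sign of `f` gives `∫ |f| = 0` (`eq_zero_of_divergence_eq`). Monotonicity alone would not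
exclude a nonzero `f` here, since the coefficient of `f` in the first equation may vanish.
-/

namespace MFG

variable {d : ℕ}

/-! ### Real `L²` functions and their Fourier coefficients -/

/-- The inclusion of real into complex `L²` functions. -/
noncomputable def toComplexL2 (d : ℕ) : L2 d →L[ℝ] Lp ℂ 2 (torusMeasure d) :=
  Complex.ofRealCLM.compLpL 2 (torusMeasure d)

theorem coeFn_toComplexL2 (u : L2 d) :
    toComplexL2 d u =ᵐ[torusMeasure d] fun x => ((u x : ℝ) : ℂ) :=
  ContinuousLinearMap.coeFn_compLpL (L := Complex.ofRealCLM) u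

/-- The real part of a complex `L²` function. -/
noncomputable def rePartL2 (d : ℕ) : Lp ℂ 2 (torusMeasure d) →L[ℝ] L2 d :=
  Complex.reCLM.compLpL 2 (torusMeasure d)

theorem coeFn_rePartL2 (u : Lp ℂ 2 (torusMeasure d)) :
    rePartL2 d u =ᵐ[torusMeasure d] fun x => (u x).re :=
  ContinuousLinearMap.coeFn_compLpL (L := Complex.reCLM) u

/-- The exponentials `x ↦ exp (2πi n·x)`, as a Hilbert basis for the measure `torusMeasure d`. -/
noncomputable def expBasis (d : ℕ) :
    HilbertBasis (Fin d → ℤ) ℂ (Lp ℂ 2 (torusMeasure d)) :=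
  UnitAddTorus.mFourierBasis

theorem expBasis_repr (U : Lp ℂ 2 (torusMeasure d)) (n : Fin d → ℤ) :
    (expBasis d).repr U n = ∫ x, UnitAddTorus.mFourier (-n) x * U x ∂(torusMeasure d) :=
  UnitAddTorus.mFourierBasis_repr U n

theorem hasSum_expBasis (U W : Lp ℂ 2 (torusMeasure d)) :
    HasSum (fun n => conj ((expBasis d).repr U n) * (expBasis d).repr W n)
      (∫ x, conj (U x) * W x ∂(torusMeasure d)) := by
  simp only [expBasis_repr]
  exact UnitAddTorus.hasSum_prod_mFourierCoeff (d := Fin d) U W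

theorem integrable_mFourier_mul (n : Fin d → ℤ) {U : Torus d → ℂ}
    (hU : Integrable U (torusMeasure d)) :
    Integrable (fun x => UnitAddTorus.mFourier n x * U x) (torusMeasure d) := by
  refine Integrable.bdd_mul (c := ‖UnitAddTorus.mFourier n‖) hU ?_ ?_
  · exact (UnitAddTorus.mFourier n).continuous.aestronglyMeasurable
  · exact Filter.Eventually.of_forall fun x => ContinuousMap.norm_coe_le_norm _ x

/-- The `n`-th Fourier coefficient of a real `L²` function. -/
noncomputable def fc (u : L2 d) (n : Fin d → ℤ) : ℂ :=
  ∫ x, UnitAddTorus.mFourier (-n) x * ((u x : ℝ) : ℂ) ∂(torusMeasure d)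

theorem fc_eq_repr (u : L2 d) (n : Fin d → ℤ) :
    fc u n = (expBasis d).repr (toComplexL2 d u) n := by
  rw [expBasis_repr]
  refine integral_congr_ae ?_
  filter_upwards [coeFn_toComplexL2 u] with x hx
  rw [hx]

theorem fc_add (u v : L2 d) (n : Fin d → ℤ) : fc (u + v) n = fc u n + fc v n := by
  simp [fc_eq_repr]

theorem fc_smul (c : ℝ) (u : L2 d) (n : Fin d → ℤ) : fc (c • u) n = c * fc u n := by
  have : toComplexL2 d (c • u) = (c : ℂ) • toComplexL2 d u := (toComplexL2 d).map_smul c u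
  rw [fc_eq_repr, fc_eq_repr, this, map_smul]
  rfl

theorem fc_sub (u v : L2 d) (n : Fin d → ℤ) : fc (u - v) n = fc u n - fc v n := by
  simp [fc_eq_repr]

theorem fc_zero (n : Fin d → ℤ) : fc (0 : L2 d) n = 0 := by
  simp [fc_eq_repr]

theorem fc_sum {ι : Type*} (s : Finset ι) (u : ι → L2 d) (n : Fin d → ℤ) :
    fc (∑ i ∈ s, u i) n = ∑ i ∈ s, fc (u i) n := by
  classical
  induction s using Finset.induction_on with
  | empty => simp [fc_zero]
  | insert a s ha ih => rw [Finset.sum_insert ha, Finset.sum_insert ha, fc_add, ih]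

theorem fc_neg_index (u : L2 d) (n : Fin d → ℤ) : fc u (-n) = conj (fc u n) := by
  unfold fc
  rw [← integral_conj]
  refine integral_congr_ae (Filter.Eventually.of_forall fun x => ?_)
  simp [UnitAddTorus.mFourier_neg]

theorem hasSum_inner (u v : L2 d) :
    HasSum (fun n => conj (fc u n) * fc v n) ((inner ℝ u v : ℝ) : ℂ) := by
  have h := hasSum_expBasis (toComplexL2 d u) (toComplexL2 d v)
  simp only [← fc_eq_repr] at h
  convert h using 1
  rw [L2.inner_def, ← integral_complex_ofReal]
  refine integral_congr_ae ?_
  filter_upwards [coeFn_toComplexL2 u, coeFn_toComplexL2 v] with x hx hy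
  simp [hx, hy, mul_comm]

theorem hasSum_fc_sq (u : L2 d) : HasSum (fun n => ‖fc u n‖ ^ 2) (‖u‖ ^ 2) := by
  have h := Complex.hasSum_re (hasSum_inner u u)
  rw [Complex.ofReal_re, real_inner_self_eq_norm_sq] at h
  convert h using 2 with n
  rw [← Complex.normSq_eq_conj_mul_self, Complex.ofReal_re, Complex.normSq_eq_norm_sq]

theorem fc_injective {u v : L2 d} (h : ∀ n, fc u n = fc v n) : u = v := by
  have h1 := hasSum_fc_sq (u - v)
  have h2 : (fun n => ‖fc (u - v) n‖ ^ 2) = fun _ => 0 := by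
    funext n; simp [fc_sub, h]
  rw [h2] at h1
  have h3 : ‖u - v‖ ^ 2 = 0 := h1.unique hasSum_zero
  exact sub_eq_zero.1 (norm_eq_zero.1 (by simpa using h3))

/-- **Riesz–Fischer** for real functions: a Hermitian square-summable sequence is the sequence of
Fourier coefficients of a real `L²` function. -/
theorem exists_fc_eq {s : (Fin d → ℤ) → ℂ} (hs : Summable fun n => ‖s n‖ ^ 2)
    (hs' : ∀ n, s (-n) = conj (s n)) : ∃ u : L2 d, ∀ n, fc u n = s n := by
  have hmem : Memℓp s 2 := memℓp_gen (by simpa using hs)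
  set U : Lp ℂ 2 (torusMeasure d) := (expBasis d).repr.symm ⟨s, hmem⟩ with hU
  have hr : ∀ n, (expBasis d).repr U n = s n := fun n => by simp [hU]
  have hint : Integrable (fun x => U x) (torusMeasure d) := (Lp.memLp U).integrable (by norm_num)
  refine ⟨rePartL2 d U, fun n => ?_⟩
  have h1 : fc (rePartL2 d U) n
      = (1 / 2 : ℂ) * ((∫ x, UnitAddTorus.mFourier (-n) x * U x ∂(torusMeasure d))
        + conj (∫ x, UnitAddTorus.mFourier (-(-n)) x * U x ∂(torusMeasure d))) := by
    unfold fc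
    rw [← integral_conj, ← integral_add, ← integral_const_mul]
    · refine integral_congr_ae ?_
      filter_upwards [coeFn_rePartL2 U] with x hx
      rw [hx, Complex.re_eq_add_conj]
      simp only [map_mul, ← UnitAddTorus.mFourier_neg, neg_neg]
      ring
    · exact integrable_mFourier_mul _ hint
    · exact Complex.conjCLE.integrable_comp_iff.2 (integrable_mFourier_mul (-(-n)) hint)
  rw [h1, ← expBasis_repr, ← expBasis_repr, hr, hr, hs']
  simp; ring

/-! ### Integration by parts on the torus -/

theorem TorusContDiff.of_le {m n : WithTop ℕ∞} {φ : Torus d → ℝ} (h : TorusContDiff n φ)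
    (hmn : m ≤ n) : TorusContDiff m φ :=
  ContDiff.of_le h hmn

theorem TorusContDiff.hasDerivAt {n : WithTop ℕ∞} {φ : Torus d → ℝ} (h : TorusContDiff n φ)
    (hn : n ≠ 0) (i : Fin d) (x : Torus d) (t : ℝ) :
    HasDerivAt (fun s : ℝ => φ (x + Pi.single i (s : UnitAddCircle)))
      (pderiv i φ (x + Pi.single i (t : UnitAddCircle))) t := by
  obtain ⟨y, rfl⟩ := toTorus_isQuotientMap.surjective x
  simp only [toTorus_add_single]
  rw [h.pderiv_eq hn]
  have h1 : HasFDerivAt (fun z => φ (toTorus z))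
      (fderiv ℝ (fun z => φ (toTorus z)) (y + t • Pi.single i 1)) (y + t • Pi.single i 1) :=
    ((ContDiff.differentiable h hn) _).hasFDerivAt
  have h2 : HasDerivAt (fun s : ℝ => y + s • (Pi.single i 1 : Fin d → ℝ)) (Pi.single i 1) t := by
    simpa using ((hasDerivAt_id t).smul_const (Pi.single i 1 : Fin d → ℝ)).const_add y
  exact h1.comp_hasDerivAt t h2

theorem TorusContDiff.hasDerivAt_zero {n : WithTop ℕ∞} {φ : Torus d → ℝ} (h : TorusContDiff n φ)
    (hn : n ≠ 0) (i : Fin d) (x : Torus d) :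
    HasDerivAt (fun s : ℝ => φ (x + Pi.single i (s : UnitAddCircle))) (pderiv i φ x) 0 := by
  simpa using h.hasDerivAt hn i x 0

theorem TorusContDiff.pderiv {m n : WithTop ℕ∞} {φ : Torus d → ℝ} (h : TorusContDiff n φ)
    (hmn : m + 1 ≤ n) (i : Fin d) : TorusContDiff m (pderiv i φ) := by
  have hn : n ≠ 0 := by
    rintro rfl
    simp at hmn
  unfold TorusContDiff
  simp only [h.pderiv_eq hn i]
  exact (ContDiff.fderiv_right (m := m) h hmn).clm_apply contDiff_const

theorem TorusContDiff.mul {n : WithTop ℕ∞} {φ ψ : Torus d → ℝ} (h : TorusContDiff n φ)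
    (h' : TorusContDiff n ψ) : TorusContDiff n (fun x => φ x * ψ x) :=
  ContDiff.mul h h'

theorem pderiv_mul {n : WithTop ℕ∞} {φ ψ : Torus d → ℝ} (h : TorusContDiff n φ)
    (h' : TorusContDiff n ψ) (hn : n ≠ 0) (i : Fin d) (x : Torus d) :
    pderiv i (fun y => φ y * ψ y) x = pderiv i φ x * ψ x + φ x * pderiv i ψ x := by
  have h1 := ((h.hasDerivAt_zero hn i x).mul (h'.hasDerivAt_zero hn i x)).deriv
  simp only [AddCircle.coe_zero, Pi.single_zero, add_zero] at h1
  exact h1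

instance instIsAddRightInvariantTorus : (torusMeasure d).IsAddRightInvariant := by
  unfold torusMeasure; infer_instance

theorem integrable_of_continuous {φ : Torus d → ℝ} (h : Continuous φ) :
    Integrable φ (torusMeasure d) :=
  h.integrable_of_hasCompactSupport (HasCompactSupport.of_compactSpace φ)

theorem exists_bound_of_continuous {φ : Torus d → ℝ} (h : Continuous φ) :
    ∃ C, ∀ x, ‖φ x‖ ≤ C :=
  ⟨‖(⟨φ, h⟩ : C(Torus d, ℝ))‖, fun x => ContinuousMap.norm_coe_le_norm ⟨φ, h⟩ x⟩

/-- Translation invariance of the measure makes `t ↦ ∫ φ (x + t eᵢ)` constant; its derivative at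
`0` is the integral of `∂ᵢφ`. -/
theorem integral_pderiv_eq_zero {φ : Torus d → ℝ} (h : TorusContDiff 1 φ) (i : Fin d) :
    ∫ x, pderiv i φ x ∂(torusMeasure d) = 0 := by
  have hc : Continuous (pderiv i φ) := (h.pderiv (m := 0) (by simp) i).continuous
  obtain ⟨C, hC⟩ := exists_bound_of_continuous hc
  have hF : ∀ t : ℝ, Continuous fun x : Torus d => φ (x + Pi.single i (t : UnitAddCircle)) :=
    fun t => h.continuous.comp (continuous_add_const _)
  have hF' : ∀ t : ℝ,
      Continuous fun x : Torus d => pderiv i φ (x + Pi.single i (t : UnitAddCircle)) :=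
    fun t => hc.comp (continuous_add_const _)
  have h1 : HasDerivAt (fun t : ℝ => ∫ x, φ (x + Pi.single i (t : UnitAddCircle)) ∂(torusMeasure d))
      (∫ x, pderiv i φ (x + Pi.single i ((0 : ℝ) : UnitAddCircle)) ∂(torusMeasure d)) 0 := by
    refine (hasDerivAt_integral_of_dominated_loc_of_deriv_le (μ := torusMeasure d) (𝕜 := ℝ)
      (F := fun (t : ℝ) (x : Torus d) => φ (x + Pi.single i (t : UnitAddCircle)))
      (F' := fun (t : ℝ) (x : Torus d) => pderiv i φ (x + Pi.single i (t : UnitAddCircle)))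
      (bound := fun _ => C) (s := univ) Filter.univ_mem ?_ ?_ ?_ ?_ ?_ ?_).2
    · exact Filter.Eventually.of_forall fun t => (hF t).aestronglyMeasurable
    · exact integrable_of_continuous (hF 0)
    · exact (hF' 0).aestronglyMeasurable
    · exact Filter.Eventually.of_forall fun x t _ => hC _
    · exact integrable_const C
    · exact Filter.Eventually.of_forall fun x t _ => h.hasDerivAt one_ne_zero i x t
  have h2 : (fun t : ℝ => ∫ x, φ (x + Pi.single i (t : UnitAddCircle)) ∂(torusMeasure d))
      = fun _ => ∫ x, φ x ∂(torusMeasure d) := by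
    funext t
    exact integral_add_right_eq_self φ _
  rw [h2] at h1
  simpa using h1.unique (hasDerivAt_const _ _)

open Classical in
/-- The class in `L²` of a function on the torus (with the value `0` if it is not in `L²`). -/
noncomputable def classL2 (φ : Torus d → ℝ) : L2 d :=
  if h : MemLp φ 2 (torusMeasure d) then h.toLp φ else 0

theorem memLp_of_continuous {φ : Torus d → ℝ} (h : Continuous φ) : MemLp φ 2 (torusMeasure d) :=
  MemLp.of_bound h.aestronglyMeasurable _ (Filter.Eventually.of_forall
    (exists_bound_of_continuous h).choose_spec)

theorem coeFn_classL2 {φ : Torus d → ℝ} (h : Continuous φ) :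
    classL2 φ =ᵐ[torusMeasure d] φ := by
  unfold classL2
  rw [dif_pos (memLp_of_continuous h)]
  exact MemLp.coeFn_toLp _

theorem inner_classL2 (u : L2 d) {φ : Torus d → ℝ} (h : Continuous φ) :
    inner ℝ u (classL2 φ) = ∫ x, u x * φ x ∂(torusMeasure d) := by
  rw [L2.inner_def]
  refine integral_congr_ae ?_
  filter_upwards [coeFn_classL2 h] with x hx
  simp [hx, mul_comm]

theorem integral_mul_pderiv {φ ψ : Torus d → ℝ} (h : TorusContDiff 1 φ)
    (h' : TorusContDiff 1 ψ) (i : Fin d) :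
    ∫ x, φ x * pderiv i ψ x ∂(torusMeasure d) = -∫ x, pderiv i φ x * ψ x ∂(torusMeasure d) := by
  have h0 := integral_pderiv_eq_zero (h.mul h') i
  simp only [pderiv_mul h h' one_ne_zero] at h0
  have hc := (h.pderiv (m := 0) (by simp) i).continuous
  have hc' := (h'.pderiv (m := 0) (by simp) i).continuous
  have h1 : Integrable (fun x => pderiv i φ x * ψ x) (torusMeasure d) :=
    integrable_of_continuous (hc.mul h'.continuous)
  have h2 : Integrable (fun x => φ x * pderiv i ψ x) (torusMeasure d) :=
    integrable_of_continuous (h.continuous.mul hc')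
  rw [integral_add h1 h2] at h0
  linarith

/-- The classical partial derivative of a `C¹` function is its weak derivative. -/
theorem hasWeakPDeriv_classL2 {φ : Torus d → ℝ} (h : TorusContDiff 1 φ) (i : Fin d) :
    HasWeakPDeriv i (classL2 φ) (classL2 (pderiv i φ)) := by
  intro ψ hψ
  have hc := (h.pderiv (m := 0) (by simp) i).continuous
  have h1 := integral_mul_pderiv h (hψ.of_le (by simp)) i
  convert h1 using 1
  · refine integral_congr_ae ?_
    filter_upwards [coeFn_classL2 h.continuous] with x hx
    rw [hx]
  · congr 1
    refine integral_congr_ae ?_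
    filter_upwards [coeFn_classL2 hc] with x hx
    rw [hx]

/-! ### Weak derivatives on the Fourier side -/

/-- The Fourier symbol `2πi nᵢ` of the partial derivative `∂ᵢ`. -/
noncomputable def dsymb (i : Fin d) (n : Fin d → ℤ) : ℂ := 2 * Real.pi * Complex.I * n i

theorem conj_dsymb (i : Fin d) (n : Fin d → ℤ) : conj (dsymb i n) = -dsymb i n := by
  simp [dsymb, Complex.conj_ofNat]

theorem dsymb_neg (i : Fin d) (n : Fin d → ℤ) : dsymb i (-n) = -dsymb i n := by
  simp [dsymb]

theorem mFourier_add_single (n : Fin d → ℤ) (i : Fin d) (x : Torus d) (t : ℝ) :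
    UnitAddTorus.mFourier n (x + Pi.single i (t : UnitAddCircle))
      = Complex.exp (dsymb i n * t) * UnitAddTorus.mFourier n x := by
  have h1 : UnitAddTorus.mFourier n (x + Pi.single i (t : UnitAddCircle))
      = UnitAddTorus.mFourier n x * UnitAddTorus.mFourier n (Pi.single i (t : UnitAddCircle)) := by
    simp only [UnitAddTorus.mFourier, ContinuousMap.coe_mk, ← Finset.prod_mul_distrib,
      Pi.add_apply]
    refine Finset.prod_congr rfl fun j _ => ?_
    simp [fourier_apply, smul_add, AddCircle.toCircle_add]
  rw [h1, mul_comm]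
  congr 1
  have : ∀ j, fourier (n j) ((Pi.single i (t : UnitAddCircle) : Torus d) j)
      = if j = i then Complex.exp (dsymb i n * t) else 1 := by
    intro j
    by_cases hj : j = i
    · subst hj
      simp [dsymb]
    · simp [hj]
  simp only [UnitAddTorus.mFourier, ContinuousMap.coe_mk, this]
  simp

theorem hasDerivAt_mFourier (n : Fin d → ℤ) (i : Fin d) (x : Torus d) :
    HasDerivAt (fun t : ℝ => UnitAddTorus.mFourier n (x + Pi.single i (t : UnitAddCircle)))
      (dsymb i n * UnitAddTorus.mFourier n x) 0 := by
  simp only [mFourier_add_single]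
  have h1 : HasDerivAt (fun t : ℝ => Complex.exp (dsymb i n * t)) (dsymb i n) 0 := by
    have h2 : HasDerivAt (fun t : ℝ => dsymb i n * (t : ℂ)) (dsymb i n) 0 := by
      simpa using (Complex.ofRealCLM.hasDerivAt (x := (0 : ℝ))).const_mul (dsymb i n)
    simpa using h2.cexp
  exact h1.mul_const _

/-- The real part of a trigonometric monomial with complex amplitude. -/
noncomputable def reMono (c : ℂ) (n : Fin d → ℤ) (x : Torus d) : ℝ :=
  (c * UnitAddTorus.mFourier n x).re

theorem reMono_smooth (c : ℂ) (n : Fin d → ℤ) : TorusContDiff ∞ (reMono c n) :=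
  Complex.reCLM.contDiff.comp (contDiff_const.mul (mFourier_lift_contDiff n))

theorem pderiv_reMono (c : ℂ) (n : Fin d → ℤ) (i : Fin d) :
    pderiv i (reMono c n) = reMono (c * dsymb i n) n := by
  funext x
  have h := Complex.reCLM.hasFDerivAt.comp_hasDerivAt (0 : ℝ)
    ((hasDerivAt_mFourier n i x).const_mul c)
  have h2 := h.deriv
  simp only [Function.comp_def, Complex.reCLM_apply] at h2
  unfold pderiv reMono
  rw [h2, mul_assoc]

theorem integral_mul_reMono (u : L2 d) (c : ℂ) (n : Fin d → ℤ) :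
    ∫ x, u x * reMono c n x ∂(torusMeasure d) = (c * fc u (-n)).re := by
  have hint : Integrable (fun x => ((u x : ℝ) : ℂ)) (torusMeasure d) :=
    ((Lp.memLp u).integrable (by norm_num)).ofReal
  unfold fc
  rw [← integral_const_mul, neg_neg, ← Complex.reCLM_apply,
    ← ContinuousLinearMap.integral_comp_comm _ ((integrable_mFourier_mul n hint).const_mul c)]
  refine integral_congr_ae (Filter.Eventually.of_forall fun x => ?_)
  simp only [reMono, Complex.reCLM_apply, ← mul_assoc, Complex.re_mul_ofReal]
  ring

theorem HasWeakPDeriv.fc_eq {i : Fin d} {u g : L2 d} (h : HasWeakPDeriv i u g)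
    (n : Fin d → ℤ) : fc g n = dsymb i n * fc u n := by
  have key : ∀ c : ℂ, (c * (dsymb i n * fc u n)).re = (c * fc g n).re := by
    intro c
    have h1 := h _ (reMono_smooth c (-n))
    rw [pderiv_reMono, integral_mul_reMono, integral_mul_reMono, neg_neg, dsymb_neg] at h1
    rw [← neg_inj, ← h1, ← Complex.neg_re]
    congr 1; ring
  apply Complex.ext
  · simpa using (key 1).symm
  · have h1 := key Complex.I
    simp only [Complex.I_mul_re, neg_inj] at h1
    exact h1.symm

theorem inner_eq_neg_inner_of_fc {i : Fin d} {u g v h : L2 d}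
    (hu : ∀ n, fc g n = dsymb i n * fc u n) (hv : ∀ n, fc h n = dsymb i n * fc v n) :
    inner ℝ u h = -inner ℝ g v := by
  have h1 := hasSum_inner u h
  have h2 := (hasSum_inner g v).neg
  have : (fun n => conj (fc u n) * fc h n) = fun n => -(conj (fc g n) * fc v n) := by
    funext n
    rw [hu, hv, map_mul, conj_dsymb]; ring
  rw [this] at h1
  exact_mod_cast h1.unique h2

theorem hasWeakPDeriv_iff {i : Fin d} {u g : L2 d} :
    HasWeakPDeriv i u g ↔ ∀ n, fc g n = dsymb i n * fc u n := by
  refine ⟨fun h => h.fc_eq, fun h φ hφ => ?_⟩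
  have h1 : TorusContDiff 1 φ := hφ.of_le (by simp)
  have h2 := inner_eq_neg_inner_of_fc h (hasWeakPDeriv_classL2 h1 i).fc_eq
  rwa [inner_classL2 _ (h1.pderiv (m := 0) (by simp) i).continuous,
    inner_classL2 _ h1.continuous] at h2

/-- Integration by parts in `H¹`. -/
theorem HasWeakPDeriv.inner_eq {i : Fin d} {u g v h : L2 d} (hu : HasWeakPDeriv i u g)
    (hv : HasWeakPDeriv i v h) : inner ℝ u h = -inner ℝ g v :=
  inner_eq_neg_inner_of_fc hu.fc_eq hv.fc_eq

/-! ### Sobolev spaces on the Fourier side -/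

/-- The Fourier symbol `1 + ∑ᵢ (2πnᵢ)²` of `1 - Δ`. -/
noncomputable def wt (n : Fin d → ℤ) : ℝ := 1 + ∑ i, (2 * Real.pi * n i) ^ 2

theorem one_le_wt (n : Fin d → ℤ) : 1 ≤ wt n := by
  have : 0 ≤ ∑ i, (2 * Real.pi * n i) ^ 2 := Finset.sum_nonneg fun i _ => sq_nonneg _
  unfold wt; linarith

theorem wt_pos (n : Fin d → ℤ) : 0 < wt n := one_pos.trans_le (one_le_wt n)

theorem wt_neg (n : Fin d → ℤ) : wt (-n) = wt n := by simp [wt]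

theorem norm_dsymb_sq (i : Fin d) (n : Fin d → ℤ) : ‖dsymb i n‖ ^ 2 = (2 * Real.pi * n i) ^ 2 := by
  simp [dsymb, mul_pow]

theorem norm_dsymb_sq_le (i : Fin d) (n : Fin d → ℤ) : ‖dsymb i n‖ ^ 2 ≤ wt n := by
  rw [norm_dsymb_sq, wt]
  have := Finset.single_le_sum (f := fun i => (2 * Real.pi * (n i : ℝ)) ^ 2)
    (fun i _ => sq_nonneg _) (Finset.mem_univ i)
  linarith

theorem wt_eq (n : Fin d → ℤ) : (wt n : ℂ) = 1 - ∑ i, dsymb i n * dsymb i n := by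
  simp only [wt, dsymb]
  push_cast
  rw [sub_eq_add_neg, ← Finset.sum_neg_distrib]
  congr 1
  refine Finset.sum_congr rfl fun i _ => ?_
  linear_combination ((2 * Real.pi * (n i : ℂ)) ^ 2) * Complex.I_sq

theorem MemH.of_succ {k : ℕ} {u : L2 d} (h : MemH (k + 1) u) : MemH k u := by
  induction k generalizing u with
  | zero => trivial
  | succ k ih =>
    intro i
    obtain ⟨g, hg, hg'⟩ := h i
    exact ⟨g, hg, ih hg'⟩

theorem MemH.mono {j k : ℕ} (hjk : j ≤ k) {u : L2 d} (h : MemH k u) : MemH j u := by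
  induction hjk with
  | refl => exact h
  | step _ ih => exact ih h.of_succ

/-- `u ∈ H^k` if and only if `∑ (1 + |2πn|²)^k |û(n)|²` is finite. -/
theorem memH_iff {k : ℕ} {u : L2 d} :
    MemH k u ↔ Summable fun n => wt n ^ k * ‖fc u n‖ ^ 2 := by
  induction k generalizing u with
  | zero => simpa [MemH] using (hasSum_fc_sq u).summable
  | succ k ih =>
    constructor
    · intro h
      have h0 := ih.1 h.of_succ
      choose g hg hg' using h
      have h1 := h0.add (summable_sum fun i (_ : i ∈ Finset.univ) => ih.1 (hg' i))
      refine h1.congr fun n => ?_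
      have : ∀ i, wt n ^ k * ‖fc (g i) n‖ ^ 2
          = wt n ^ k * ‖fc u n‖ ^ 2 * (2 * Real.pi * n i) ^ 2 := by
        intro i
        rw [(hg i).fc_eq, norm_mul, mul_pow, norm_dsymb_sq]; ring
      simp only [this]
      rw [← Finset.mul_sum, pow_succ, wt]; ring
    · intro h i
      have hle : ∀ n, wt n ^ k * ‖dsymb i n * fc u n‖ ^ 2 ≤ wt n ^ (k + 1) * ‖fc u n‖ ^ 2 := by
        intro n
        rw [norm_mul, mul_pow, pow_succ (wt n), mul_assoc]
        have := norm_dsymb_sq_le i n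
        have h2 := wt_pos n
        gcongr
      have hs : Summable fun n => wt n ^ k * ‖dsymb i n * fc u n‖ ^ 2 :=
        h.of_nonneg_of_le (fun n => by have := wt_pos n; positivity) hle
      obtain ⟨g, hg⟩ := exists_fc_eq (s := fun n => dsymb i n * fc u n)
        (hs.of_nonneg_of_le (fun n => by positivity) fun n =>
          le_mul_of_one_le_left (by positivity) (one_le_pow₀ (one_le_wt n)))
        (fun n => by simp [fc_neg_index, dsymb_neg, conj_dsymb])
      refine ⟨g, hasWeakPDeriv_iff.2 hg, ih.2 ?_⟩
      simpa only [hg] using hs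

theorem MemH.hasWeakPDeriv {k : ℕ} {u : L2 d} (h : MemH (k + 1) u) (i : Fin d) :
    HasWeakPDeriv i u (wpderiv i u) := by
  obtain ⟨g, hg, -⟩ := h i
  rwa [hg.wpderiv_eq]

theorem MemH.wpderiv {k : ℕ} {u : L2 d} (h : MemH (k + 1) u) (i : Fin d) :
    MemH k (wpderiv i u) := by
  obtain ⟨g, hg, hg'⟩ := h i
  rwa [hg.wpderiv_eq]

theorem MemH.fc_wpderiv {k : ℕ} {u : L2 d} (h : MemH (k + 1) u) (i : Fin d) (n : Fin d → ℤ) :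
    fc (MFG.wpderiv i u) n = dsymb i n * fc u n :=
  (h.hasWeakPDeriv i).fc_eq n

theorem MemH.neg {k : ℕ} {u : L2 d} (h : MemH k u) : MemH k (-u) := by
  simpa using h.smul (-1)

theorem MemH.sub {k : ℕ} {u v : L2 d} (h : MemH k u) (h' : MemH k v) : MemH k (u - v) := by
  rw [sub_eq_add_neg]; exact h.add h'.neg

theorem MemH.sum {k : ℕ} {ι : Type*} {s : Finset ι} {u : ι → L2 d} (h : ∀ i ∈ s, MemH k (u i)) :
    MemH k (∑ i ∈ s, u i) :=
  Submodule.sum_mem (sobolevSubmodule d k) h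

/-- Elliptic regularity for `1 - Δ`, in terms of Fourier coefficients. -/
theorem memH_add_two_of_fc {k : ℕ} {u R : L2 d} (hR : MemH k R)
    (h : ∀ n, (wt n : ℂ) * fc u n = fc R n) : MemH (k + 2) u := by
  rw [memH_iff] at hR ⊢
  refine hR.congr fun n => ?_
  rw [← h, norm_mul, mul_pow, Complex.norm_real, Real.norm_eq_abs, sq_abs]; ring

/-- The sum `∑ₙ (1 + |2πn|²)^{-s}` over `ℤ^d` converges for `2s > d`. -/
theorem summable_wt_inv {s : ℕ} (hs : d < 2 * s) :
    Summable fun n : Fin d → ℤ => (wt n ^ s)⁻¹ := by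
  classical
  let b := Pi.basisFun ℝ (Fin d)
  let Λ : Submodule ℤ (Fin d → ℝ) := Submodule.span ℤ (Set.range b)
  have hfin : Module.finrank ℤ Λ = d := by
    rw [Module.finrank_eq_card_basis (b.restrictScalars ℤ)]; simp
  have h1 := ZLattice.summable_norm_pow_inv (L := Λ) (2 * s) (by omega)
  have hmem : ∀ n : Fin d → ℤ, (fun i => (n i : ℝ)) ∈ Λ := by
    intro n
    have : (fun i => (n i : ℝ)) = ∑ i, n i • b i := by
      funext j
      simp [b, Finset.sum_apply, Pi.single_apply]
    rw [this]
    exact Submodule.sum_mem _ fun i _ =>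
      Submodule.smul_mem _ _ (Submodule.subset_span ⟨i, rfl⟩)
  have hinj : Function.Injective fun n : Fin d → ℤ => (⟨fun i => (n i : ℝ), hmem n⟩ : Λ) := by
    intro n m h
    funext i
    have := congrFun (congrArg Subtype.val h) i
    simpa using this
  have h2 := h1.comp_injective hinj
  refine h2.of_norm_bounded_eventually ?_
  rw [Filter.eventually_cofinite]
  refine (Set.finite_singleton (0 : Fin d → ℤ)).subset fun n hn => ?_
  by_contra hn0
  refine hn ?_
  have hne : (fun i => (n i : ℝ)) ≠ 0 := by
    intro h
    refine hn0 (funext fun i => ?_)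
    simpa using congrFun h i
  have hpos : 0 < ‖fun i => (n i : ℝ)‖ := norm_pos_iff.2 hne
  have hle : ‖fun i => (n i : ℝ)‖ ^ 2 ≤ wt n := by
    have : ‖fun i => (n i : ℝ)‖ ≤ Real.sqrt (wt n) := by
      refine (pi_norm_le_iff_of_nonneg (Real.sqrt_nonneg _)).2 fun i => ?_
      refine Real.le_sqrt_of_sq_le ?_
      refine le_trans ?_ (norm_dsymb_sq_le i n)
      rw [norm_dsymb_sq, Real.norm_eq_abs, sq_abs, mul_pow]
      have : 1 ≤ (2 * Real.pi) ^ 2 := one_le_pow₀ (by linarith [Real.pi_gt_three])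
      exact le_mul_of_one_le_left (sq_nonneg _) this
    calc _ ≤ Real.sqrt (wt n) ^ 2 := by gcongr
      _ = wt n := Real.sq_sqrt (wt_pos n).le
  have hw := wt_pos n
  rw [Real.norm_of_nonneg (by positivity)]
  simp only [Function.comp_apply, pow_mul]
  change (wt n ^ s)⁻¹ ≤ ((‖fun i => (n i : ℝ)‖⁻¹ ^ 2) ^ s)
  rw [inv_pow, inv_pow]
  gcongr

theorem finite_setOf_wt_le {s : ℕ} (hs : d < 2 * s) (C : ℝ) :
    {n : Fin d → ℤ | wt n ≤ C}.Finite := by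
  by_cases hC : 0 < C
  · have h := (summable_wt_inv hs).tendsto_cofinite_zero.eventually
      (Iio_mem_nhds (show (0 : ℝ) < (C ^ s)⁻¹ by positivity))
    rw [Filter.eventually_cofinite] at h
    refine h.subset fun n hn => ?_
    have hw := wt_pos n
    simp only [mem_ofPred_eq, not_lt] at hn ⊢
    gcongr
  · convert Set.finite_empty
    ext n
    simpa using lt_of_le_of_lt (not_lt.1 hC) (wt_pos n)

/-! ### Products in Sobolev spaces -/

theorem memLp_mul {a : Torus d → ℝ} (ha : Continuous a) (w : L2 d) :
    MemLp (fun x => a x * w x) 2 (torusMeasure d) := by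
  obtain ⟨C, hC⟩ := exists_bound_of_continuous ha
  refine (Lp.memLp w).of_le_mul (c := C) (ha.aestronglyMeasurable.mul
    (Lp.aestronglyMeasurable w)) (Filter.Eventually.of_forall fun x => ?_)
  rw [norm_mul]
  exact mul_le_mul_of_nonneg_right (hC x) (norm_nonneg _)

theorem coeFn_mulL2 {a : Torus d → ℝ} (ha : Continuous a) (w : L2 d) :
    mulL2 a w =ᵐ[torusMeasure d] fun x => a x * w x := by
  unfold mulL2
  rw [dif_pos (memLp_mul ha w)]
  exact MemLp.coeFn_toLp _

theorem mulL2_classL2 {a φ : Torus d → ℝ} (ha : Continuous a) (hφ : Continuous φ) :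
    mulL2 a (classL2 φ) = classL2 (fun x => a x * φ x) := by
  refine Lp.ext ?_
  have hc : Continuous fun x => a x * φ x := ha.mul hφ
  filter_upwards [coeFn_mulL2 ha (classL2 φ), coeFn_classL2 hφ, coeFn_classL2 hc] with x h1 h2 h3
  rw [h1, h2, h3]

/-- Fourier coefficients of a product are given by convolution. -/
theorem norm_fc_mulL2_le {a : Torus d → ℝ} (ha : Continuous a) (g : L2 d) (n : Fin d → ℤ) :
    ENNReal.ofReal ‖fc (mulL2 a g) n‖
      ≤ ∑' k, ENNReal.ofReal ‖fc (classL2 a) k‖ * ENNReal.ofReal ‖fc g (n + k)‖ := by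
  have hg : MemLp (fun x => UnitAddTorus.mFourier (-n) x * ((g x : ℝ) : ℂ)) 2
      (torusMeasure d) := by
    have hg0 : MemLp (fun x => ((g x : ℝ) : ℂ)) 2 (torusMeasure d) := (Lp.memLp g).ofReal
    refine MemLp.of_le_mul (c := ‖UnitAddTorus.mFourier (-n)‖) hg0
      ((UnitAddTorus.mFourier (-n)).continuous.aestronglyMeasurable.mul hg0.aestronglyMeasurable)
      (Filter.Eventually.of_forall fun x => ?_)
    rw [norm_mul]
    exact mul_le_mul_of_nonneg_right (ContinuousMap.norm_coe_le_norm _ x) (norm_nonneg _)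
  have h := hasSum_expBasis (toComplexL2 d (classL2 a)) (hg.toLp _)
  have h1 : ∀ k, (expBasis d).repr (hg.toLp _) k = fc g (n + k) := by
    intro k
    rw [expBasis_repr]
    refine integral_congr_ae ?_
    filter_upwards [hg.coeFn_toLp] with x hx
    rw [hx, ← mul_assoc, ← UnitAddTorus.mFourier_add, neg_add_rev]
  have h2 : ∫ x, conj (toComplexL2 d (classL2 a) x) * hg.toLp _ x ∂(torusMeasure d)
      = fc (mulL2 a g) n := by
    refine integral_congr_ae ?_
    filter_upwards [hg.coeFn_toLp, coeFn_toComplexL2 (classL2 a), coeFn_classL2 ha,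
      coeFn_mulL2 ha g] with x h1 h2 h3 h4
    rw [h1, h2, h3, h4, Complex.conj_ofReal]
    push_cast; ring
  rw [h2] at h
  simp only [h1, ← fc_eq_repr] at h
  rw [← h.tsum_eq]
  simp only [ofReal_norm, ← enorm_mul]
  refine enorm_tsum_le_tsum_enorm.trans_eq (tsum_congr fun k => ?_)
  rw [enorm_mul, enorm_mul, RCLike.enorm_conj]

theorem ennreal_mul_le_sq_add_sq (a b : ENNReal) : a * b ≤ a ^ 2 + b ^ 2 := by
  rcases le_total a b with h | h
  · exact (mul_le_mul_left h b).trans ((sq b).symm.le.trans le_add_self)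
  · exact (mul_le_mul_right h a).trans ((sq a).symm.le.trans le_self_add)

/-- Young's inequality `ℓ¹ * ℓ² ⊆ ℓ²` for convolutions on a group, with a non-optimal constant. -/
theorem tsum_conv_sq_le {G : Type*} [AddCommGroup G] (p q : G → ENNReal) :
    ∑' n, (∑' k, p k * q (n + k)) ^ 2 ≤ (∑' k, p k) * (∑' k, p k) * (2 * ∑' n, q n ^ 2) := by
  have hshift : ∀ k, ∑' n, q (n + k) ^ 2 = ∑' n, q n ^ 2 := fun k =>
    (Equiv.addRight k).tsum_eq fun n => q n ^ 2
  calc ∑' n, (∑' k, p k * q (n + k)) ^ 2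
      = ∑' n, ∑' k, ∑' l, p k * p l * (q (n + k) * q (n + l)) := by
        refine tsum_congr fun n => ?_
        rw [sq, ← ENNReal.tsum_mul_right]
        refine tsum_congr fun k => ?_
        rw [← ENNReal.tsum_mul_left]
        exact tsum_congr fun l => by ring
    _ ≤ ∑' n, ∑' k, ∑' l, p k * p l * (q (n + k) ^ 2 + q (n + l) ^ 2) := by
        gcongr
        exact ennreal_mul_le_sq_add_sq _ _
    _ = ∑' k, ∑' l, p k * p l * (2 * ∑' n, q n ^ 2) := by
        rw [ENNReal.tsum_comm]
        refine tsum_congr fun k => ?_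
        rw [ENNReal.tsum_comm]
        refine tsum_congr fun l => ?_
        rw [ENNReal.tsum_mul_left, ENNReal.tsum_add, hshift, hshift, two_mul]
    _ = _ := by
        simp only [ENNReal.tsum_mul_right, ENNReal.tsum_mul_left]

/-- The square root of the weight `wt`, with values in `[0, ∞]`. -/
noncomputable def rwt (n : Fin d → ℤ) : ENNReal := ENNReal.ofReal (Real.sqrt (wt n))

theorem rwt_ne_top (n : Fin d → ℤ) : rwt n ≠ ⊤ := ENNReal.ofReal_ne_top

theorem rwt_ne_zero (n : Fin d → ℤ) : rwt n ≠ 0 := by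
  simpa [rwt] using wt_pos n

theorem rwt_pow_ne_top (n : Fin d → ℤ) (k : ℕ) : rwt n ^ k ≠ ⊤ := ENNReal.pow_ne_top (rwt_ne_top n)

theorem rwt_pow_ne_zero (n : Fin d → ℤ) (k : ℕ) : rwt n ^ k ≠ 0 := pow_ne_zero _ (rwt_ne_zero n)

theorem rwt_sq (n : Fin d → ℤ) : rwt n ^ 2 = ENNReal.ofReal (wt n) := by
  rw [rwt, ← ENNReal.ofReal_pow (Real.sqrt_nonneg _), Real.sq_sqrt (wt_pos n).le]

theorem wt_le (n k : Fin d → ℤ) : wt n ≤ 2 * (wt k + wt (n + k)) := by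
  have : ∑ i, (2 * Real.pi * n i) ^ 2
      ≤ 2 * (∑ i, (2 * Real.pi * k i) ^ 2 + ∑ i, (2 * Real.pi * (n + k) i) ^ 2) := by
    rw [← Finset.sum_add_distrib, Finset.mul_sum]
    refine Finset.sum_le_sum fun i _ => ?_
    simp only [Pi.add_apply]
    push_cast
    nlinarith [sq_nonneg (2 * Real.pi * n i + 2 * (2 * Real.pi * k i))]
  unfold wt
  linarith

theorem rwt_le_of_le {n k l : Fin d → ℤ} (h : wt n ≤ 2 * (wt k + wt l)) (h' : rwt l ≤ rwt k) :
    rwt n ≤ 2 * rwt k := by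
  have hl : Real.sqrt (wt l) ≤ Real.sqrt (wt k) :=
    (ENNReal.ofReal_le_ofReal_iff (Real.sqrt_nonneg _)).1 h'
  have hl' : wt l ≤ wt k := (Real.sqrt_le_sqrt_iff (wt_pos k).le).1 hl
  have h2 : (2 : ENNReal) = ENNReal.ofReal 2 := by simp
  rw [rwt, rwt, h2, ← ENNReal.ofReal_mul (by norm_num)]
  refine ENNReal.ofReal_le_ofReal ?_
  rw [Real.sqrt_le_left (by positivity), mul_pow, Real.sq_sqrt (wt_pos k).le]
  linarith

theorem memH_iff_tsum {k : ℕ} {u : L2 d} :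
    MemH k u ↔ ∑' n, (rwt n ^ k * ENNReal.ofReal ‖fc u n‖) ^ 2 ≠ ⊤ := by
  have h : ∀ n, (rwt n ^ k * ENNReal.ofReal ‖fc u n‖) ^ 2
      = ENNReal.ofReal (wt n ^ k * ‖fc u n‖ ^ 2) := by
    intro n
    have hw := wt_pos n
    rw [mul_pow, ← pow_mul, mul_comm k, pow_mul, rwt_sq, ← ENNReal.ofReal_pow hw.le,
      ← ENNReal.ofReal_pow (norm_nonneg _), ← ENNReal.ofReal_mul (by positivity)]
  have h0 : ∀ n, 0 ≤ wt n ^ k * ‖fc u n‖ ^ 2 := fun n => by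
    have hw := wt_pos n
    positivity
  simp only [h, memH_iff]
  refine ⟨fun hs => hs.tsum_ofReal_ne_top, fun hs => ?_⟩
  refine (ENNReal.summable_toReal hs).congr fun n => ?_
  rw [ENNReal.toReal_ofReal (h0 n)]

theorem tsum_rwt_inv_ne_top {s : ℕ} (hs : d < 2 * s) :
    ∑' n : Fin d → ℤ, ((rwt n ^ s)⁻¹) ^ 2 ≠ ⊤ := by
  have h : ∀ n : Fin d → ℤ, ((rwt n ^ s)⁻¹) ^ 2 = ENNReal.ofReal ((wt n ^ s)⁻¹) := by
    intro n
    have hw := wt_pos n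
    rw [← ENNReal.inv_pow, ← pow_mul, mul_comm s, pow_mul, rwt_sq, ← ENNReal.ofReal_pow hw.le,
      ENNReal.ofReal_inv_of_pos (by positivity)]
  simp only [h]
  exact (summable_wt_inv hs).tsum_ofReal_ne_top

theorem tsum_ne_top_of_weighted {s : ℕ} (hs : d < 2 * s) {y z : (Fin d → ℤ) → ENNReal}
    (hy : ∑' n, y n ^ 2 ≠ ⊤) (hz : ∀ n, z n ≤ y n * (rwt n ^ s)⁻¹) : ∑' n, z n ≠ ⊤ := by
  have h : ∑' n, z n ≤ ∑' n, y n ^ 2 + ∑' n : Fin d → ℤ, ((rwt n ^ s)⁻¹) ^ 2 := by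
    rw [← ENNReal.tsum_add]
    exact ENNReal.tsum_le_tsum fun n => (hz n).trans (ennreal_mul_le_sq_add_sq _ _)
  exact ne_top_of_le_ne_top (ENNReal.add_ne_top.2 ⟨hy, tsum_rwt_inv_ne_top hs⟩) h

theorem tsum_conv_sq_ne_top {G : Type*} [AddCommGroup G] {p q : G → ENNReal}
    (hp : ∑' k, p k ≠ ⊤) (hq : ∑' k, q k ^ 2 ≠ ⊤) :
    ∑' n, (∑' k, p k * q (n + k)) ^ 2 ≠ ⊤ :=
  ne_top_of_le_ne_top (ENNReal.mul_ne_top (ENNReal.mul_ne_top hp hp)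
    (ENNReal.mul_ne_top (by simp) hq)) (tsum_conv_sq_le p q)

theorem tsum_conv_sq_ne_top' {G : Type*} [AddCommGroup G] {p q : G → ENNReal}
    (hp : ∑' k, p k ^ 2 ≠ ⊤) (hq : ∑' k, q k ≠ ⊤) :
    ∑' n, (∑' k, p k * q (n + k)) ^ 2 ≠ ⊤ := by
  have hq' : ∑' k, q (-k) ≠ ⊤ := by
    have h1 := (Equiv.neg G).tsum_eq q
    simp only [Equiv.neg_apply] at h1
    rwa [h1]
  have hp' : ∑' k, p (-k) ^ 2 ≠ ⊤ := by
    have h1 := (Equiv.neg G).tsum_eq fun k => p k ^ 2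
    simp only [Equiv.neg_apply] at h1
    rwa [h1]
  have h := tsum_conv_sq_ne_top (p := fun k => q (-k)) (q := fun k => p (-k)) hq' hp'
  have h2 : ∀ n, ∑' k, p k * q (n + k) = ∑' k, q (-k) * p (-(n + k)) := by
    intro n
    rw [← (Equiv.subRight n).tsum_eq (fun k => p k * q (n + k)), ← (Equiv.neg G).tsum_eq]
    refine tsum_congr fun k => ?_
    simp only [Equiv.neg_apply, Equiv.subRight_apply, mul_comm (p _)]
    congr 2 <;> abel
  simpa only [h2] using h

/-- The distribution of the weight over the two factors of a convolution: the larger of the two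
frequencies carries the weight `rwt ^ j`, and if it belongs to the factor in `H^s`, the surplus
`rwt ^ (s - j)` goes to the other one. -/
theorem rwt_pow_mul_le {j s : ℕ} (hjs : j ≤ s) (n k : Fin d → ℤ) (x y : ENNReal) :
    rwt n ^ j * (x * y) ≤ 2 ^ j * (x * (rwt (n + k) ^ j * y)
      + rwt k ^ s * x * ((rwt (n + k) ^ (s - j))⁻¹ * y)) := by
  rcases le_total (rwt k) (rwt (n + k)) with h | h
  · have h1 : rwt n ≤ 2 * rwt (n + k) :=
      rwt_le_of_le (by rw [add_comm (wt (n + k))]; exact wt_le n k) h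
    calc rwt n ^ j * (x * y) ≤ (2 * rwt (n + k)) ^ j * (x * y) := by gcongr
      _ = 2 ^ j * (x * (rwt (n + k) ^ j * y)) := by rw [mul_pow]; ring
      _ ≤ _ := by gcongr; exact le_self_add
  · have h1 : rwt n ≤ 2 * rwt k := rwt_le_of_le (wt_le n k) h
    have h2 : rwt k ^ j ≤ rwt k ^ s * (rwt (n + k) ^ (s - j))⁻¹ := by
      rw [← div_eq_mul_inv, ENNReal.le_div_iff_mul_le (Or.inl (rwt_pow_ne_zero _ _))
        (Or.inl (rwt_pow_ne_top _ _))]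
      calc rwt k ^ j * rwt (n + k) ^ (s - j) ≤ rwt k ^ j * rwt k ^ (s - j) := by gcongr
        _ = rwt k ^ s := by rw [← pow_add, Nat.add_sub_cancel' hjs]
    calc rwt n ^ j * (x * y) ≤ (2 * rwt k) ^ j * (x * y) := by gcongr
      _ = 2 ^ j * (rwt k ^ j * (x * y)) := by rw [mul_pow]; ring
      _ ≤ 2 ^ j * (rwt k ^ s * (rwt (n + k) ^ (s - j))⁻¹ * (x * y)) := by gcongr
      _ = 2 ^ j * (rwt k ^ s * x * ((rwt (n + k) ^ (s - j))⁻¹ * y)) := by ring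
      _ ≤ _ := by gcongr; exact le_add_self

/-- **Sobolev multiplication**: `H^s · H^j ⊆ H^j` for `j ≤ s` and `s > d / 2`. -/
theorem MemH.mulL2 {j s : ℕ} (hjs : j ≤ s) (hs : d < 2 * s) {a : Torus d → ℝ}
    (ha : Continuous a) (ha' : MemH s (classL2 a)) {g : L2 d} (hg : MemH j g) :
    MemH j (mulL2 a g) := by
  rw [memH_iff_tsum] at ha' hg ⊢
  set x : (Fin d → ℤ) → ENNReal := fun k => ENNReal.ofReal ‖fc (classL2 a) k‖ with hx
  set y : (Fin d → ℤ) → ENNReal := fun k => ENNReal.ofReal ‖fc g k‖ with hy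
  have hA : ∑' n, (∑' k, x k * (rwt (n + k) ^ j * y (n + k))) ^ 2 ≠ ⊤ := by
    refine tsum_conv_sq_ne_top (q := fun m => rwt m ^ j * y m) ?_ hg
    refine tsum_ne_top_of_weighted hs ha' fun n => ?_
    rw [mul_right_comm, ENNReal.mul_inv_cancel (rwt_pow_ne_zero _ _) (rwt_pow_ne_top _ _), one_mul]
  have hB : ∑' n, (∑' k, rwt k ^ s * x k * ((rwt (n + k) ^ (s - j))⁻¹ * y (n + k))) ^ 2 ≠ ⊤ := by
    refine tsum_conv_sq_ne_top' (p := fun m => rwt m ^ s * x m)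
      (q := fun m => (rwt m ^ (s - j))⁻¹ * y m) ha' ?_
    refine tsum_ne_top_of_weighted hs hg fun n => ?_
    have : (rwt n ^ s)⁻¹ = (rwt n ^ j)⁻¹ * (rwt n ^ (s - j))⁻¹ := by
      rw [← ENNReal.mul_inv (Or.inl (rwt_pow_ne_zero _ _)) (Or.inl (rwt_pow_ne_top _ _)),
        ← pow_add, Nat.add_sub_cancel' hjs]
    rw [this, mul_right_comm, ← mul_assoc, ENNReal.mul_inv_cancel (rwt_pow_ne_zero _ _)
      (rwt_pow_ne_top _ _), one_mul]
  have hle : ∀ n, (rwt n ^ j * ENNReal.ofReal ‖fc (MFG.mulL2 a g) n‖) ^ 2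
      ≤ (2 ^ j) ^ 2 * (3 * ((∑' k, x k * (rwt (n + k) ^ j * y (n + k))) ^ 2
        + (∑' k, rwt k ^ s * x k * ((rwt (n + k) ^ (s - j))⁻¹ * y (n + k))) ^ 2)) := by
    intro n
    have h1 : rwt n ^ j * ENNReal.ofReal ‖fc (MFG.mulL2 a g) n‖
        ≤ 2 ^ j * (∑' k, x k * (rwt (n + k) ^ j * y (n + k))
          + ∑' k, rwt k ^ s * x k * ((rwt (n + k) ^ (s - j))⁻¹ * y (n + k))) := by
      calc rwt n ^ j * ENNReal.ofReal ‖fc (MFG.mulL2 a g) n‖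
          ≤ rwt n ^ j * ∑' k, x k * y (n + k) := by
            gcongr
            exact norm_fc_mulL2_le ha g n
        _ ≤ ∑' k, 2 ^ j * (x k * (rwt (n + k) ^ j * y (n + k))
          + rwt k ^ s * x k * ((rwt (n + k) ^ (s - j))⁻¹ * y (n + k))) := by
            rw [← ENNReal.tsum_mul_left]
            exact ENNReal.tsum_le_tsum fun k => rwt_pow_mul_le hjs n k _ _
        _ = _ := by rw [ENNReal.tsum_mul_left, ENNReal.tsum_add]
    refine (pow_le_pow_left' h1 2).trans ?_
    rw [mul_pow]
    gcongr
    set A := ∑' k, x k * (rwt (n + k) ^ j * y (n + k))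
    set B := ∑' k, rwt k ^ s * x k * ((rwt (n + k) ^ (s - j))⁻¹ * y (n + k))
    have h2 := ennreal_mul_le_sq_add_sq A B
    calc (A + B) ^ 2 = A ^ 2 + B ^ 2 + 2 * (A * B) := by ring
      _ ≤ A ^ 2 + B ^ 2 + 2 * (A ^ 2 + B ^ 2) := by gcongr
      _ = 3 * (A ^ 2 + B ^ 2) := by ring
  refine ne_top_of_le_ne_top ?_ (ENNReal.tsum_le_tsum hle)
  rw [ENNReal.tsum_mul_left, ENNReal.tsum_mul_left, ENNReal.tsum_add]
  exact ENNReal.mul_ne_top (by simp) (ENNReal.mul_ne_top (by simp) (ENNReal.add_ne_top.2 ⟨hA, hB⟩))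

/-! ### Continuous functions of Sobolev regularity, and composition -/

theorem classL2_congr_add {φ ψ : Torus d → ℝ} (hφ : Continuous φ) (hψ : Continuous ψ) :
    classL2 (fun x => φ x + ψ x) = classL2 φ + classL2 ψ := by
  refine Lp.ext ?_
  have hc : Continuous fun x => φ x + ψ x := hφ.add hψ
  filter_upwards [coeFn_classL2 hφ, coeFn_classL2 hψ, coeFn_classL2 hc,
    Lp.coeFn_add (classL2 φ) (classL2 ψ)] with x h1 h2 h3 h4
  rw [h3, h4, Pi.add_apply, h1, h2]

theorem classL2_const_mul (c : ℝ) {φ : Torus d → ℝ} (hφ : Continuous φ) :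
    classL2 (fun x => c * φ x) = c • classL2 φ := by
  refine Lp.ext ?_
  have hc : Continuous fun x => c * φ x := continuous_const.mul hφ
  filter_upwards [coeFn_classL2 hφ, coeFn_classL2 hc, Lp.coeFn_smul c (classL2 φ)]
    with x h1 h3 h4
  rw [h3, h4, Pi.smul_apply, h1, smul_eq_mul]

/-- `φ` is continuous and its class in `L²` belongs to `H^s`. -/
structure SobCont (s : ℕ) (φ : Torus d → ℝ) : Prop where
  continuous : Continuous φ
  memH : MemH s (classL2 φ)

theorem SobCont.add {s : ℕ} {φ ψ : Torus d → ℝ} (hφ : SobCont s φ) (hψ : SobCont s ψ) :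
    SobCont s (fun x => φ x + ψ x) :=
  ⟨hφ.continuous.add hψ.continuous, by
    rw [classL2_congr_add hφ.continuous hψ.continuous]; exact hφ.memH.add hψ.memH⟩

theorem SobCont.const_mul {s : ℕ} (c : ℝ) {φ : Torus d → ℝ} (hφ : SobCont s φ) :
    SobCont s (fun x => c * φ x) :=
  ⟨continuous_const.mul hφ.continuous, by
    rw [classL2_const_mul c hφ.continuous]; exact hφ.memH.smul c⟩

theorem SobCont.mul {s : ℕ} (hs : d < 2 * s) {φ ψ : Torus d → ℝ} (hφ : SobCont s φ)
    (hψ : SobCont s ψ) : SobCont s (fun x => φ x * ψ x) :=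
  ⟨hφ.continuous.mul hψ.continuous, by
    rw [← mulL2_classL2 hφ.continuous hψ.continuous]
    exact MemH.mulL2 le_rfl hs hφ.continuous hφ.memH hψ.memH⟩

theorem SobCont.of_le {s t : ℕ} (hst : s ≤ t) {φ : Torus d → ℝ} (hφ : SobCont t φ) :
    SobCont s φ :=
  ⟨hφ.continuous, hφ.memH.mono hst⟩

theorem classL2_pderiv {φ : Torus d → ℝ} (h : TorusContDiff 1 φ) (i : Fin d) :
    classL2 (pderiv i φ) = wpderiv i (classL2 φ) :=
  (hasWeakPDeriv_classL2 h i).wpderiv_eq.symm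

theorem TorusContDiff.continuous_pderiv {φ : Torus d → ℝ} (h : TorusContDiff 1 φ) (i : Fin d) :
    Continuous (MFG.pderiv i φ) :=
  (h.pderiv (m := 0) (by simp) i).continuous

theorem SobCont.pderiv {s : ℕ} {φ : Torus d → ℝ} (h : SobCont (s + 1) φ)
    (h' : TorusContDiff 1 φ) (i : Fin d) : SobCont s (pderiv i φ) :=
  ⟨h'.continuous_pderiv i, by rw [classL2_pderiv h']; exact h.memH.wpderiv i⟩

theorem SobCont.of_pderiv {s : ℕ} {φ : Torus d → ℝ} (h' : TorusContDiff 1 φ)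
    (h : ∀ i, SobCont s (MFG.pderiv i φ)) : SobCont (s + 1) φ :=
  ⟨h'.continuous, fun i => ⟨_, hasWeakPDeriv_classL2 h' i, (h i).memH⟩⟩

theorem SobCont.zero (s : ℕ) : SobCont s (fun _ : Torus d => (0 : ℝ)) := by
  have h : classL2 (fun _ : Torus d => (0 : ℝ)) = 0 := by
    refine Lp.ext ?_
    filter_upwards [coeFn_classL2 (continuous_const (y := (0 : ℝ)) (X := Torus d)),
      Lp.coeFn_zero ℝ 2 (torusMeasure d)] with x h1 h2
    rw [h1, h2]; rfl
  exact ⟨continuous_const, by rw [h]; exact MemH.zero_mem s⟩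

theorem SobCont.sum {s : ℕ} {ι : Type*} (t : Finset ι) {φ : ι → Torus d → ℝ}
    (h : ∀ i, SobCont s (φ i)) : SobCont s (fun x => ∑ i ∈ t, φ i x) := by
  classical
  induction t using Finset.induction_on with
  | empty => simpa using SobCont.zero s
  | insert a t ha ih =>
    simp only [Finset.sum_insert ha]
    exact (h a).add ih

theorem TorusContDiff.sobCont {φ : Torus d → ℝ} (h : TorusContDiff ∞ φ) (s : ℕ) :
    SobCont s φ := by
  induction s generalizing φ with
  | zero => exact ⟨h.continuous, trivial⟩
  | succ s ih => exact SobCont.of_pderiv (h.of_le (by simp)) fun i => ih (h.pderiv_smooth i)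

theorem SobCont.const (s : ℕ) (c : ℝ) : SobCont s (fun _ : Torus d => c) :=
  TorusContDiff.sobCont (φ := fun _ : Torus d => c) contDiff_const s

theorem RepresentsH.sobCont {s : ℕ} {φ : Torus d → ℝ} (h : RepresentsH s φ)
    (hc : Continuous φ) : SobCont s φ := by
  obtain ⟨U, hU⟩ := h
  have : classL2 φ = U.toL2 := Lp.ext ((coeFn_classL2 hc).trans hU.symm)
  exact ⟨hc, this ▸ U.property⟩

/-- `G : 𝕋^d × (0, ∞) → ℝ` is smooth. -/
def SmoothOnPos (G : Torus d → ℝ → ℝ) : Prop :=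
  ContDiffOn ℝ ∞ (fun p : (Fin d → ℝ) × ℝ => G (toTorus p.1) p.2) (univ ×ˢ Ioi 0)

theorem isOpen_univ_prod_Ioi : IsOpen ((univ : Set (Fin d → ℝ)) ×ˢ Ioi (0 : ℝ)) :=
  isOpen_univ.prod isOpen_Ioi

theorem SmoothOnPos.hasFDerivAt {G : Torus d → ℝ → ℝ} (hG : SmoothOnPos G) (y : Fin d → ℝ)
    {t : ℝ} (ht : 0 < t) :
    HasFDerivAt (fun p : (Fin d → ℝ) × ℝ => G (toTorus p.1) p.2)
      (fderiv ℝ (fun p : (Fin d → ℝ) × ℝ => G (toTorus p.1) p.2) (y, t)) (y, t) :=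
  ((hG.contDiffAt (isOpen_univ_prod_Ioi.mem_nhds (mk_mem_prod trivial ht))).differentiableAt
    (by simp)).hasFDerivAt

theorem SmoothOnPos.pderiv_eq {G : Torus d → ℝ → ℝ} (hG : SmoothOnPos G) (i : Fin d)
    (y : Fin d → ℝ) {t : ℝ} (ht : 0 < t) :
    pderiv i (fun x => G x t) (toTorus y)
      = fderiv ℝ (fun p : (Fin d → ℝ) × ℝ => G (toTorus p.1) p.2) (y, t) (Pi.single i 1, 0) := by
  unfold pderiv
  simp only [toTorus_add_single]
  refine HasDerivAt.deriv ?_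
  have h2 : HasDerivAt (fun s : ℝ => (y + s • (Pi.single i 1 : Fin d → ℝ), t))
      (Pi.single i 1, 0) 0 := by
    refine HasDerivAt.prodMk ?_ (hasDerivAt_const _ _)
    simpa using ((hasDerivAt_id (0 : ℝ)).smul_const (Pi.single i 1 : Fin d → ℝ)).const_add y
  exact HasFDerivAt.comp_hasDerivAt (0 : ℝ) (by simpa using hG.hasFDerivAt y ht) h2

theorem SmoothOnPos.deriv_eq {G : Torus d → ℝ → ℝ} (hG : SmoothOnPos G) (y : Fin d → ℝ) {t : ℝ}
    (ht : 0 < t) :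
    deriv (G (toTorus y)) t
      = fderiv ℝ (fun p : (Fin d → ℝ) × ℝ => G (toTorus p.1) p.2) (y, t) (0, 1) := by
  refine HasDerivAt.deriv ?_
  have h2 : HasDerivAt (fun s : ℝ => (y, s)) (0, 1) t :=
    (hasDerivAt_const _ _).prodMk (hasDerivAt_id t)
  exact (hG.hasFDerivAt y ht).comp_hasDerivAt t h2

theorem SmoothOnPos.contDiffOn_fderiv {G : Torus d → ℝ → ℝ} (hG : SmoothOnPos G)
    (e : (Fin d → ℝ) × ℝ) :
    ContDiffOn ℝ ∞ (fun p => fderiv ℝ (fun p : (Fin d → ℝ) × ℝ => G (toTorus p.1) p.2) p e)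
      (univ ×ˢ Ioi 0) :=
  (ContDiffOn.fderiv_of_isOpen hG isOpen_univ_prod_Ioi (m := ∞) (by simp)).clm_apply
    contDiffOn_const

theorem SmoothOnPos.pderiv {G : Torus d → ℝ → ℝ} (hG : SmoothOnPos G) (i : Fin d) :
    SmoothOnPos (fun x t => pderiv i (fun x => G x t) x) :=
  (hG.contDiffOn_fderiv (Pi.single i 1, 0)).congr fun p hp => hG.pderiv_eq i p.1 hp.2

theorem SmoothOnPos.deriv {G : Torus d → ℝ → ℝ} (hG : SmoothOnPos G) :
    SmoothOnPos (fun x t => deriv (G x) t) :=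
  (hG.contDiffOn_fderiv (0, 1)).congr fun p hp => hG.deriv_eq p.1 hp.2

theorem SmoothOnPos.torusContDiff {G : Torus d → ℝ → ℝ} (hG : SmoothOnPos G) {n : WithTop ℕ∞}
    (hn : n ≤ ∞) {m : Torus d → ℝ} (hm : TorusContDiff n m) (hpos : ∀ x, 0 < m x) :
    TorusContDiff n (fun x => G x (m x)) :=
  ContDiffOn.comp_contDiff (ContDiffOn.of_le hG hn) (contDiff_id.prodMk hm)
    fun _ => ⟨trivial, hpos _⟩

theorem SmoothOnPos.pderiv_comp {G : Torus d → ℝ → ℝ} (hG : SmoothOnPos G)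
    {m : Torus d → ℝ} (hm : TorusContDiff 1 m) (hpos : ∀ x, 0 < m x) (i : Fin d) (x : Torus d) :
    MFG.pderiv i (fun x => G x (m x)) x
      = MFG.pderiv i (fun y => G y (m x)) x + MFG.pderiv i m x * _root_.deriv (G x) (m x) := by
  obtain ⟨y, rfl⟩ := toTorus_isQuotientMap.surjective x
  rw [hG.pderiv_eq i y (hpos _), hG.deriv_eq y (hpos _)]
  have h1 := hm.hasDerivAt_zero one_ne_zero i (toTorus y)
  have h2 : HasDerivAt (fun s : ℝ => (y + s • (Pi.single i 1 : Fin d → ℝ),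
      m (toTorus y + Pi.single i (s : UnitAddCircle)))) (Pi.single i 1, MFG.pderiv i m (toTorus y))
      0 := by
    refine HasDerivAt.prodMk ?_ h1
    simpa using ((hasDerivAt_id (0 : ℝ)).smul_const (Pi.single i 1 : Fin d → ℝ)).const_add y
  have h3 := HasFDerivAt.comp_hasDerivAt (0 : ℝ) (by simpa using hG.hasFDerivAt y (hpos _)) h2
  have h4 : MFG.pderiv i (fun x => G x (m x)) (toTorus y)
      = fderiv ℝ (fun p : (Fin d → ℝ) × ℝ => G (toTorus p.1) p.2) (y, m (toTorus y))
        (Pi.single i 1, MFG.pderiv i m (toTorus y)) := by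
    rw [← h3.deriv]
    simp only [MFG.pderiv, toTorus_add_single, Function.comp_def]
  rw [h4, ← smul_eq_mul, ← map_smul, ← map_add]
  simp

/-- If `m > 0` lies in `H^{r+1}` with `r > d/2`, then so does `x ↦ G(x, m(x))`, for every smooth
`G`. The regularity of the composition is raised one derivative at a time by the chain rule,
`∂ᵢ(G(x, m)) = (∂ᵢG)(x, m) + (∂ₘG)(x, m) ∂ᵢm`, applied to all smooth `G` at once. -/
theorem SobCont.comp {r : ℕ} (hr : d < 2 * r) {m : Torus d → ℝ} (hm : SobCont (r + 1) m)
    (hm' : TorusContDiff 1 m) (hpos : ∀ x, 0 < m x) {G : Torus d → ℝ → ℝ} (hG : SmoothOnPos G) :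
    SobCont (r + 1) (fun x => G x (m x)) := by
  suffices h : ∀ j ≤ r + 1, ∀ G : Torus d → ℝ → ℝ, SmoothOnPos G →
      SobCont j (fun x => G x (m x)) from h _ le_rfl G hG
  intro j
  induction j with
  | zero =>
    exact fun _ G hG => ⟨(hG.torusContDiff (by simp) hm' hpos).continuous, trivial⟩
  | succ j ih =>
    intro hj G hG
    refine SobCont.of_pderiv (hG.torusContDiff (by simp) hm' hpos) fun i => ?_
    have h1 := ih (by omega) _ (hG.pderiv i)
    have h2 := ih (by omega) _ hG.deriv
    have h3 := hm.pderiv hm' i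
    have h4 : SobCont j (fun x => MFG.pderiv i m x * _root_.deriv (G x) (m x)) :=
      ⟨h3.continuous.mul h2.continuous, by
        rw [← mulL2_classL2 h3.continuous h2.continuous]
        exact MemH.mulL2 (by omega) hr h3.continuous h3.memH h2.memH⟩
    have h5 := h1.add h4
    have h6 : MFG.pderiv i (fun x => G x (m x)) = _ :=
      funext fun x => hG.pderiv_comp hm' hpos i x
    rwa [h6]

theorem smoothOnPos_of_contDiffOn {g : ℝ → ℝ} (hg : ContDiffOn ℝ ∞ g (Ioi 0)) :
    SmoothOnPos (fun (_ : Torus d) t => g t) :=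
  hg.comp contDiffOn_snd fun _ hp => hp.2

theorem smoothOnPos_rpow (β : ℝ) : SmoothOnPos (fun (_ : Torus d) t => t ^ β) :=
  smoothOnPos_of_contDiffOn fun _ ht =>
    (Real.contDiffAt_rpow_const_of_ne (ne_of_gt ht)).contDiffWithinAt

theorem smoothOnPos_arctan : SmoothOnPos (fun (_ : Torus d) t => Real.arctan t) :=
  smoothOnPos_of_contDiffOn Real.contDiff_arctan.contDiffOn

/-! ### Regularity of solutions of the nonlinear system -/

/-- Elliptic regularity for classical solutions of `φ - Δφ = R`. -/
theorem SobCont.of_sub_lap {s : ℕ} {φ R : Torus d → ℝ} (hφ : TorusContDiff 2 φ) (hR : SobCont s R)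
    (h : ∀ x, φ x - lap φ x = R x) : SobCont (s + 2) φ := by
  have h1 : TorusContDiff 1 φ := hφ.of_le (by norm_num)
  have h2 : ∀ i, TorusContDiff 1 (MFG.pderiv i φ) := fun i => hφ.pderiv (by norm_num) i
  refine ⟨hφ.continuous, memH_add_two_of_fc hR.memH fun n => ?_⟩
  have h3 : classL2 R = classL2 φ + (-1 : ℝ) • ∑ i, classL2 (MFG.pderiv i (MFG.pderiv i φ)) := by
    refine Lp.ext ?_
    have hall : ∀ᵐ x ∂(torusMeasure d), ∀ i, classL2 (MFG.pderiv i (MFG.pderiv i φ)) x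
        = MFG.pderiv i (MFG.pderiv i φ) x :=
      ae_all_iff.2 fun i => coeFn_classL2 ((h2 i).continuous_pderiv i)
    filter_upwards [coeFn_classL2 hR.continuous, coeFn_classL2 hφ.continuous, hall,
      Lp.coeFn_add (classL2 φ) ((-1 : ℝ) • ∑ i, classL2 (MFG.pderiv i (MFG.pderiv i φ))),
      Lp.coeFn_smul (-1 : ℝ) (∑ i, classL2 (MFG.pderiv i (MFG.pderiv i φ))),
      Lp.coeFn_finsetSum Finset.univ fun i => classL2 (MFG.pderiv i (MFG.pderiv i φ))]
      with x e1 e2 e3 e4 e5 e6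
    rw [e4, Pi.add_apply, e5, Pi.smul_apply, e6, e1, e2, ← h x]
    simp [lap, e3, sub_eq_add_neg]
  rw [h3, fc_add, fc_smul, fc_sum, wt_eq]
  have h4 : ∀ i, fc (classL2 (MFG.pderiv i (MFG.pderiv i φ))) n
      = dsymb i n * dsymb i n * fc (classL2 φ) n := fun i => by
    rw [(hasWeakPDeriv_classL2 (h2 i) i).fc_eq, (hasWeakPDeriv_classL2 h1 i).fc_eq, mul_assoc]
  simp only [h4, ← Finset.sum_mul]
  push_cast; ring

theorem div_two_mul_rpow {x : ℝ} (hx : 0 < x) (α y : ℝ) :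
    y / (2 * x ^ α) = 1 / 2 * (y * x ^ (-α)) := by
  rw [Real.rpow_neg hx.le]
  have := (Real.rpow_pos_of_pos hx α).ne'
  field_simp

/-- One bootstrap step: the first equation improves the regularity of `u`, which then makes the
divergence term of the second equation regular enough to improve that of `m`. -/
theorem IsSolution.sobCont_succ {α : ℝ} {V : Torus d → ℝ → ℝ} {b : Fin d → Torus d → ℝ}
    (hdata : IsData α V b) {k₀ : ℕ} {lam : ℝ} {u m : Torus d → ℝ}
    (hsol : IsSolution k₀ α V b lam u m) {r : ℕ} (hr : d < 2 * r)
    (hu : SobCont (r + 1) u) (hm : SobCont (r + 1) m) :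
    SobCont (r + 2) u ∧ SobCont (r + 2) m := by
  have hu1 : TorusContDiff 1 u := hsol.u_C2.of_le (by norm_num)
  have hm1 : TorusContDiff 1 m := hsol.m_C2.of_le (by norm_num)
  have hDu : ∀ i, SobCont r (MFG.pderiv i u) := fun i => hu.pderiv hu1 i
  have hcomp : ∀ {G : Torus d → ℝ → ℝ}, SmoothOnPos G → SobCont (r + 1) fun x => G x (m x) :=
    fun hG => SobCont.comp hr hm hm1 hsol.m_pos hG
  have hb : ∀ i s, SobCont s (b i) := fun i s => (hdata.b_smooth i).sobCont s
  have hr' : d < 2 * (r + 1) := by omega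
  have hu2 : SobCont (r + 2) u := by
    refine SobCont.of_sub_lap (R := fun x =>
      (-(1 / 2)) * ((∑ i, MFG.pderiv i u x * MFG.pderiv i u x) * m x ^ (-α))
      + (-lam) * (∑ i, b i x * MFG.pderiv i u x)
      + lam * V x (m x) + (1 - lam) * Real.arctan (m x)) hsol.u_C2 ?_ fun x => ?_
    · refine SobCont.add (SobCont.add (SobCont.add ?_ ?_) ?_) ?_
      · exact SobCont.const_mul _ (SobCont.mul hr
          (SobCont.sum _ fun i => (hDu i).mul hr (hDu i))
          ((hcomp (smoothOnPos_rpow (-α))).of_le (by omega)))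
      · exact SobCont.const_mul _ (SobCont.sum _ fun i => (hb i r).mul hr (hDu i))
      · exact SobCont.const_mul _ ((hcomp hdata.V_smooth).of_le (by omega))
      · exact SobCont.const_mul _ ((hcomp smoothOnPos_arctan).of_le (by omega))
    · have h := congrArg Prod.fst (hsol.eq_zero x)
      simp only [contMap, gradSq, Prod.fst_zero, div_two_mul_rpow (hsol.m_pos x), sq] at h
      linarith
  refine ⟨hu2, ?_⟩
  have hX : ∀ i, SobCont (r + 1) fun x => m x ^ (1 - α) * MFG.pderiv i u x := fun i =>
    (hcomp (smoothOnPos_rpow (1 - α))).mul hr' (hu2.pderiv hu1 i)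
  have hX1 : ∀ i, TorusContDiff 1 fun x => m x ^ (1 - α) * MFG.pderiv i u x := fun i =>
    ((smoothOnPos_rpow (1 - α)).torusContDiff (by simp) hm1 hsol.m_pos).mul
      (hsol.u_C2.pderiv (by norm_num) i)
  have hY : ∀ i, SobCont (r + 1) fun x => b i x * m x := fun i => (hb i _).mul hr' hm
  have hY1 : ∀ i, TorusContDiff 1 fun x => b i x * m x := fun i =>
    ((hdata.b_smooth i).of_le (by simp)).mul hm1
  refine SobCont.of_sub_lap (R := fun x =>
      (∑ i, MFG.pderiv i (fun y => m y ^ (1 - α) * MFG.pderiv i u y) x)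
      + lam * (∑ i, MFG.pderiv i (fun y => b i y * m y) x) + 1) hsol.m_C2 ?_ fun x => ?_
  · refine SobCont.add (SobCont.add ?_ (SobCont.const_mul _ ?_)) (SobCont.const _ _)
    · exact SobCont.sum _ fun i => (hX i).pderiv (hX1 i) i
    · exact SobCont.sum _ fun i => (hY i).pderiv (hY1 i) i
  · have h := congrArg Prod.snd (hsol.eq_zero x)
    simp only [contMap, divergence, Prod.snd_zero] at h
    linarith

/-- A classical solution is smooth: both components belong to every `H^s`. -/
theorem IsSolution.sobCont {α : ℝ} {V : Torus d → ℝ → ℝ} {b : Fin d → Torus d → ℝ}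
    (hdata : IsData α V b) {k₀ : ℕ} (hk₀ : d < 2 * k₀) {lam : ℝ} {u m : Torus d → ℝ}
    (hsol : IsSolution k₀ α V b lam u m) (s : ℕ) : SobCont s u ∧ SobCont s m := by
  suffices h : ∀ r, SobCont (k₀ + r + 1) u ∧ SobCont (k₀ + r + 1) m from
    ⟨(h s).1.of_le (by omega), (h s).2.of_le (by omega)⟩
  intro r
  induction r with
  | zero => exact ⟨(hsol.u_mem.sobCont hsol.u_C2.continuous).of_le (by omega),
      (hsol.m_mem.sobCont hsol.m_C2.continuous).of_le (by omega)⟩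
  | succ r ih => exact hsol.sobCont_succ hdata (r := k₀ + r) (by omega) ih.1 ih.2

/-! ### Fourier multipliers -/

theorem norm_le_of_fc {u v : L2 d} {C : ℝ} (hC : 0 ≤ C) (h : ∀ n, ‖fc v n‖ ≤ C * ‖fc u n‖) :
    ‖v‖ ≤ C * ‖u‖ := by
  refine le_of_sq_le_sq ?_ (by positivity)
  rw [mul_pow]
  refine hasSum_le (fun n => ?_) (hasSum_fc_sq v) ((hasSum_fc_sq u).mul_left (C ^ 2))
  rw [← mul_pow]
  exact pow_le_pow_left₀ (norm_nonneg _) (h n) 2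

/-- A bounded Hermitian symbol defines a bounded operator on real `L²` functions. -/
theorem exists_multiplier {σ : (Fin d → ℤ) → ℂ} (hσ : ∀ n, σ (-n) = conj (σ n)) {C : ℝ}
    (hC : ∀ n, ‖σ n‖ ≤ C) : ∃ T : L2 d →L[ℝ] L2 d, ∀ u n, fc (T u) n = σ n * fc u n := by
  have hC0 : 0 ≤ C := (norm_nonneg _).trans (hC 0)
  have hle : ∀ (u : L2 d) n, ‖σ n * fc u n‖ ≤ C * ‖fc u n‖ := fun u n => by
    rw [norm_mul]
    exact mul_le_mul_of_nonneg_right (hC n) (norm_nonneg _)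
  have hex : ∀ u : L2 d, ∃ v : L2 d, ∀ n, fc v n = σ n * fc u n := fun u => by
    refine exists_fc_eq ?_ fun n => ?_
    · refine ((hasSum_fc_sq u).summable.mul_left (C ^ 2)).of_nonneg_of_le
        (fun n => sq_nonneg _) fun n => ?_
      rw [← mul_pow]
      exact pow_le_pow_left₀ (norm_nonneg _) (hle u n) 2
    · rw [hσ, fc_neg_index, map_mul]
  choose T hT using hex
  refine ⟨LinearMap.mkContinuous ⟨⟨T, fun u v => ?_⟩, fun c u => ?_⟩ C fun u => ?_, hT⟩
  · refine fc_injective fun n => ?_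
    rw [fc_add, hT, hT, hT, fc_add, mul_add]
  · refine fc_injective fun n => ?_
    simp only [RingHom.id_apply]
    rw [fc_smul, hT, hT, fc_smul, mul_left_comm]
  · exact norm_le_of_fc hC0 fun n => (congrArg norm (hT u n)).trans_le (hle u n)

theorem isCompactOperator_of_finite_symbol {σ : (Fin d → ℤ) → ℂ} {T : L2 d →L[ℝ] L2 d}
    (hT : ∀ u n, fc (T u) n = σ n * fc u n) (hfin : {n | σ n ≠ 0}.Finite) :
    IsCompactOperator T := by
  have : Finite {n | σ n ≠ 0} := hfin
  let Φ : LinearMap.range T.toLinearMap →ₗ[ℝ] ({n | σ n ≠ 0} → ℂ) :=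
    { toFun := fun v n => fc v.1 n.1
      map_add' := fun v w => funext fun n => fc_add _ _ _
      map_smul' := fun c v => funext fun n => by
        simp [fc_smul] }
  have hΦ : Function.Injective Φ := by
    rintro ⟨v, hv⟩ ⟨w, hw⟩ h
    refine Subtype.ext (fc_injective fun n => ?_)
    by_cases hn : σ n = 0
    · obtain ⟨v, rfl⟩ := hv
      obtain ⟨w, rfl⟩ := hw
      have h1 := hT v n
      have h2 := hT w n
      rw [hn, zero_mul] at h1 h2
      exact h1.trans h2.symm
    · exact congrFun h ⟨n, hn⟩
  have hfd : FiniteDimensional ℝ (LinearMap.range T.toLinearMap) :=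
    FiniteDimensional.of_injective Φ hΦ
  have hprop : ProperSpace (LinearMap.range T.toLinearMap) := FiniteDimensional.proper ℝ _
  have hloc : LocallyCompactSpace (LinearMap.range T.toLinearMap) := inferInstance
  exact (isCompactOperator_id_iff_locallyCompactSpace.2 hloc |>.comp_clm
    (T.codRestrict _ fun x => ⟨x, rfl⟩)).clm_comp (Submodule.subtypeL _)

/-- A Fourier multiplier whose symbol tends to `0` is compact, as a norm limit of multipliers with
finitely supported symbols. -/
theorem isCompactOperator_of_symbol {σ : (Fin d → ℤ) → ℂ} (hσ : ∀ n, σ (-n) = conj (σ n))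
    {C : ℝ} (hC : ∀ n, ‖σ n‖ ≤ C) {T : L2 d →L[ℝ] L2 d} (hT : ∀ u n, fc (T u) n = σ n * fc u n)
    (hfin : ∀ ε > 0, {n | ε ≤ ‖σ n‖}.Finite) : IsCompactOperator T := by
  have hC0 : 0 ≤ C := (norm_nonneg _).trans (hC 0)
  suffices h : T ∈ closure {S : L2 d →L[ℝ] L2 d | IsCompactOperator S} by
    rwa [isClosed_setOfPred_isCompactOperator.closure_eq] at h
  refine Metric.mem_closure_iff.2 fun ε hε => ?_
  obtain ⟨S, hS⟩ := exists_multiplier (σ := fun n => if ε / 2 ≤ ‖σ n‖ then σ n else 0) (C := C)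
    (fun n => by
      have : ‖σ (-n)‖ = ‖σ n‖ := by rw [hσ, RCLike.norm_conj]
      simp only [this]
      split_ifs <;> simp [hσ])
    (fun n => by
      split_ifs
      · exact hC n
      · simpa using hC0)
  refine ⟨S, isCompactOperator_of_finite_symbol hS ((hfin (ε / 2) (by positivity)).subset
    fun n hn => ?_), ?_⟩
  · by_contra h
    exact hn (if_neg h)
  · rw [dist_eq_norm]
    refine lt_of_le_of_lt (ContinuousLinearMap.opNorm_le_bound _ (by positivity) fun u => ?_)
      (half_lt_self hε)
    refine norm_le_of_fc (by positivity) fun n => ?_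
    rw [sub_apply, fc_sub, hT, hS, ← sub_mul, norm_mul]
    refine mul_le_mul_of_nonneg_right ?_ (norm_nonneg _)
    split_ifs with h
    · simp; positivity
    · simpa using (not_le.1 h).le

theorem exists_resolvent (d : ℕ) :
    ∃ T : L2 d →L[ℝ] L2 d, ∀ u n, fc (T u) n = ((wt n : ℂ))⁻¹ * fc u n :=
  exists_multiplier (C := 1) (fun n => by simp [wt_neg]) fun n => by
    rw [norm_inv, Complex.norm_real, Real.norm_of_nonneg (wt_pos n).le]
    exact inv_le_one_of_one_le₀ (one_le_wt n)

/-- The operator `(1 - Δ)⁻¹` on `L²`. -/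
noncomputable def resolvent (d : ℕ) : L2 d →L[ℝ] L2 d := (exists_resolvent d).choose

theorem fc_resolvent (u : L2 d) (n : Fin d → ℤ) :
    fc (resolvent d u) n = ((wt n : ℂ))⁻¹ * fc u n :=
  (exists_resolvent d).choose_spec u n

theorem wt_ne_zero (n : Fin d → ℤ) : (wt n : ℂ) ≠ 0 := by
  exact_mod_cast (wt_pos n).ne'

theorem norm_dsymb_div_wt_sq_le (i : Fin d) (n : Fin d → ℤ) :
    ‖dsymb i n * ((wt n : ℂ))⁻¹‖ ^ 2 ≤ (wt n)⁻¹ := by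
  have hw := wt_pos n
  rw [norm_mul, mul_pow, norm_inv, Complex.norm_real, Real.norm_of_nonneg hw.le]
  calc ‖dsymb i n‖ ^ 2 * (wt n)⁻¹ ^ 2 ≤ wt n * (wt n)⁻¹ ^ 2 := by
        gcongr
        exact norm_dsymb_sq_le i n
    _ = (wt n)⁻¹ := by field_simp

theorem norm_dsymb_div_wt_le_one (i : Fin d) (n : Fin d → ℤ) :
    ‖dsymb i n * ((wt n : ℂ))⁻¹‖ ≤ 1 := by
  have h := (norm_dsymb_div_wt_sq_le i n).trans (inv_le_one_of_one_le₀ (one_le_wt n))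
  exact (sq_le_one_iff₀ (norm_nonneg _)).1 h

theorem exists_dresolvent (i : Fin d) :
    ∃ T : L2 d →L[ℝ] L2 d, ∀ u n, fc (T u) n = (dsymb i n * ((wt n : ℂ))⁻¹) * fc u n :=
  exists_multiplier (C := 1) (fun n => by simp [wt_neg, dsymb_neg, conj_dsymb])
    (norm_dsymb_div_wt_le_one i)

/-- The operator `∂ᵢ (1 - Δ)⁻¹` on `L²`. -/
noncomputable def dresolvent (i : Fin d) : L2 d →L[ℝ] L2 d := (exists_dresolvent i).choose

theorem fc_dresolvent (i : Fin d) (u : L2 d) (n : Fin d → ℤ) :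
    fc (dresolvent i u) n = (dsymb i n * ((wt n : ℂ))⁻¹) * fc u n :=
  (exists_dresolvent i).choose_spec u n

theorem isCompactOperator_resolvent : IsCompactOperator (resolvent d) := by
  refine isCompactOperator_of_symbol (C := 1) (σ := fun n => ((wt n : ℂ))⁻¹)
    (fun n => by simp [wt_neg]) (fun n => ?_) fc_resolvent fun ε hε => ?_
  · rw [norm_inv, Complex.norm_real, Real.norm_of_nonneg (wt_pos n).le]
    exact inv_le_one_of_one_le₀ (one_le_wt n)
  · refine (finite_setOf_wt_le (show d < 2 * (d + 1) by omega) ε⁻¹).subset fun n hn => ?_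
    simp only [mem_ofPred_eq] at hn ⊢
    rw [norm_inv, Complex.norm_real, Real.norm_of_nonneg (wt_pos n).le] at hn
    exact (le_inv_comm₀ hε (wt_pos n)).1 hn

theorem isCompactOperator_dresolvent (i : Fin d) : IsCompactOperator (dresolvent i) := by
  refine isCompactOperator_of_symbol (C := 1) (σ := fun n => dsymb i n * ((wt n : ℂ))⁻¹)
    (fun n => by simp [wt_neg, dsymb_neg, conj_dsymb]) (norm_dsymb_div_wt_le_one i)
    (fc_dresolvent i) fun ε hε => ?_
  refine (finite_setOf_wt_le (show d < 2 * (d + 1) by omega) (ε ^ 2)⁻¹).subset fun n hn => ?_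
  simp only [mem_ofPred_eq] at hn ⊢
  have h := (pow_le_pow_left₀ hε.le hn 2).trans (norm_dsymb_div_wt_sq_le i n)
  exact (le_inv_comm₀ (by positivity) (wt_pos n)).1 h

theorem hasWeakPDeriv_resolvent (i : Fin d) (p : L2 d) :
    HasWeakPDeriv i (resolvent d p) (dresolvent i p) :=
  hasWeakPDeriv_iff.2 fun n => by rw [fc_dresolvent, fc_resolvent, mul_assoc]

theorem wpderiv_resolvent (i : Fin d) (p : L2 d) : wpderiv i (resolvent d p) = dresolvent i p :=
  (hasWeakPDeriv_resolvent i p).wpderiv_eq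

theorem MemH.resolvent {k : ℕ} {p : L2 d} (hp : MemH k p) : MemH (k + 2) (resolvent d p) :=
  memH_add_two_of_fc hp fun n => by
    rw [fc_resolvent, mul_inv_cancel_left₀ (wt_ne_zero n)]

theorem MemH.dresolvent {k : ℕ} {p : L2 d} (hp : MemH k p) (i : Fin d) :
    MemH (k + 1) (dresolvent i p) := by
  rw [← wpderiv_resolvent]
  exact hp.resolvent.wpderiv i

theorem MemH.fc_sub_wlap {v : L2 d} (hv : MemH 2 v) (n : Fin d → ℤ) :
    fc (v - wlap v) n = wt n * fc v n := by
  have h : ∀ i, fc (MFG.wpderiv i (MFG.wpderiv i v)) n = dsymb i n * dsymb i n * fc v n :=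
    fun i => by
    rw [(hv.wpderiv i).fc_wpderiv, hv.fc_wpderiv, mul_assoc]
  rw [fc_sub, wlap, fc_sum, wt_eq]
  simp only [h, ← Finset.sum_mul]
  ring

theorem MemH.resolvent_sub_wlap {v : L2 d} (hv : MemH 2 v) : MFG.resolvent d (v - wlap v) = v :=
  fc_injective fun n => by
    rw [fc_resolvent, hv.fc_sub_wlap, inv_mul_cancel_left₀ (wt_ne_zero n)]

theorem resolvent_sub_wlap_resolvent (p : L2 d) :
    resolvent d p - wlap (resolvent d p) = p :=
  fc_injective fun n => by
    have h : MemH 2 (resolvent d p) := MemH.resolvent (k := 0) trivial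
    rw [h.fc_sub_wlap, fc_resolvent, mul_inv_cancel_left₀ (wt_ne_zero n)]

/-! ### Multiplication operators and the product rule -/

theorem mulL2_add {a : Torus d → ℝ} (ha : Continuous a) (v w : L2 d) :
    mulL2 a (v + w) = mulL2 a v + mulL2 a w := by
  refine Lp.ext ?_
  filter_upwards [coeFn_mulL2 ha (v + w), coeFn_mulL2 ha v, coeFn_mulL2 ha w, Lp.coeFn_add v w,
    Lp.coeFn_add (mulL2 a v) (mulL2 a w)] with x h1 h2 h3 h4 h5
  rw [h1, h5, Pi.add_apply, h2, h3, h4, Pi.add_apply, mul_add]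

theorem mulL2_smul {a : Torus d → ℝ} (ha : Continuous a) (c : ℝ) (w : L2 d) :
    mulL2 a (c • w) = c • mulL2 a w := by
  refine Lp.ext ?_
  filter_upwards [coeFn_mulL2 ha (c • w), coeFn_mulL2 ha w, Lp.coeFn_smul c w,
    Lp.coeFn_smul c (mulL2 a w)] with x h1 h2 h3 h4
  rw [h1, h4, Pi.smul_apply, h2, h3, Pi.smul_apply, smul_eq_mul, smul_eq_mul, mul_left_comm]

theorem add_mulL2 {a b : Torus d → ℝ} (ha : Continuous a) (hb : Continuous b) (w : L2 d) :
    mulL2 (fun x => a x + b x) w = mulL2 a w + mulL2 b w := by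
  refine Lp.ext ?_
  have hc : Continuous fun x => a x + b x := ha.add hb
  filter_upwards [coeFn_mulL2 hc w, coeFn_mulL2 ha w, coeFn_mulL2 hb w,
    Lp.coeFn_add (mulL2 a w) (mulL2 b w)] with x h1 h2 h3 h4
  rw [h1, h4, Pi.add_apply, h2, h3, add_mul]

theorem const_mul_mulL2 {a : Torus d → ℝ} (ha : Continuous a) (c : ℝ) (w : L2 d) :
    mulL2 (fun x => c * a x) w = c • mulL2 a w := by
  refine Lp.ext ?_
  have hc : Continuous fun x => c * a x := continuous_const.mul ha
  filter_upwards [coeFn_mulL2 hc w, coeFn_mulL2 ha w, Lp.coeFn_smul c (mulL2 a w)] with x h1 h2 h3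
  rw [h1, h3, Pi.smul_apply, h2, smul_eq_mul, mul_assoc]

/-- Multiplication by a continuous function, as a bounded operator on `L²`. -/
noncomputable def mulCLM (a : Torus d → ℝ) (ha : Continuous a) : L2 d →L[ℝ] L2 d :=
  LinearMap.mkContinuous ⟨⟨mulL2 a, mulL2_add ha⟩, mulL2_smul ha⟩
    (exists_bound_of_continuous ha).choose fun w => by
      refine Lp.norm_le_mul_norm_of_ae_le_mul ?_
      filter_upwards [coeFn_mulL2 ha w] with x hx
      change ‖mulL2 a w x‖ ≤ _
      rw [hx, norm_mul]
      exact mul_le_mul_of_nonneg_right ((exists_bound_of_continuous ha).choose_spec x)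
        (norm_nonneg _)

theorem mulCLM_apply {a : Torus d → ℝ} (ha : Continuous a) (w : L2 d) :
    mulCLM a ha w = mulL2 a w := rfl

/-- The product rule for a `C¹` function and a weakly differentiable one. -/
theorem HasWeakPDeriv.mulL2 {i : Fin d} {f g : L2 d} (h : HasWeakPDeriv i f g)
    {a : Torus d → ℝ} (ha : TorusContDiff 1 a) :
    HasWeakPDeriv i (mulL2 a f) (mulL2 a g + mulL2 (pderiv i a) f) := by
  intro φ hφ
  have hφ1 : TorusContDiff 1 φ := hφ.of_le (by simp)
  have hp := hφ1.continuous_pderiv i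
  have hpa := ha.continuous_pderiv i
  have h1 := h.inner_eq (hasWeakPDeriv_classL2 (ha.mul hφ1) i)
  rw [inner_classL2 _ ((ha.mul hφ1).continuous_pderiv i), inner_classL2 _ (ha.mul hφ1).continuous]
    at h1
  have e1 : ∫ x, f x * MFG.pderiv i (fun y => a y * φ y) x ∂(torusMeasure d)
      = ∫ x, MFG.mulL2 a f x * MFG.pderiv i φ x ∂(torusMeasure d)
        + ∫ x, MFG.mulL2 (MFG.pderiv i a) f x * φ x ∂(torusMeasure d) := by
    rw [← integral_add (integrable_mul_continuous _ hp)
      (integrable_mul_continuous _ hφ.continuous)]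
    refine integral_congr_ae ?_
    filter_upwards [coeFn_mulL2 ha.continuous f, coeFn_mulL2 hpa f] with x h2 h3
    rw [h2, h3, pderiv_mul ha hφ1 one_ne_zero]
    ring
  have e2 : ∫ x, g x * (a x * φ x) ∂(torusMeasure d)
      = ∫ x, MFG.mulL2 a g x * φ x ∂(torusMeasure d) := by
    refine integral_congr_ae ?_
    filter_upwards [coeFn_mulL2 ha.continuous g] with x h2
    rw [h2]; ring
  have e3 : ∫ x, (MFG.mulL2 a g + MFG.mulL2 (MFG.pderiv i a) f : L2 d) x * φ x ∂(torusMeasure d)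
      = ∫ x, MFG.mulL2 a g x * φ x ∂(torusMeasure d)
        + ∫ x, MFG.mulL2 (MFG.pderiv i a) f x * φ x ∂(torusMeasure d) := by
    rw [← integral_add (integrable_mul_continuous _ hφ.continuous)
      (integrable_mul_continuous _ hφ.continuous)]
    refine integral_congr_ae ?_
    filter_upwards [Lp.coeFn_add (MFG.mulL2 a g) (MFG.mulL2 (MFG.pderiv i a) f)] with x h2
    rw [h2, Pi.add_apply, add_mul]
  rw [e3]
  linarith

/-! ### The Fredholm alternative -/

/-- An injective compact perturbation of an isomorphism is bijective. -/
theorem bijective_of_compact_perturbation {X : Type*} [NormedAddCommGroup X] [NormedSpace ℝ X]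
    [CompleteSpace X] (J : X ≃L[ℝ] X) {T : X →L[ℝ] X} (hT : IsCompactOperator T)
    (hinj : ∀ x, J x + T x = 0 → x = 0) :
    Function.Bijective ((J : X →L[ℝ] X) + T) := by
  have hS : IsCompactOperator ((J.symm : X →L[ℝ] X) ∘L T) := hT.clm_comp (J.symm : X →L[ℝ] X)
  refine ⟨(injective_iff_map_eq_zero _).2 fun x hx => hinj x hx, fun y => ?_⟩
  rcases hS.hasEigenvalue_or_mem_resolventSet (μ := (-1 : ℝ)) (by norm_num) with h | h
  · obtain ⟨x, hx⟩ := h.exists_hasEigenvector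
    refine absurd (hinj x ?_) hx.2
    have h1 : J.symm (T x) = -x := by simpa using hx.apply_eq_smul
    have h2 : T x = J (-x) := by rw [← h1, J.apply_symm_apply]
    rw [h2, map_neg, add_neg_cancel]
  · rw [spectrum.mem_resolventSet_iff, ContinuousLinearMap.isUnit_iff_bijective] at h
    obtain ⟨x, hx⟩ := h.2 (J.symm y)
    have h1 : -x - J.symm (T x) = J.symm y := by
      simpa [Algebra.algebraMap_eq_smul_one] using hx
    refine ⟨-x, ?_⟩
    have h2 := congrArg J h1
    simp only [map_sub, J.apply_symm_apply] at h2
    rw [← h2]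
    simp [sub_eq_add_neg]

/-! ### Completeness of the Sobolev spaces -/

/-- An element of `H^k`, from its class in `L²`. -/
def H.mk {k : ℕ} (u : L2 d) (hu : MemH k u) : H d k :=
  (⟨u, hu⟩ : sobolevSubmodule d k)

theorem H.toL2_mk {k : ℕ} (u : L2 d) (hu : MemH k u) : (H.mk u hu).toL2 = u := rfl

theorem H.ext {k : ℕ} {u v : H d k} (h : u.toL2 = v.toL2) : u = v := Subtype.ext h

theorem H.memH {k : ℕ} (u : H d k) : MemH k u.toL2 := u.property

theorem H.norm_sq {k : ℕ} (u : H d k) : ‖u‖ ^ 2 = innerH k u.toL2 u.toL2 :=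
  (real_inner_self_eq_norm_sq u).symm

/-- The inclusion of `H^k` into `L²`, as a bounded operator. -/
noncomputable def H.inclusion (d k : ℕ) : H d k →L[ℝ] L2 d :=
  LinearMap.mkContinuous ⟨⟨H.toL2, fun _ _ => rfl⟩, fun _ _ => rfl⟩ 1 fun u => by
    refine le_of_sq_le_sq ?_ (by positivity)
    rw [one_mul, H.norm_sq, ← real_inner_self_eq_norm_sq]
    exact innerH_self_nonneg k u.toL2

/-- The weak derivative `∂ᵢ : H^{k+1} → H^k`. -/
noncomputable def H.deriv {k : ℕ} (i : Fin d) (u : H d (k + 1)) : H d k :=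
  H.mk (wpderiv i u.toL2) (u.memH.wpderiv i)

theorem wpderiv_sub {k : ℕ} {u v : L2 d} (hu : MemH (k + 1) u) (hv : MemH (k + 1) v)
    (i : Fin d) : wpderiv i (u - v) = wpderiv i u - wpderiv i v :=
  fc_injective fun n => by
    rw [(hu.sub hv).fc_wpderiv, fc_sub, fc_sub, hu.fc_wpderiv, hv.fc_wpderiv, mul_sub]

theorem H.deriv_sub {k : ℕ} (i : Fin d) (u v : H d (k + 1)) :
    H.deriv i (u - v) = H.deriv i u - H.deriv i v :=
  H.ext (wpderiv_sub u.memH v.memH i)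

theorem H.norm_sq_succ {k : ℕ} (u : H d (k + 1)) :
    ‖u‖ ^ 2 = ‖u.toL2‖ ^ 2 + ∑ i, ‖H.deriv i u‖ ^ 2 := by
  simp only [H.norm_sq, innerH, real_inner_self_eq_norm_sq]
  rfl

theorem H.norm_deriv_le {k : ℕ} (i : Fin d) (u : H d (k + 1)) : ‖H.deriv i u‖ ≤ ‖u‖ := by
  refine le_of_sq_le_sq ?_ (norm_nonneg _)
  rw [H.norm_sq_succ u]
  have := Finset.single_le_sum (f := fun i => ‖H.deriv i u‖ ^ 2) (fun i _ => sq_nonneg _)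
    (Finset.mem_univ i)
  linarith [sq_nonneg ‖u.toL2‖]

theorem norm_fc_le (u : L2 d) (n : Fin d → ℤ) : ‖fc u n‖ ≤ ‖u‖ := by
  refine le_of_sq_le_sq ?_ (norm_nonneg _)
  exact le_hasSum (hasSum_fc_sq u) n fun m _ => sq_nonneg _

theorem tendsto_fc {ι : Type*} {l : Filter ι} {u : ι → L2 d} {v : L2 d}
    (h : Filter.Tendsto u l (nhds v)) (n : Fin d → ℤ) :
    Filter.Tendsto (fun j => fc (u j) n) l (nhds (fc v n)) := by
  rw [tendsto_iff_norm_sub_tendsto_zero] at h ⊢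
  refine squeeze_zero (fun _ => norm_nonneg _) (fun j => ?_) h
  rw [← fc_sub]
  exact norm_fc_le _ _

instance instCompleteSpaceH (d k : ℕ) : CompleteSpace (H d k) := by
  induction k with
  | zero =>
    refine Metric.complete_of_cauchySeq_tendsto fun u hu => ?_
    have hu' : CauchySeq fun n => (u n).toL2 := (H.inclusion d 0).lipschitz.cauchySeq_comp hu
    obtain ⟨v, hv⟩ := cauchySeq_tendsto_of_complete hu'
    refine ⟨H.mk v trivial, ?_⟩
    rw [tendsto_iff_norm_sub_tendsto_zero] at hv ⊢
    refine hv.congr fun n => ?_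
    refine (sq_eq_sq₀ (norm_nonneg _) (norm_nonneg _)).1 ?_
    rw [H.norm_sq, innerH, real_inner_self_eq_norm_sq]
    rfl
  | succ k ih =>
    refine Metric.complete_of_cauchySeq_tendsto fun u hu => ?_
    have hu' : CauchySeq fun n => (u n).toL2 :=
      (H.inclusion d (k + 1)).lipschitz.cauchySeq_comp hu
    have hD : ∀ i, CauchySeq fun n => H.deriv i (u n) := fun i => by
      refine (LipschitzWith.of_dist_le_mul (K := 1) fun x y => ?_).cauchySeq_comp hu
        (f := H.deriv i)
      rw [dist_eq_norm, dist_eq_norm, ← H.deriv_sub, NNReal.coe_one, one_mul]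
      exact H.norm_deriv_le _ _
    obtain ⟨v, hv⟩ := cauchySeq_tendsto_of_complete hu'
    choose g hg using fun i => cauchySeq_tendsto_of_complete (hD i)
    have hgL : ∀ i, Filter.Tendsto (fun n => (H.deriv i (u n)).toL2) Filter.atTop
        (nhds (g i).toL2) := fun i =>
      ((H.inclusion d k).continuous.tendsto (g i)).comp (hg i)
    have hw : ∀ i, HasWeakPDeriv i v (g i).toL2 := fun i => hasWeakPDeriv_iff.2 fun n => by
      refine tendsto_nhds_unique (tendsto_fc (hgL i) n) ?_
      refine ((tendsto_fc hv n).const_mul (dsymb i n)).congr fun j => ?_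
      exact ((u j).memH.fc_wpderiv i n).symm
    refine ⟨H.mk v fun i => ⟨_, hw i, (g i).memH⟩, ?_⟩
    have hgi : ∀ i, H.deriv i (H.mk v fun i => ⟨_, hw i, (g i).memH⟩ : H d (k + 1)) = g i :=
      fun i => H.ext (hw i).wpderiv_eq
    rw [tendsto_iff_norm_sub_tendsto_zero]
    have h1 : Filter.Tendsto (fun n => ‖(u n).toL2 - v‖ ^ 2 + ∑ i, ‖H.deriv i (u n) - g i‖ ^ 2)
        Filter.atTop (nhds (0 ^ 2 + ∑ _i : Fin d, 0 ^ 2)) :=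
      ((tendsto_iff_norm_sub_tendsto_zero.1 hv).pow 2).add (tendsto_finsetSum _ fun i _ =>
        (tendsto_iff_norm_sub_tendsto_zero.1 (hg i)).pow 2)
    simp only [ne_eq, OfNat.ofNat_ne_zero, not_false_eq_true, zero_pow, Finset.sum_const_zero,
      add_zero] at h1
    have h2 := h1.sqrt
    rw [Real.sqrt_zero] at h2
    refine h2.congr fun n => ?_
    rw [Real.sqrt_eq_iff_mul_self_eq (by positivity) (norm_nonneg _), ← sq, H.norm_sq_succ]
    simp only [H.deriv_sub, hgi]
    rfl

/-! ### Linear second-order systems with smooth coefficients -/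

/-- The coefficients admitted in the linear systems: `C¹` functions lying in every `H^s`. -/
structure SmoothCoef (a : Torus d → ℝ) : Prop where
  C1 : TorusContDiff 1 a
  sob : ∀ s, SobCont s a

/-- The exponent `j + (d + 1)` of the coefficient is one that exceeds both `j` and `d / 2`. -/
theorem SmoothCoef.memH_mulL2 {a : Torus d → ℝ} (ha : SmoothCoef a) {j : ℕ} {g : L2 d}
    (hg : MemH j g) : MemH j (mulL2 a g) :=
  MemH.mulL2 (s := j + (d + 1)) (by omega) (by omega) ha.C1.continuous (ha.sob _).memH hg

theorem SmoothCoef.memH_mulL2_pderiv {a : Torus d → ℝ} (ha : SmoothCoef a) (i : Fin d) {j : ℕ}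
    {g : L2 d} (hg : MemH j g) : MemH j (mulL2 (pderiv i a) g) :=
  MemH.mulL2 (s := j + (d + 1)) (by omega) (by omega) (ha.C1.continuous_pderiv i)
    ((ha.sob _).pderiv ha.C1 i).memH hg

/-- First row `v - Δv + ∑ βᵢ ∂ᵢv - γ f` of a linear system in divergence form. -/
noncomputable def sysFst (β : Fin d → Torus d → ℝ) (γ : Torus d → ℝ) (v f : L2 d) : L2 d :=
  v - wlap v + ∑ i, mulL2 (β i) (wpderiv i v) - mulL2 γ f

/-- Second row `f - Δf - div(a Dv) - div(c f)` of a linear system in divergence form. -/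
noncomputable def sysSnd (a : Torus d → ℝ) (c : Fin d → Torus d → ℝ) (v f : L2 d) : L2 d :=
  f - wlap f - wdiv (fun i => mulL2 a (wpderiv i v)) - wdiv (fun i => mulL2 (c i) f)

/-- The compact part of the first row, in the unknowns `p = v - Δv` and `q = f - Δf`. -/
noncomputable def compFst (β : Fin d → Torus d → ℝ) (γ : Torus d → ℝ) (w : L2 d × L2 d) : L2 d :=
  ∑ i, mulL2 (β i) (dresolvent i w.1) + -mulL2 γ (resolvent d w.2)

/-- The compact part of the second row, in the unknowns `p = v - Δv` and `q = f - Δf`. -/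
noncomputable def compSnd (a : Torus d → ℝ) (c : Fin d → Torus d → ℝ) (w : L2 d × L2 d) : L2 d :=
  -(mulL2 a (resolvent d w.1) + ∑ i, mulL2 (pderiv i a) (dresolvent i w.1)
    + ∑ i, (mulL2 (c i) (dresolvent i w.2) + mulL2 (pderiv i (c i)) (resolvent d w.2)))

theorem sysFst_resolvent (β : Fin d → Torus d → ℝ) (γ : Torus d → ℝ) (w : L2 d × L2 d) :
    sysFst β γ (resolvent d w.1) (resolvent d w.2) = w.1 + compFst β γ w := by
  simp only [sysFst, compFst, resolvent_sub_wlap_resolvent, wpderiv_resolvent]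
  abel

/-- In nondivergence form the second row reads
`q - a ΔR p - Da·DR p - ⋯` with `R = (1 - Δ)⁻¹`, and `-ΔR p = p - R p`: the only non-compact
contribution of the divergence term is `a p`. -/
theorem sysSnd_resolvent {a : Torus d → ℝ} (ha : TorusContDiff 1 a) {c : Fin d → Torus d → ℝ}
    (hc : ∀ i, TorusContDiff 1 (c i)) (w : L2 d × L2 d) :
    sysSnd a c (resolvent d w.1) (resolvent d w.2) = w.2 + mulL2 a w.1 + compSnd a c w := by
  have h1 : ∀ i, wpderiv i (mulL2 a (dresolvent i w.1))
      = mulL2 a (wpderiv i (dresolvent i w.1)) + mulL2 (pderiv i a) (dresolvent i w.1) :=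
    fun i => by
    have h : MemH 1 (dresolvent i w.1) := MemH.dresolvent (k := 0) trivial i
    exact ((h.hasWeakPDeriv i).mulL2 ha).wpderiv_eq
  have h2 : ∀ i, wpderiv i (mulL2 (c i) (resolvent d w.2))
      = mulL2 (c i) (dresolvent i w.2) + mulL2 (pderiv i (c i)) (resolvent d w.2) := fun i =>
    ((hasWeakPDeriv_resolvent i w.2).mulL2 (hc i)).wpderiv_eq
  have h3 : ∑ i, mulL2 a (wpderiv i (dresolvent i w.1))
      = mulL2 a (resolvent d w.1) - mulL2 a w.1 := by
    simp only [← mulCLM_apply ha.continuous]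
    rw [← map_sum, ← map_sub]
    congr 1
    have h := resolvent_sub_wlap_resolvent w.1
    simp only [wlap, wpderiv_resolvent] at h
    nth_rewrite 3 [← h]
    abel
  simp only [sysSnd, compSnd, resolvent_sub_wlap_resolvent, wpderiv_resolvent, wdiv, h1, h2]
  rw [Finset.sum_add_distrib, h3]
  abel

/-- `F` is a compact linear operator. -/
def IsCompactLinear {X Y : Type*} [NormedAddCommGroup X] [NormedSpace ℝ X] [NormedAddCommGroup Y]
    [NormedSpace ℝ Y] (F : X → Y) : Prop :=
  ∃ T : X →L[ℝ] Y, IsCompactOperator T ∧ ∀ x, T x = F x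

section IsCompactLinear

variable {X Y Z : Type*} [NormedAddCommGroup X] [NormedSpace ℝ X] [NormedAddCommGroup Y]
  [NormedSpace ℝ Y] [NormedAddCommGroup Z] [NormedSpace ℝ Z]

theorem IsCompactLinear.add {F G : X → Y} (hF : IsCompactLinear F) (hG : IsCompactLinear G) :
    IsCompactLinear fun x => F x + G x := by
  obtain ⟨S, hS, hS'⟩ := hF
  obtain ⟨T, hT, hT'⟩ := hG
  exact ⟨S + T, hS.add hT, fun x => by simp [hS', hT']⟩

theorem IsCompactLinear.neg {F : X → Y} (hF : IsCompactLinear F) :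
    IsCompactLinear fun x => -F x := by
  obtain ⟨S, hS, hS'⟩ := hF
  exact ⟨-S, hS.neg, fun x => by simp [hS']⟩

theorem IsCompactLinear.sum {ι : Type*} (t : Finset ι) {F : ι → X → Y}
    (hF : ∀ i, IsCompactLinear (F i)) : IsCompactLinear fun x => ∑ i ∈ t, F i x := by
  classical
  induction t using Finset.induction_on with
  | empty => exact ⟨0, isCompactOperator_zero, fun x => by simp⟩
  | insert a t ha ih =>
    simp only [Finset.sum_insert ha]
    exact (hF a).add ih

theorem IsCompactLinear.clm_comp {F : X → Y} (hF : IsCompactLinear F) (g : Y →L[ℝ] Z) :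
    IsCompactLinear fun x => g (F x) := by
  obtain ⟨S, hS, hS'⟩ := hF
  exact ⟨g ∘L S, hS.clm_comp g, fun x => by simp [hS']⟩

end IsCompactLinear

theorem IsCompactLinear.mulL2 {X : Type*} [NormedAddCommGroup X] [NormedSpace ℝ X] {F : X → L2 d}
    (hF : IsCompactLinear F) {a : Torus d → ℝ} (ha : Continuous a) :
    IsCompactLinear fun x => mulL2 a (F x) :=
  hF.clm_comp (mulCLM a ha)

theorem isCompactLinear_comp_clm {X : Type*} [NormedAddCommGroup X] [NormedSpace ℝ X]
    {T : L2 d →L[ℝ] L2 d} (hT : IsCompactOperator T) (g : X →L[ℝ] L2 d) :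
    IsCompactLinear fun x => T (g x) :=
  ⟨T ∘L g, hT.comp_clm g, fun _ => rfl⟩

theorem isCompactLinear_compFst {β : Fin d → Torus d → ℝ} {γ : Torus d → ℝ}
    (hβ : ∀ i, Continuous (β i)) (hγ : Continuous γ) :
    IsCompactLinear fun w : L2 d × L2 d => compFst β γ w := by
  have r2 := isCompactLinear_comp_clm isCompactOperator_resolvent
    (ContinuousLinearMap.snd ℝ (L2 d) (L2 d))
  have s1 := fun i => isCompactLinear_comp_clm (isCompactOperator_dresolvent (d := d) i)
    (ContinuousLinearMap.fst ℝ (L2 d) (L2 d))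
  exact (IsCompactLinear.sum _ fun i => (s1 i).mulL2 (hβ i)).add (r2.mulL2 hγ).neg

theorem isCompactLinear_compSnd {a : Torus d → ℝ} (ha : TorusContDiff 1 a)
    {c : Fin d → Torus d → ℝ} (hc : ∀ i, TorusContDiff 1 (c i)) :
    IsCompactLinear fun w : L2 d × L2 d => compSnd a c w := by
  have r1 := isCompactLinear_comp_clm isCompactOperator_resolvent
    (ContinuousLinearMap.fst ℝ (L2 d) (L2 d))
  have r2 := isCompactLinear_comp_clm isCompactOperator_resolvent
    (ContinuousLinearMap.snd ℝ (L2 d) (L2 d))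
  have s1 := fun i => isCompactLinear_comp_clm (isCompactOperator_dresolvent (d := d) i)
    (ContinuousLinearMap.fst ℝ (L2 d) (L2 d))
  have s2 := fun i => isCompactLinear_comp_clm (isCompactOperator_dresolvent (d := d) i)
    (ContinuousLinearMap.snd ℝ (L2 d) (L2 d))
  exact (((r1.mulL2 ha.continuous).add
    (IsCompactLinear.sum _ fun i => (s1 i).mulL2 (ha.continuous_pderiv i))).add
    (IsCompactLinear.sum _ fun i => ((s2 i).mulL2 (hc i).continuous).add
      (r2.mulL2 ((hc i).continuous_pderiv i)))).neg

/-- The triangular isomorphism `(p, q) ↦ (p, q + a p)` of `L² × L²`. -/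
noncomputable def shear (a : Torus d → ℝ) (ha : Continuous a) :
    (L2 d × L2 d) ≃L[ℝ] (L2 d × L2 d) :=
  ContinuousLinearEquiv.equivOfInverse
    ((ContinuousLinearMap.fst ℝ _ _).prod
      (ContinuousLinearMap.snd ℝ _ _ + mulCLM a ha ∘L ContinuousLinearMap.fst ℝ _ _))
    ((ContinuousLinearMap.fst ℝ _ _).prod
      (ContinuousLinearMap.snd ℝ _ _ - mulCLM a ha ∘L ContinuousLinearMap.fst ℝ _ _))
    (fun w => by ext1 <;> simp) (fun w => by ext1 <;> simp)

/-- If the system has trivial kernel in `H² × H²`, then it is an isomorphism `A` of `L² × L²` in the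
unknowns `p = v - Δv` and `q = f - Δf`. -/
theorem exists_equiv_of_trivial_kernel {β : Fin d → Torus d → ℝ} {γ a : Torus d → ℝ}
    {c : Fin d → Torus d → ℝ} (hβ : ∀ i, SmoothCoef (β i)) (hγ : SmoothCoef γ)
    (ha : SmoothCoef a) (hc : ∀ i, SmoothCoef (c i))
    (hker : ∀ v f : L2 d, MemH 2 v → MemH 2 f → sysFst β γ v f = 0 → sysSnd a c v f = 0 →
      v = 0 ∧ f = 0) :
    ∃ A : (L2 d × L2 d) ≃L[ℝ] (L2 d × L2 d), ∀ w,
      A w = (w.1 + compFst β γ w, w.2 + mulL2 a w.1 + compSnd a c w) := by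
  have hT : IsCompactLinear fun w : L2 d × L2 d => (compFst β γ w, compSnd a c w) := by
    have h := ((isCompactLinear_compFst (fun i => (hβ i).C1.continuous) hγ.C1.continuous).clm_comp
      (ContinuousLinearMap.inl ℝ (L2 d) (L2 d))).add
      ((isCompactLinear_compSnd ha.C1 (fun i => (hc i).C1)).clm_comp
      (ContinuousLinearMap.inr ℝ (L2 d) (L2 d)))
    simpa using h
  obtain ⟨T, hT, hT'⟩ := hT
  have hJ : ∀ w, shear a ha.C1.continuous w + T w
      = (w.1 + compFst β γ w, w.2 + mulL2 a w.1 + compSnd a c w) := fun w => by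
    rw [hT']; rfl
  have hbij := bijective_of_compact_perturbation (shear a ha.C1.continuous) hT fun w hw => by
    rw [hJ] at hw
    have h1 := congrArg Prod.fst hw
    have h2 := congrArg Prod.snd hw
    simp only [Prod.fst_zero, Prod.snd_zero] at h1 h2
    rw [← sysFst_resolvent] at h1
    rw [← sysSnd_resolvent ha.C1 fun i => (hc i).C1] at h2
    have hm : ∀ p : L2 d, MemH 2 (resolvent d p) := fun p => MemH.resolvent (k := 0) trivial
    obtain ⟨h3, h4⟩ := hker _ _ (hm _) (hm _) h1 h2
    have hz : ∀ p : L2 d, resolvent d p = 0 → p = 0 := fun p hp => fc_injective fun n => by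
      have h5 := fc_resolvent p n
      rw [hp, fc_zero] at h5
      rw [fc_zero]
      exact (mul_eq_zero.1 h5.symm).resolve_left (inv_ne_zero (wt_ne_zero n))
    exact Prod.ext (hz _ h3) (hz _ h4)
  refine ⟨ContinuousLinearEquiv.ofBijective _ (LinearMap.ker_eq_bot.2 hbij.1)
    (LinearMap.range_eq_top.2 hbij.2), fun w => ?_⟩
  rw [← hJ]
  rfl

theorem memH_compFst {β : Fin d → Torus d → ℝ} {γ : Torus d → ℝ} (hβ : ∀ i, SmoothCoef (β i))
    (hγ : SmoothCoef γ) {j : ℕ} {w : L2 d × L2 d} (h1 : MemH j w.1) (h2 : MemH j w.2) :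
    MemH (j + 1) (compFst β γ w) :=
  (MemH.sum fun i _ => (hβ i).memH_mulL2 (h1.dresolvent i)).add
    (hγ.memH_mulL2 h2.resolvent.of_succ).neg

theorem memH_compSnd {a : Torus d → ℝ} {c : Fin d → Torus d → ℝ} (ha : SmoothCoef a)
    (hc : ∀ i, SmoothCoef (c i)) {j : ℕ} {w : L2 d × L2 d} (h1 : MemH j w.1) (h2 : MemH j w.2) :
    MemH (j + 1) (compSnd a c w) :=
  (((ha.memH_mulL2 h1.resolvent.of_succ).add
    (MemH.sum fun i _ => ha.memH_mulL2_pderiv i (h1.dresolvent i))).add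
    (MemH.sum fun i _ => ((hc i).memH_mulL2 (h2.dresolvent i)).add
      ((hc i).memH_mulL2_pderiv i h2.resolvent.of_succ))).neg

/-- A second-order system with smooth coefficients and trivial kernel is an isomorphism from
`E^{k+2}` onto `E^k`. -/
theorem exists_continuousLinearEquiv {β : Fin d → Torus d → ℝ} {γ a : Torus d → ℝ}
    {c : Fin d → Torus d → ℝ} (hβ : ∀ i, SmoothCoef (β i)) (hγ : SmoothCoef γ)
    (ha : SmoothCoef a) (hc : ∀ i, SmoothCoef (c i))
    (hker : ∀ v f : L2 d, MemH 2 v → MemH 2 f → sysFst β γ v f = 0 → sysSnd a c v f = 0 →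
      v = 0 ∧ f = 0) (k : ℕ) :
    ∃ L : E d (k + 2) ≃L[ℝ] E d k, ∀ w : E d (k + 2),
      (L w).1.toL2 = sysFst β γ w.1.toL2 w.2.toL2 ∧
      (L w).2.toL2 = sysSnd a c w.1.toL2 w.2.toL2 := by
  obtain ⟨A, hA⟩ := exists_equiv_of_trivial_kernel hβ hγ ha hc hker
  -- regularity: `A` is the sum of a triangular operator and one that gains a derivative
  have hreg : ∀ z : L2 d × L2 d, MemH k z.1 → MemH k z.2 →
      MemH k (A.symm z).1 ∧ MemH k (A.symm z).2 := by
    intro z h1 h2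
    suffices h : ∀ j ≤ k, MemH j (A.symm z).1 ∧ MemH j (A.symm z).2 from h k le_rfl
    intro j
    induction j with
    | zero => exact fun _ => ⟨trivial, trivial⟩
    | succ j ih =>
      intro hj
      obtain ⟨i1, i2⟩ := ih (by omega)
      have hz := hA (A.symm z)
      rw [A.apply_symm_apply] at hz
      have e1 := congrArg Prod.fst hz
      have e2 := congrArg Prod.snd hz
      simp only at e1 e2
      have m1 : MemH (j + 1) (A.symm z).1 := by
        rw [eq_sub_of_add_eq e1.symm]
        exact (h1.mono hj).sub (memH_compFst hβ hγ i1 i2)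
      have m2 : MemH (j + 1) (A.symm z).2 := by
        rw [eq_sub_of_add_eq (eq_sub_of_add_eq e2.symm)]
        exact ((h2.mono hj).sub (memH_compSnd ha hc i1 i2)).sub (ha.memH_mulL2 m1)
      exact ⟨m1, m2⟩
  have hsys : ∀ w, (sysFst β γ (resolvent d w.1) (resolvent d w.2),
      sysSnd a c (resolvent d w.1) (resolvent d w.2)) = A w := fun w => by
    rw [sysFst_resolvent, sysSnd_resolvent ha.C1 fun i => (hc i).C1, hA]
  let M : E d k →ₗ[ℝ] E d (k + 2) :=
    { toFun := fun z => (H.mk (resolvent d (A.symm (z.1.toL2, z.2.toL2)).1)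
          (hreg (z.1.toL2, z.2.toL2) z.1.memH z.2.memH).1.resolvent,
        H.mk (resolvent d (A.symm (z.1.toL2, z.2.toL2)).2)
          (hreg (z.1.toL2, z.2.toL2) z.1.memH z.2.memH).2.resolvent)
      map_add' := fun y z => by
        refine Prod.ext (H.ext ?_) (H.ext ?_)
        · change resolvent d (A.symm ((y.1.toL2, y.2.toL2) + (z.1.toL2, z.2.toL2))).1
            = resolvent d (A.symm (y.1.toL2, y.2.toL2)).1
              + resolvent d (A.symm (z.1.toL2, z.2.toL2)).1
          rw [map_add, Prod.fst_add, map_add]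
        · change resolvent d (A.symm ((y.1.toL2, y.2.toL2) + (z.1.toL2, z.2.toL2))).2
            = resolvent d (A.symm (y.1.toL2, y.2.toL2)).2
              + resolvent d (A.symm (z.1.toL2, z.2.toL2)).2
          rw [map_add, Prod.snd_add, map_add]
      map_smul' := fun r z => by
        refine Prod.ext (H.ext ?_) (H.ext ?_)
        · change resolvent d (A.symm (r • (z.1.toL2, z.2.toL2))).1
            = r • resolvent d (A.symm (z.1.toL2, z.2.toL2)).1
          rw [map_smul, Prod.smul_fst, map_smul]
        · change resolvent d (A.symm (r • (z.1.toL2, z.2.toL2))).2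
            = r • resolvent d (A.symm (z.1.toL2, z.2.toL2)).2
          rw [map_smul, Prod.smul_snd, map_smul] }
  have hM1 : ∀ z, (M z).1.toL2 = resolvent d (A.symm (z.1.toL2, z.2.toL2)).1 := fun _ => rfl
  have hM2 : ∀ z, (M z).2.toL2 = resolvent d (A.symm (z.1.toL2, z.2.toL2)).2 := fun _ => rfl
  have hMsys : ∀ z, (sysFst β γ (M z).1.toL2 (M z).2.toL2, sysSnd a c (M z).1.toL2 (M z).2.toL2)
      = (z.1.toL2, z.2.toL2) := fun z => by
    rw [hM1, hM2, hsys, A.apply_symm_apply]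
  have hcont : Continuous M := by
    refine M.continuous_of_seq_closed_graph fun z x y hz hy => ?_
    have c1 : Continuous fun z : E d k => resolvent d (A.symm (z.1.toL2, z.2.toL2)).1 :=
      (resolvent d).continuous.comp (continuous_fst.comp (A.symm.continuous.comp
        (((H.inclusion d k).continuous.comp continuous_fst).prodMk
          ((H.inclusion d k).continuous.comp continuous_snd))))
    have c2 : Continuous fun z : E d k => resolvent d (A.symm (z.1.toL2, z.2.toL2)).2 :=
      (resolvent d).continuous.comp (continuous_snd.comp (A.symm.continuous.comp
        (((H.inclusion d k).continuous.comp continuous_fst).prodMk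
          ((H.inclusion d k).continuous.comp continuous_snd))))
    have i1 : Continuous fun z : E d (k + 2) => z.1.toL2 :=
      (H.inclusion d (k + 2)).continuous.comp continuous_fst
    have i2 : Continuous fun z : E d (k + 2) => z.2.toL2 :=
      (H.inclusion d (k + 2)).continuous.comp continuous_snd
    refine Prod.ext (H.ext ?_) (H.ext ?_)
    · exact tendsto_nhds_unique ((i1.tendsto y).comp hy) ((c1.tendsto x).comp hz)
    · exact tendsto_nhds_unique ((i2.tendsto y).comp hy) ((c2.tendsto x).comp hz)
  have hinj : Function.Injective M := fun y z hyz => by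
    have h := hMsys y
    rw [hyz, hMsys z] at h
    exact Prod.ext (H.ext (congrArg Prod.fst h).symm) (H.ext (congrArg Prod.snd h).symm)
  have hsurj : Function.Surjective M := fun w => by
    have m1 : MemH 2 w.1.toL2 := w.1.memH.mono (by omega)
    have m2 : MemH 2 w.2.toL2 := w.2.memH.mono (by omega)
    set p := w.1.toL2 - wlap w.1.toL2 with hp
    set q := w.2.toL2 - wlap w.2.toL2 with hq
    have hpk : MemH k p := w.1.memH.of_succ.of_succ.sub
      (MemH.sum fun i _ => (w.1.memH.wpderiv i).wpderiv i)
    have hqk : MemH k q := w.2.memH.of_succ.of_succ.sub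
      (MemH.sum fun i _ => (w.2.memH.wpderiv i).wpderiv i)
    have g1 : MemH k (A (p, q)).1 := by
      rw [hA]
      exact hpk.add (memH_compFst hβ hγ hpk hqk).of_succ
    have g2 : MemH k (A (p, q)).2 := by
      rw [hA]
      exact (hqk.add (ha.memH_mulL2 hpk)).add (memH_compSnd ha hc hpk hqk).of_succ
    refine ⟨(H.mk _ g1, H.mk _ g2), Prod.ext (H.ext ?_) (H.ext ?_)⟩
    · rw [hM1]
      simp only [H.toL2_mk, Prod.mk.eta, A.symm_apply_apply]
      exact m1.resolvent_sub_wlap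
    · rw [hM2]
      simp only [H.toL2_mk, Prod.mk.eta, A.symm_apply_apply]
      exact m2.resolvent_sub_wlap
  let M' : E d k ≃L[ℝ] E d (k + 2) := ContinuousLinearEquiv.ofBijective ⟨M, hcont⟩
    (LinearMap.ker_eq_bot.2 hinj) (LinearMap.range_eq_top.2 hsurj)
  refine ⟨M'.symm, fun w => ?_⟩
  have h := hMsys (M'.symm w)
  have hw : M (M'.symm w) = w := M'.apply_symm_apply w
  rw [hw] at h
  exact ⟨(congrArg Prod.fst h).symm, (congrArg Prod.snd h).symm⟩

/-! ### Uniqueness for scalar equations in divergence form -/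

theorem rePartL2_toComplexL2 (f : L2 d) : rePartL2 d (toComplexL2 d f) = f := by
  refine Lp.ext ?_
  filter_upwards [coeFn_rePartL2 (toComplexL2 d f), coeFn_toComplexL2 f] with x h1 h2
  rw [h1, h2, Complex.ofReal_re]

theorem rePartL2_smul_expBasis (c : ℂ) (n : Fin d → ℤ) :
    rePartL2 d (c • expBasis d n) = classL2 (reMono c n) := by
  have h : expBasis d n =ᵐ[torusMeasure d] UnitAddTorus.mFourier n := by
    have h1 : expBasis d n = UnitAddTorus.mFourierLp 2 n :=
      congrFun UnitAddTorus.coe_mFourierBasis n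
    rw [h1]
    exact UnitAddTorus.coeFn_mFourierLp 2 n
  refine Lp.ext ?_
  filter_upwards [coeFn_rePartL2 (c • expBasis d n), Lp.coeFn_smul c (expBasis d n), h,
    coeFn_classL2 (reMono_smooth c n).continuous] with x h1 h2 h3 h4
  rw [h1, h2, h4, Pi.smul_apply, h3]
  rfl

/-- Expansion of a real function in real trigonometric monomials. -/
theorem hasSum_classL2_reMono (f : L2 d) :
    HasSum (fun n => classL2 (reMono (fc f n) n)) f := by
  have h := ((expBasis d).hasSum_repr (toComplexL2 d f)).mapL (rePartL2 d)
  simpa only [rePartL2_toComplexL2, rePartL2_smul_expBasis, ← fc_eq_repr] using h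

/-- The truncation of the Fourier series of `f` to the frequencies in `S`. -/
noncomputable def trig (f : L2 d) (S : Finset (Fin d → ℤ)) (x : Torus d) : ℝ :=
  ∑ n ∈ S, reMono (fc f n) n x

theorem trig_smooth (f : L2 d) (S : Finset (Fin d → ℤ)) : TorusContDiff ∞ (trig f S) :=
  ContDiff.sum fun n _ => reMono_smooth (fc f n) n

theorem classL2_trig (f : L2 d) (S : Finset (Fin d → ℤ)) :
    classL2 (trig f S) = ∑ n ∈ S, classL2 (reMono (fc f n) n) := by
  refine Lp.ext ?_
  have hall : ∀ᵐ x ∂(torusMeasure d), ∀ n, classL2 (reMono (fc f n) n) x = reMono (fc f n) n x :=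
    ae_all_iff.2 fun n => coeFn_classL2 (reMono_smooth _ n).continuous
  filter_upwards [coeFn_classL2 (trig_smooth f S).continuous, hall,
    Lp.coeFn_finsetSum S fun n => classL2 (reMono (fc f n) n)] with x h1 h2 h3
  rw [h1, h3]
  simp [trig, h2]

theorem tendsto_classL2_trig (f : L2 d) :
    Filter.Tendsto (fun S => classL2 (trig f S)) Filter.atTop (nhds f) := by
  simp only [classL2_trig]
  exact hasSum_classL2_reMono f

theorem pderiv_trig {i : Fin d} {f g : L2 d} (h : HasWeakPDeriv i f g)
    (S : Finset (Fin d → ℤ)) : pderiv i (trig f S) = trig g S := by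
  funext x
  have h1 : HasDerivAt (fun t : ℝ => trig f S (x + Pi.single i (t : UnitAddCircle)))
      (∑ n ∈ S, pderiv i (reMono (fc f n) n) x) 0 :=
    HasDerivAt.fun_sum fun n _ => (reMono_smooth (fc f n) n).hasDerivAt_zero (by simp) i x
  have h2 : pderiv i (trig f S) x = _ := h1.deriv
  rw [h2]
  simp only [trig, pderiv_reMono, h.fc_eq, mul_comm]

theorem add_sq_pos {η : ℝ} (hη : 0 < η) (t : ℝ) : 0 < t ^ 2 + η ^ 2 := by positivity

/-- A smooth bounded approximation `t / √(t² + η²)` of the sign function. -/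
noncomputable def smoothSign (η t : ℝ) : ℝ := t / Real.sqrt (t ^ 2 + η ^ 2)

/-- The derivative `η² / (t² + η²)^{3/2}` of `smoothSign η`. -/
noncomputable def smoothSignDeriv (η t : ℝ) : ℝ := η ^ 2 / Real.sqrt (t ^ 2 + η ^ 2) ^ 3

theorem contDiff_smoothSign {η : ℝ} (hη : 0 < η) : ContDiff ℝ ∞ (smoothSign η) := by
  unfold smoothSign
  refine contDiff_id.div (ContDiff.sqrt (by fun_prop) fun t => (add_sq_pos hη t).ne') fun t => ?_
  exact (Real.sqrt_pos.2 (add_sq_pos hη t)).ne'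

theorem continuous_smoothSignDeriv {η : ℝ} (hη : 0 < η) : Continuous (smoothSignDeriv η) := by
  unfold smoothSignDeriv
  refine continuous_const.div (by fun_prop) fun t => ?_
  exact pow_ne_zero _ (Real.sqrt_pos.2 (add_sq_pos hη t)).ne'

theorem hasDerivAt_smoothSign {η : ℝ} (hη : 0 < η) (t : ℝ) :
    HasDerivAt (smoothSign η) (smoothSignDeriv η t) t := by
  have hp := add_sq_pos hη t
  have hs := Real.sqrt_pos.2 hp
  have h1 : HasDerivAt (fun t : ℝ => t ^ 2 + η ^ 2) (2 * t) t := by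
    simpa using (hasDerivAt_pow 2 t).add_const (η ^ 2)
  have h2 := (hasDerivAt_id t).div (h1.sqrt hp.ne') hs.ne'
  convert! h2 using 1
  have hsq := Real.sq_sqrt hp.le
  set s := Real.sqrt (t ^ 2 + η ^ 2)
  have hη2 : η ^ 2 = s ^ 2 - t ^ 2 := by linarith
  change η ^ 2 / s ^ 3 = (1 * s - t * (2 * t / (2 * s))) / s ^ 2
  rw [hη2]
  field_simp

theorem le_sqrt_add_sq (η t : ℝ) : η ≤ Real.sqrt (t ^ 2 + η ^ 2) :=
  Real.le_sqrt_of_sq_le (by nlinarith [sq_nonneg t])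

theorem abs_le_sqrt_add_sq (η t : ℝ) : |t| ≤ Real.sqrt (t ^ 2 + η ^ 2) :=
  Real.abs_le_sqrt (by nlinarith [sq_nonneg η])

theorem abs_smoothSign_le {η : ℝ} (hη : 0 < η) (t : ℝ) : |smoothSign η t| ≤ 1 := by
  have hs := Real.sqrt_pos.2 (add_sq_pos hη t)
  rw [smoothSign, abs_div, abs_of_pos hs, div_le_one hs]
  exact abs_le_sqrt_add_sq η t

theorem abs_sub_le_mul_smoothSign {η : ℝ} (hη : 0 < η) (t : ℝ) :
    |t| - η ≤ t * smoothSign η t := by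
  have hp := add_sq_pos hη t
  have hs := Real.sqrt_pos.2 hp
  have h1 := le_sqrt_add_sq η t
  have h2 := abs_le_sqrt_add_sq η t
  have hsq := Real.sq_sqrt hp.le
  unfold smoothSign
  set s := Real.sqrt (t ^ 2 + η ^ 2)
  rw [mul_div_assoc', le_div_iff₀ hs]
  nlinarith [mul_le_mul_of_nonneg_right h2 hs.le, mul_le_mul_of_nonneg_left h1 hη.le]

theorem smoothSignDeriv_nonneg (η t : ℝ) : 0 ≤ smoothSignDeriv η t := by
  unfold smoothSignDeriv; positivity

theorem smoothSignDeriv_mul_sq_le {η : ℝ} (hη : 0 < η) (t : ℝ) :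
    smoothSignDeriv η t * t ^ 2 ≤ η := by
  have hp := add_sq_pos hη t
  have hs := Real.sqrt_pos.2 hp
  have h1 := le_sqrt_add_sq η t
  have hsq := Real.sq_sqrt hp.le
  unfold smoothSignDeriv
  set s := Real.sqrt (t ^ 2 + η ^ 2)
  rw [div_mul_eq_mul_div, div_le_iff₀ (by positivity)]
  have h3 : t ^ 2 ≤ s ^ 2 := by nlinarith [sq_nonneg η]
  calc η ^ 2 * t ^ 2 ≤ η ^ 2 * s ^ 2 := by gcongr
    _ = η * (η * s ^ 2) := by ring
    _ ≤ η * (s * s ^ 2) := by gcongr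
    _ = η * s ^ 3 := by ring

theorem smoothSignDeriv_le {η : ℝ} (hη : 0 < η) (t : ℝ) : smoothSignDeriv η t ≤ η⁻¹ := by
  have hs := Real.sqrt_pos.2 (add_sq_pos hη t)
  have h1 := le_sqrt_add_sq η t
  unfold smoothSignDeriv
  set s := Real.sqrt (t ^ 2 + η ^ 2)
  rw [div_le_iff₀ (by positivity), inv_mul_eq_div, le_div_iff₀ hη]
  calc η ^ 2 * η = η ^ 3 := by ring
    _ ≤ s ^ 3 := by gcongr

theorem norm_classL2_le {φ ψ : Torus d → ℝ} (hφ : Continuous φ) (hψ : Continuous ψ) {C : ℝ}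
    (h : ∀ x, |φ x| ≤ C * |ψ x|) : ‖classL2 φ‖ ≤ C * ‖classL2 ψ‖ := by
  refine Lp.norm_le_mul_norm_of_ae_le_mul ?_
  filter_upwards [coeFn_classL2 hφ, coeFn_classL2 hψ] with x h1 h2
  rw [h1, h2]
  exact h x

theorem norm_classL2_le_one {φ : Torus d → ℝ} (hφ : Continuous φ) (h : ∀ x, |φ x| ≤ 1) :
    ‖classL2 φ‖ ≤ 1 := by
  refine le_of_sq_le_sq ?_ zero_le_one
  rw [← real_inner_self_eq_norm_sq, inner_classL2 _ hφ]
  calc ∫ x, classL2 φ x * φ x ∂(torusMeasure d) = ∫ x, φ x * φ x ∂(torusMeasure d) := by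
        refine integral_congr_ae ?_
        filter_upwards [coeFn_classL2 hφ] with x h1
        rw [h1]
    _ ≤ ∫ _, (1 : ℝ) ^ 2 ∂(torusMeasure d) := by
        refine integral_mono (integrable_of_continuous (hφ.mul hφ)) (integrable_const _) fun x => ?_
        simp only [← sq]
        exact sq_le_sq' (abs_le.1 (h x)).1 (abs_le.1 (h x)).2
    _ = 1 ^ 2 := by simp

theorem inner_classL2_classL2 {φ ψ : Torus d → ℝ} (hφ : Continuous φ) (hψ : Continuous ψ) :
    inner ℝ (classL2 φ) (classL2 ψ) = ∫ x, φ x * ψ x ∂(torusMeasure d) := by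
  rw [inner_classL2 _ hψ]
  refine integral_congr_ae ?_
  filter_upwards [coeFn_classL2 hφ] with x h1
  rw [h1]

theorem MemH.inner_wdiv {X : Fin d → L2 d} (hX : ∀ i, MemH 1 (X i)) {φ : L2 d}
    (hφ : MemH 1 φ) : inner ℝ (wdiv X) φ = -∑ i, inner ℝ (X i) (MFG.wpderiv i φ) := by
  rw [wdiv, sum_inner, ← Finset.sum_neg_distrib]
  refine Finset.sum_congr rfl fun i _ => ?_
  rw [((hX i).hasWeakPDeriv i).inner_eq (hφ.hasWeakPDeriv i), neg_neg]

theorem wlap_eq_wdiv (f : L2 d) : wlap f = wdiv fun i => wpderiv i f := rfl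

/-- The integrand obtained by testing `ψ - Δψ - div(cψ)` with `smoothSign η ψ`. -/
noncomputable def testIntegrand (η : ℝ) (c : Fin d → Torus d → ℝ) (ψ : Torus d → ℝ)
    (x : Torus d) : ℝ :=
  ψ x * smoothSign η (ψ x)
    + ∑ i, (pderiv i ψ x + c i x * ψ x) * (smoothSignDeriv η (ψ x) * pderiv i ψ x)

theorem abs_le_testIntegrand {η : ℝ} (hη : 0 < η) {c : Fin d → Torus d → ℝ} {K : ℝ}
    (hK : ∀ x, ∑ i, c i x ^ 2 ≤ K) (ψ : Torus d → ℝ) (x : Torus d) :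
    |ψ x| ≤ (1 + K / 4) * η + testIntegrand η c ψ x := by
  have h1 := abs_sub_le_mul_smoothSign hη (ψ x)
  have hG := smoothSignDeriv_nonneg η (ψ x)
  have h2 : ∑ i, -(c i x ^ 2 * (smoothSignDeriv η (ψ x) * ψ x ^ 2 / 4))
      ≤ ∑ i, (pderiv i ψ x + c i x * ψ x) * (smoothSignDeriv η (ψ x) * pderiv i ψ x) := by
    refine Finset.sum_le_sum fun i _ => ?_
    nlinarith [mul_nonneg hG (sq_nonneg (pderiv i ψ x + c i x * ψ x / 2))]
  rw [Finset.sum_neg_distrib, ← Finset.sum_mul] at h2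
  have h3 : (∑ i, c i x ^ 2) * (smoothSignDeriv η (ψ x) * ψ x ^ 2 / 4) ≤ K * (η / 4) := by
    have h4 := smoothSignDeriv_mul_sq_le hη (ψ x)
    have h5 : 0 ≤ ∑ i, c i x ^ 2 := Finset.sum_nonneg fun i _ => sq_nonneg _
    have h6 : 0 ≤ smoothSignDeriv η (ψ x) * ψ x ^ 2 := by positivity
    exact mul_le_mul (hK x) (by linarith) (by linarith) (h5.trans (hK x))
  unfold testIntegrand
  linarith

theorem continuous_testIntegrand {η : ℝ} (hη : 0 < η) {c : Fin d → Torus d → ℝ}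
    (hc : ∀ i, Continuous (c i)) {ψ : Torus d → ℝ} (hψ : TorusContDiff ∞ ψ) :
    Continuous (testIntegrand η c ψ) := by
  have h1 : Continuous (smoothSign η) := (contDiff_smoothSign hη).continuous
  have h2 := continuous_smoothSignDeriv hη
  have h3 := hψ.continuous
  have h4 : ∀ i, Continuous (pderiv i ψ) := fun i => (hψ.pderiv_smooth i).continuous
  unfold testIntegrand
  fun_prop

/-- Stability of the tested equation: replacing the solution `f` by a smooth `ψ` costs an error
controlled by the distance of `ψ` to `f` in `H¹`. -/
theorem integral_testIntegrand_le {η : ℝ} (hη : 0 < η) {c : Fin d → Torus d → ℝ}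
    (hc : ∀ i, TorusContDiff 1 (c i)) {f : L2 d} (hf : MemH 2 f)
    (h0 : f - wlap f - wdiv (fun i => mulL2 (c i) f) = 0) {ψ : Torus d → ℝ}
    (hψ : TorusContDiff ∞ ψ) :
    ∫ x, testIntegrand η c ψ x ∂(torusMeasure d)
      ≤ ‖classL2 ψ - f‖ + ∑ i, ‖classL2 (pderiv i ψ) - wpderiv i f
          + mulL2 (c i) (classL2 ψ - f)‖ * (η⁻¹ * ‖classL2 (pderiv i ψ)‖) := by
  have hc0 : ∀ i, Continuous (c i) := fun i => (hc i).continuous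
  have hψ0 := hψ.continuous
  have hF : TorusContDiff ∞ fun x => smoothSign η (ψ x) := (contDiff_smoothSign hη).comp hψ
  have hF0 := hF.continuous
  have hDψ : ∀ i, Continuous (pderiv i ψ) := fun i => (hψ.pderiv_smooth i).continuous
  have hG : ∀ i, Continuous fun x => smoothSignDeriv η (ψ x) * pderiv i ψ x := fun i =>
    ((continuous_smoothSignDeriv hη).comp hψ0).mul (hDψ i)
  have hDF : ∀ i, pderiv i (fun x => smoothSign η (ψ x))
      = fun x => smoothSignDeriv η (ψ x) * pderiv i ψ x := fun i => by
    funext x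
    have h1 := hψ.hasDerivAt_zero (by simp) i x
    have h2 := hasDerivAt_smoothSign hη (ψ (x + Pi.single i ((0 : ℝ) : UnitAddCircle)))
    have h3 := (h2.comp (0 : ℝ) h1).deriv
    simp only [AddCircle.coe_zero, Pi.single_zero, add_zero] at h3
    exact h3
  have hwF : ∀ i, wpderiv i (classL2 fun x => smoothSign η (ψ x))
      = classL2 fun x => smoothSignDeriv η (ψ x) * pderiv i ψ x := fun i => by
    rw [← hDF, classL2_pderiv (hF.of_le (by simp))]
  have hcf : ∀ i, MemH 1 (mulL2 (c i) f) := fun i j =>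
    ⟨_, (hf.hasWeakPDeriv j).mulL2 (hc i), trivial⟩
  have hFm : MemH 1 (classL2 fun x => smoothSign η (ψ x)) := (hF.sobCont 1).memH
  have htest : inner ℝ f (classL2 fun x => smoothSign η (ψ x))
      + ∑ i, inner ℝ (wpderiv i f + mulL2 (c i) f)
        (classL2 fun x => smoothSignDeriv η (ψ x) * pderiv i ψ x) = 0 := by
    have h1 := congrArg (fun z => inner ℝ z (classL2 fun x => smoothSign η (ψ x))) h0
    simp only [inner_sub_left, inner_zero_left, wlap_eq_wdiv] at h1
    rw [MemH.inner_wdiv (fun i => hf.wpderiv i) hFm, MemH.inner_wdiv hcf hFm] at h1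
    simp only [hwF] at h1
    simp only [inner_add_left, Finset.sum_add_distrib]
    linarith
  have hint : ∫ x, testIntegrand η c ψ x ∂(torusMeasure d)
      = inner ℝ (classL2 ψ) (classL2 fun x => smoothSign η (ψ x))
      + ∑ i, inner ℝ (classL2 (pderiv i ψ) + mulL2 (c i) (classL2 ψ))
        (classL2 fun x => smoothSignDeriv η (ψ x) * pderiv i ψ x) := by
    have hcψ : ∀ i, Continuous fun x => c i x * ψ x := fun i => (hc0 i).mul hψ0
    have hs : ∀ i, Continuous fun x => pderiv i ψ x + c i x * ψ x := fun i => (hDψ i).add (hcψ i)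
    simp only [mulL2_classL2 (hc0 _) hψ0, ← classL2_congr_add (hDψ _) (hcψ _)]
    simp only [inner_classL2_classL2 hψ0 hF0, inner_classL2_classL2 (hs _) (hG _)]
    have j1 : Integrable (fun x => ψ x * smoothSign η (ψ x)) (torusMeasure d) :=
      integrable_of_continuous (hψ0.mul hF0)
    have j2 : ∀ i, Integrable (fun x => (pderiv i ψ x + c i x * ψ x)
        * (smoothSignDeriv η (ψ x) * pderiv i ψ x)) (torusMeasure d) := fun i =>
      integrable_of_continuous ((hs i).mul (hG i))
    unfold testIntegrand
    rw [integral_add j1 (integrable_finsetSum _ fun i _ => j2 i),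
      integral_finsetSum _ fun i _ => j2 i]
  have hdiff : ∫ x, testIntegrand η c ψ x ∂(torusMeasure d)
      = inner ℝ (classL2 ψ - f) (classL2 fun x => smoothSign η (ψ x))
      + ∑ i, inner ℝ (classL2 (pderiv i ψ) - wpderiv i f + mulL2 (c i) (classL2 ψ - f))
        (classL2 fun x => smoothSignDeriv η (ψ x) * pderiv i ψ x) := by
    -- subtract the equation for `f` tested with the same function
    rw [hint, ← sub_zero (_ + _), ← htest, inner_sub_left, add_sub_add_comm,
      ← Finset.sum_sub_distrib]
    congr 1
    refine Finset.sum_congr rfl fun i _ => ?_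
    rw [← inner_sub_left]
    congr 1
    simp only [← mulCLM_apply (hc0 i), map_sub]
    abel
  rw [hdiff]
  refine add_le_add ?_ (Finset.sum_le_sum fun i _ => ?_)
  · refine (real_inner_le_norm _ _).trans (mul_le_of_le_one_right (norm_nonneg _) ?_)
    exact norm_classL2_le_one hF0 fun x => abs_smoothSign_le hη _
  · refine (real_inner_le_norm _ _).trans (mul_le_mul_of_nonneg_left ?_ (norm_nonneg _))
    refine norm_classL2_le (hG i) (hDψ i) fun x => ?_
    rw [abs_mul, abs_of_nonneg (smoothSignDeriv_nonneg _ _)]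
    exact mul_le_mul_of_nonneg_right (smoothSignDeriv_le hη _) (abs_nonneg _)

/-- Uniqueness for `f - Δf - div(c f) = 0`, with no sign condition on `div c`: the equation is
tested with a smooth approximation of the sign of `f`, for which the drift contributes
only `O(η)`, so that `∫ |f| = O(η)`. -/
theorem eq_zero_of_divergence_eq {c : Fin d → Torus d → ℝ} (hc : ∀ i, TorusContDiff 1 (c i))
    {f : L2 d} (hf : MemH 2 f) (h0 : f - wlap f - wdiv (fun i => mulL2 (c i) f) = 0) : f = 0 := by
  have hc0 : ∀ i, Continuous (c i) := fun i => (hc i).continuous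
  obtain ⟨K, hK⟩ := exists_bound_of_continuous
    (show Continuous fun x => ∑ i, c i x ^ 2 by fun_prop)
  have hK' : ∀ x, ∑ i, c i x ^ 2 ≤ K := fun x => (le_abs_self _).trans (hK x)
  have hK0 : 0 ≤ K := (norm_nonneg _).trans (hK 0)
  refine eq_zero_of_forall_smooth f fun φ hφ => ?_
  obtain ⟨B, hB⟩ := exists_bound_of_continuous hφ.continuous
  have hB0 : 0 ≤ B := (norm_nonneg _).trans (hB 0)
  rw [← inner_classL2 f hφ.continuous]
  have key : ∀ η > 0, |inner ℝ f (classL2 φ)| ≤ B * ((1 + K / 4) * η) := by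
    intro η hη
    -- the `H¹` distance of the truncated Fourier series to `f` controls the error
    let err : Finset (Fin d → ℤ) → ℝ := fun S => ‖classL2 (trig f S) - f‖
      + ∑ i, ‖classL2 (trig (wpderiv i f) S) - wpderiv i f
          + mulL2 (c i) (classL2 (trig f S) - f)‖ * (η⁻¹ * ‖classL2 (trig (wpderiv i f) S)‖)
    have herr : Filter.Tendsto err Filter.atTop (nhds 0) := by
      have t1 : Filter.Tendsto (fun S => classL2 (trig f S) - f) Filter.atTop (nhds 0) := by
        simpa using (tendsto_classL2_trig f).sub_const f
      have t2 : ∀ i, Filter.Tendsto (fun S => classL2 (trig (wpderiv i f) S) - wpderiv i f)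
          Filter.atTop (nhds 0) := fun i => by
        simpa using (tendsto_classL2_trig (wpderiv i f)).sub_const (wpderiv i f)
      have t3 : ∀ i, Filter.Tendsto (fun S => mulL2 (c i) (classL2 (trig f S) - f))
          Filter.atTop (nhds 0) := fun i => by
        have h := ((mulCLM (c i) (hc0 i)).continuous.tendsto 0).comp t1
        rwa [map_zero] at h
      have t4 := t1.norm.add (tendsto_finsetSum Finset.univ fun i _ =>
        ((t2 i).add (t3 i)).norm.mul
          ((tendsto_classL2_trig (wpderiv i f)).norm.const_mul η⁻¹))
      simpa using t4
    have hbound : ∀ S, |inner ℝ (classL2 (trig f S)) (classL2 φ)|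
        ≤ B * ((1 + K / 4) * η + err S) := by
      intro S
      have hψ := trig_smooth f S
      have hψ0 := hψ.continuous
      rw [inner_classL2_classL2 hψ0 hφ.continuous]
      have hP := continuous_testIntegrand hη hc0 hψ
      have hle := integral_testIntegrand_le hη hc hf h0 hψ
      simp only [pderiv_trig (hf.hasWeakPDeriv _)] at hle
      calc |∫ x, trig f S x * φ x ∂(torusMeasure d)|
          ≤ ∫ x, |trig f S x * φ x| ∂(torusMeasure d) := abs_integral_le_integral_abs
        _ ≤ ∫ x, B * ((1 + K / 4) * η + testIntegrand η c (trig f S) x) ∂(torusMeasure d) := by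
            refine integral_mono (integrable_of_continuous (hψ0.mul hφ.continuous).abs)
              (integrable_of_continuous (by fun_prop)) fun x => ?_
            simp only [abs_mul]
            rw [mul_comm]
            exact mul_le_mul (hB x) (abs_le_testIntegrand hη hK' _ x) (abs_nonneg _) hB0
        _ = B * ((1 + K / 4) * η + ∫ x, testIntegrand η c (trig f S) x ∂(torusMeasure d)) := by
            rw [integral_const_mul, integral_add (integrable_const _)
              (integrable_of_continuous hP)]
            simp
        _ ≤ B * ((1 + K / 4) * η + err S) := by gcongr
    have hlim : Filter.Tendsto (fun S => |inner ℝ (classL2 (trig f S)) (classL2 φ)|) Filter.atTop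
        (nhds |inner ℝ f (classL2 φ)|) :=
      ((tendsto_classL2_trig f).inner tendsto_const_nhds).abs
    have hlim2 := (herr.const_add ((1 + K / 4) * η)).const_mul B
    rw [add_zero] at hlim2
    exact le_of_tendsto_of_tendsto' hlim hlim2 hbound
  have hzero : |inner ℝ f (classL2 φ)| ≤ 0 := by
    have hlim : Filter.Tendsto (fun η : ℝ => B * ((1 + K / 4) * η)) (nhdsWithin 0 (Ioi 0))
        (nhds 0) := by
      have : Continuous fun η : ℝ => B * ((1 + K / 4) * η) := by fun_prop
      simpa using (this.tendsto 0).mono_left nhdsWithin_le_nhds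
    exact ge_of_tendsto hlim (Filter.eventually_of_mem self_mem_nhdsWithin fun η hη => key η hη)
  exact abs_nonpos_iff.1 hzero

/-! ### Triviality of the kernel of the linear system -/

theorem integrable_mul_mul {a : Torus d → ℝ} (ha : Continuous a) (v w : L2 d) :
    Integrable (fun x => a x * (v x * w x)) (torusMeasure d) := by
  have h : Integrable (fun x => a x * v x * w x) (torusMeasure d) :=
    (memLp_mul ha v).integrable_mul (Lp.memLp w)
  simpa only [mul_assoc] using h

theorem inner_mulL2 {a : Torus d → ℝ} (ha : Continuous a) (v w : L2 d) :
    inner ℝ (mulL2 a v) w = ∫ x, a x * (v x * w x) ∂(torusMeasure d) := by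
  rw [L2.inner_def]
  refine integral_congr_ae ?_
  filter_upwards [coeFn_mulL2 ha v] with x hx
  rw [hx, real_inner_eq_re_inner, RCLike.inner_apply]
  simp
  ring

theorem mulL2_zero {a : Torus d → ℝ} (ha : Continuous a) : mulL2 a (0 : L2 d) = 0 :=
  (mulCLM a ha).map_zero

theorem wpderiv_zero (i : Fin d) : wpderiv i (0 : L2 d) = 0 :=
  (hasWeakPDeriv_iff.2 fun n => by simp [fc_zero]).wpderiv_eq

/-- If the quadratic form `a |ξ|² + t (c - β)·ξ + γ t²` is nonnegative and controls `|ξ|²`, the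
system has trivial kernel. Testing the first row with `f`, the second one with `v`, and subtracting
cancels the second-order terms, which gives `Dv = 0` and `γ f = 0`. Then `v = 0` by the first row,
and `f = 0` by the uniqueness theorem for the second. -/
theorem sys_kernel_trivial {β : Fin d → Torus d → ℝ} {γ a δ : Torus d → ℝ}
    {c : Fin d → Torus d → ℝ} (hβ : ∀ i, Continuous (β i)) (hγ : Continuous γ)
    (ha : TorusContDiff 1 a) (hc : ∀ i, TorusContDiff 1 (c i)) (hδ : ∀ x, 0 < δ x)
    (hQ : ∀ (x : Torus d) (ξ : Fin d → ℝ) (t : ℝ), δ x * ∑ i, ξ i ^ 2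
      ≤ ∑ i, a x * ξ i ^ 2 + ∑ i, (c i x - β i x) * (t * ξ i) + γ x * t ^ 2)
    {v f : L2 d} (hv : MemH 2 v) (hf : MemH 2 f) (h1 : sysFst β γ v f = 0)
    (h2 : sysSnd a c v f = 0) : v = 0 ∧ f = 0 := by
  have ha0 := ha.continuous
  have hc0 : ∀ i, Continuous (c i) := fun i => (hc i).continuous
  have hv1 : MemH 1 v := hv.of_succ
  have hf1 : MemH 1 f := hf.of_succ
  have hav : ∀ i, MemH 1 (mulL2 a (wpderiv i v)) := fun i j =>
    ⟨_, ((hv.wpderiv i).hasWeakPDeriv j).mulL2 ha, trivial⟩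
  have hcf : ∀ i, MemH 1 (mulL2 (c i) f) := fun i j =>
    ⟨_, (hf1.hasWeakPDeriv j).mulL2 (hc i), trivial⟩
  have e1 : inner ℝ v f + ∑ i, inner ℝ (wpderiv i v) (wpderiv i f)
      + ∑ i, inner ℝ (mulL2 (β i) (wpderiv i v)) f - inner ℝ (mulL2 γ f) f = 0 := by
    have h := congrArg (fun z => inner ℝ z f) h1
    simp only [sysFst, inner_sub_left, inner_add_left, inner_zero_left, wlap_eq_wdiv,
      sum_inner] at h
    rw [MemH.inner_wdiv (fun i => hv.wpderiv i) hf1] at h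
    linarith
  have e2 : inner ℝ v f + ∑ i, inner ℝ (wpderiv i v) (wpderiv i f)
      + ∑ i, inner ℝ (mulL2 a (wpderiv i v)) (wpderiv i v)
      + ∑ i, inner ℝ (mulL2 (c i) f) (wpderiv i v) = 0 := by
    have h := congrArg (fun z => inner ℝ z v) h2
    simp only [sysSnd, inner_sub_left, inner_zero_left, wlap_eq_wdiv] at h
    rw [MemH.inner_wdiv (fun i => hf.wpderiv i) hv1, MemH.inner_wdiv hav hv1,
      MemH.inner_wdiv hcf hv1] at h
    simp only [real_inner_comm (wpderiv _ f) (wpderiv _ v), real_inner_comm v f] at h ⊢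
    linarith
  let Q : Torus d → ℝ := fun x => ∑ i, a x * (wpderiv i v x * wpderiv i v x)
    + ∑ i, (c i x - β i x) * (f x * wpderiv i v x) + γ x * (f x * f x)
  have i1 : ∀ i, Integrable (fun x => a x * (wpderiv i v x * wpderiv i v x)) (torusMeasure d) :=
    fun i => integrable_mul_mul ha0 _ _
  have i2 : ∀ i, Integrable (fun x => (c i x - β i x) * (f x * wpderiv i v x)) (torusMeasure d) :=
    fun i => integrable_mul_mul ((hc0 i).sub (hβ i)) _ _
  have i3 : Integrable (fun x => γ x * (f x * f x)) (torusMeasure d) := integrable_mul_mul hγ _ _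
  have i12 : Integrable (fun x => ∑ i, a x * (wpderiv i v x * wpderiv i v x)) (torusMeasure d)
      ∧ Integrable (fun x => ∑ i, (c i x - β i x) * (f x * wpderiv i v x)) (torusMeasure d) :=
    ⟨integrable_finsetSum _ fun i _ => i1 i, integrable_finsetSum _ fun i _ => i2 i⟩
  have i12' : Integrable (fun x => ∑ i, a x * (wpderiv i v x * wpderiv i v x)
      + ∑ i, (c i x - β i x) * (f x * wpderiv i v x)) (torusMeasure d) := i12.1.add i12.2
  have hQint : Integrable Q (torusMeasure d) :=
    i12'.add i3
  have hQ0 : ∫ x, Q x ∂(torusMeasure d) = 0 := by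
    have s1 : ∀ i, ∫ x, (c i x - β i x) * (f x * wpderiv i v x) ∂(torusMeasure d)
        = inner ℝ (mulL2 (c i) f) (wpderiv i v) - inner ℝ (mulL2 (β i) (wpderiv i v)) f := by
      intro i
      rw [inner_mulL2 (hc0 i), inner_mulL2 (hβ i), ← integral_sub
        (integrable_mul_mul (hc0 i) _ _) (integrable_mul_mul (hβ i) _ _)]
      refine integral_congr_ae (Filter.Eventually.of_forall fun x => ?_)
      ring
    have s2 : ∫ x, Q x ∂(torusMeasure d)
        = ∑ i, inner ℝ (mulL2 a (wpderiv i v)) (wpderiv i v)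
        + ∑ i, (inner ℝ (mulL2 (c i) f) (wpderiv i v) - inner ℝ (mulL2 (β i) (wpderiv i v)) f)
        + inner ℝ (mulL2 γ f) f := by
      simp only [← s1, inner_mulL2 ha0, inner_mulL2 hγ]
      rw [← integral_finsetSum _ fun i _ => i1 i, ← integral_finsetSum _ fun i _ => i2 i,
        ← integral_add i12.1 i12.2, ← integral_add i12' i3]
    rw [s2, Finset.sum_sub_distrib]
    linarith
  have hQle : ∀ x, δ x * ∑ i, wpderiv i v x ^ 2 ≤ Q x := fun x => by
    simpa only [sq] using hQ x (fun i => wpderiv i v x) (f x)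
  have hQpos : ∀ x, 0 ≤ Q x := fun x =>
    (mul_nonneg (hδ x).le (Finset.sum_nonneg fun i _ => sq_nonneg _)).trans (hQle x)
  have hQae : ∀ᵐ x ∂(torusMeasure d), Q x = 0 :=
    (integral_eq_zero_iff_of_nonneg hQpos hQint).1 hQ0
  have hDae : ∀ᵐ x ∂(torusMeasure d), (∀ i, wpderiv i v x = 0) ∧ γ x * f x = 0 := by
    filter_upwards [hQae] with x hx
    have h3 := hQle x
    rw [hx] at h3
    have h4 : ∑ i, wpderiv i v x ^ 2 = 0 := le_antisymm
      (nonpos_of_mul_nonpos_right h3 (hδ x)) (Finset.sum_nonneg fun i _ => sq_nonneg _)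
    have h5 : ∀ i, wpderiv i v x = 0 := fun i =>
      pow_eq_zero_iff (two_ne_zero) |>.1
        ((Finset.sum_eq_zero_iff_of_nonneg fun i _ => sq_nonneg _).1 h4 i (Finset.mem_univ i))
    refine ⟨h5, ?_⟩
    simp only [Q, h5, mul_zero, Finset.sum_const_zero, zero_add] at hx
    rcases mul_eq_zero.1 hx with h | h
    · rw [h, zero_mul]
    · rw [mul_self_eq_zero.1 h, mul_zero]
  have hDv : ∀ i, wpderiv i v = 0 := fun i => by
    refine (Lp.eq_zero_iff_ae_eq_zero).2 ?_
    filter_upwards [hDae] with x hx using hx.1 i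
  have hγf : mulL2 γ f = 0 := by
    refine (Lp.eq_zero_iff_ae_eq_zero).2 ?_
    filter_upwards [hDae, coeFn_mulL2 hγ f] with x hx hx'
    rw [hx', hx.2, Pi.zero_apply]
  have hv0 : v = 0 := by
    simpa [sysFst, wlap, hDv, wpderiv_zero, mulL2_zero, hβ, hγf] using h1
  refine ⟨hv0, eq_zero_of_divergence_eq hc hf ?_⟩
  simpa [sysSnd, wdiv, hDv, wpderiv_zero, mulL2_zero, ha0] using h2

/-! ### The linearized system as a second-order system with smooth coefficients -/

theorem SmoothCoef.add {a b : Torus d → ℝ} (ha : SmoothCoef a) (hb : SmoothCoef b) :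
    SmoothCoef fun x => a x + b x :=
  ⟨ContDiff.add ha.C1 hb.C1, fun s => (ha.sob s).add (hb.sob s)⟩

theorem SmoothCoef.mul {a b : Torus d → ℝ} (ha : SmoothCoef a) (hb : SmoothCoef b) :
    SmoothCoef fun x => a x * b x :=
  ⟨ha.C1.mul hb.C1, fun s =>
    (SobCont.mul (by omega) (ha.sob (s + (d + 1))) (hb.sob (s + (d + 1)))).of_le (by omega)⟩

theorem TorusContDiff.smoothCoef {a : Torus d → ℝ} (ha : TorusContDiff ∞ a) : SmoothCoef a :=
  ⟨ha.of_le (by simp), ha.sobCont⟩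

theorem SmoothCoef.const_mul (r : ℝ) {a : Torus d → ℝ} (ha : SmoothCoef a) :
    SmoothCoef fun x => r * a x :=
  ⟨ContDiff.mul contDiff_const ha.C1, fun s => (ha.sob s).const_mul r⟩

theorem SmoothCoef.sum {ι : Type*} (t : Finset ι) {a : ι → Torus d → ℝ}
    (ha : ∀ i, SmoothCoef (a i)) : SmoothCoef fun x => ∑ i ∈ t, a i x :=
  ⟨ContDiff.sum fun i _ => (ha i).C1, fun s => SobCont.sum t fun i => (ha i).sob s⟩

theorem SmoothCoef.comp {m : Torus d → ℝ} (hm : SmoothCoef m) (hpos : ∀ x, 0 < m x)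
    {G : Torus d → ℝ → ℝ} (hG : SmoothOnPos G) : SmoothCoef fun x => G x (m x) :=
  ⟨hG.torusContDiff (by simp) hm.C1 hpos, fun s =>
    (SobCont.comp (r := s + (d + 1)) (by omega) (hm.sob _) hm.C1 hpos hG).of_le (by omega)⟩

/-- The drift `m^{-α} Du + lam b` in the first linearized equation. -/
noncomputable def linDrift (α : ℝ) (b : Fin d → Torus d → ℝ) (lam : ℝ) (u m : Torus d → ℝ)
    (i : Fin d) (x : Torus d) : ℝ :=
  pderiv i u x / m x ^ α + lam * b i x

/-- The coefficient of `-f` in the first linearized equation. -/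
noncomputable def linPotential (α : ℝ) (V : Torus d → ℝ → ℝ) (lam : ℝ) (u m : Torus d → ℝ)
    (x : Torus d) : ℝ :=
  α * gradSq u x / (2 * m x ^ (α + 1))
    + (lam * deriv (V x) (m x) + (1 - lam) * deriv Real.arctan (m x))

/-- The vector field `(1 - α) m^{-α} Du + lam b` transporting `f` in the second linearized
equation. -/
noncomputable def linTransport (α : ℝ) (b : Fin d → Torus d → ℝ) (lam : ℝ) (u m : Torus d → ℝ)
    (i : Fin d) (x : Torus d) : ℝ :=
  (1 - α) * (m x ^ (-α) * pderiv i u x) + lam * b i x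

theorem div_rpow_eq {x : ℝ} (hx : 0 < x) (α y : ℝ) : y / x ^ α = y * x ^ (-α) := by
  rw [Real.rpow_neg hx.le, div_eq_mul_inv]

theorem smoothCoef_linearized_terms {α : ℝ} {u m : Torus d → ℝ}
    (hu : ∀ i, SmoothCoef (pderiv i u)) (hm : SmoothCoef m) (hpos : ∀ x, 0 < m x) :
    (∀ i, SmoothCoef fun x => pderiv i u x / m x ^ α)
      ∧ (SmoothCoef fun x => α * gradSq u x / (2 * m x ^ (α + 1)))
      ∧ ∀ i, SmoothCoef fun x => m x ^ (-α) * pderiv i u x := by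
  refine ⟨fun i => ?_, ?_, fun i => (hm.comp hpos (smoothOnPos_rpow (-α))).mul (hu i)⟩
  · simp only [div_rpow_eq (hpos _)]
    exact (hu i).mul (hm.comp hpos (smoothOnPos_rpow (-α)))
  · simp only [div_two_mul_rpow (hpos _), gradSq, sq]
    exact (((SmoothCoef.sum _ fun i => (hu i).mul (hu i)).const_mul α).mul
      (hm.comp hpos (smoothOnPos_rpow (-(α + 1))))).const_mul _

theorem linFst_eq_sysFst {α : ℝ} {V : Torus d → ℝ → ℝ} {b : Fin d → Torus d → ℝ} {lam : ℝ}
    {u m : Torus d → ℝ} (h1 : ∀ i, Continuous fun x => pderiv i u x / m x ^ α)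
    (h2 : ∀ i, Continuous (b i)) (h3 : Continuous fun x => α * gradSq u x / (2 * m x ^ (α + 1)))
    (h4 : Continuous fun x => lam * deriv (V x) (m x) + (1 - lam) * deriv Real.arctan (m x))
    (v f : L2 d) :
    linFst α V b lam u m v f = sysFst (linDrift α b lam u m) (linPotential α V lam u m) v f := by
  have e1 : ∀ i w, mulL2 (linDrift α b lam u m i) w
      = mulL2 (fun x => pderiv i u x / m x ^ α) w + lam • mulL2 (b i) w := fun i w => by
    have hc : Continuous fun x => lam * b i x := continuous_const.mul (h2 i)
    rw [← const_mul_mulL2 (h2 i), ← add_mulL2 (h1 i) hc]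
    rfl
  have e2 : mulL2 (linPotential α V lam u m) f
      = mulL2 (fun x => α * gradSq u x / (2 * m x ^ (α + 1))) f
        + mulL2 (fun x => lam * deriv (V x) (m x) + (1 - lam) * deriv Real.arctan (m x)) f := by
    rw [← add_mulL2 h3 h4]
    rfl
  simp only [linFst, sysFst, e1, e2, Finset.sum_add_distrib, Finset.smul_sum]
  abel

theorem linSnd_eq_sysSnd {α : ℝ} {b : Fin d → Torus d → ℝ} {lam : ℝ} {u m : Torus d → ℝ}
    (h1 : ∀ i, TorusContDiff 1 fun x => m x ^ (-α) * pderiv i u x)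
    (h2 : ∀ i, TorusContDiff 1 (b i)) (v : L2 d) {f : L2 d} (hf : MemH 1 f) :
    linSnd α b lam u m v f
      = sysSnd (fun x => m x ^ (1 - α)) (linTransport α b lam u m) v f := by
  have e1 : ∀ i, wpderiv i (mulL2 (linTransport α b lam u m i) f)
      = (1 - α) • wpderiv i (mulL2 (fun x => m x ^ (-α) * pderiv i u x) f)
        + lam • wpderiv i (mulL2 (b i) f) := fun i => by
    have c1 := (h1 i).continuous
    have c2 := (h2 i).continuous
    have e2 : mulL2 (linTransport α b lam u m i) f
        = (1 - α) • mulL2 (fun x => m x ^ (-α) * pderiv i u x) f + lam • mulL2 (b i) f := by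
      have c3 : Continuous fun x => (1 - α) * (m x ^ (-α) * pderiv i u x) := continuous_const.mul c1
      have c4 : Continuous fun x => lam * b i x := continuous_const.mul c2
      rw [← const_mul_mulL2 c1, ← const_mul_mulL2 c2, ← add_mulL2 c3 c4]
      rfl
    have w1 := (hf.hasWeakPDeriv i).mulL2 (h1 i)
    have w2 := (hf.hasWeakPDeriv i).mulL2 (h2 i)
    rw [e2, ((w1.smul (1 - α)).add (w2.smul lam)).wpderiv_eq, w1.wpderiv_eq, w2.wpderiv_eq]
  simp only [linSnd, sysSnd, wdiv, e1, Finset.sum_add_distrib, Finset.smul_sum]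
  abel

theorem linPotential_ge {α : ℝ} {V : Torus d → ℝ → ℝ} {b : Fin d → Torus d → ℝ}
    (hdata : IsData α V b) {lam : ℝ} (hlam : lam ∈ Icc (0 : ℝ) 1) {u m : Torus d → ℝ}
    (hpos : ∀ x, 0 < m x) (x : Torus d) :
    α * gradSq u x / (2 * m x ^ (α + 1)) ≤ linPotential α V lam u m x := by
  have h1 : 0 ≤ deriv (V x) (m x) := by
    rw [← derivWithin_of_isOpen isOpen_Ioi (hpos x)]
    exact (hdata.V_mono x).derivWithin_nonneg
  have h2 : 0 ≤ deriv Real.arctan (m x) := by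
    rw [Real.deriv_arctan]
    positivity
  have h3 := mul_nonneg hlam.1 h1
  have h4 := mul_nonneg (sub_nonneg.2 hlam.2) h2
  unfold linPotential
  linarith

/-- Positivity of the quadratic form of the linearized system: with `s = t / m`, it equals at
least `m^{1-α} (|ξ|² - α s Du·ξ + (α/2) s² |Du|²)`, which is `m^{1-α} (1 - α/2) |ξ|²` plus the
square `(α/2) m^{1-α} |ξ - s Du|²`. -/
theorem lin_quadratic_form {α : ℝ} {V : Torus d → ℝ → ℝ} {b : Fin d → Torus d → ℝ}
    (hdata : IsData α V b) {lam : ℝ} (hlam : lam ∈ Icc (0 : ℝ) 1) {u m : Torus d → ℝ}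
    (hpos : ∀ x, 0 < m x) (x : Torus d) (ξ : Fin d → ℝ) (t : ℝ) :
    (1 - α / 2) * m x ^ (1 - α) * ∑ i, ξ i ^ 2
      ≤ ∑ i, m x ^ (1 - α) * ξ i ^ 2
        + ∑ i, (linTransport α b lam u m i x - linDrift α b lam u m i x) * (t * ξ i)
        + linPotential α V lam u m x * t ^ 2 := by
  have hm := hpos x
  set A := m x ^ (1 - α) with hA
  have hA0 : 0 < A := Real.rpow_pos_of_pos hm _
  set s := t / m x with hs
  have ht : t = s * m x := by rw [hs]; field_simp
  have e1 : m x ^ (-α) * m x = A := by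
    rw [hA, sub_eq_add_neg, add_comm, Real.rpow_add hm, Real.rpow_one]
  have e2 : (m x ^ (α + 1))⁻¹ * m x ^ 2 = A := by
    rw [← Real.rpow_neg hm.le, ← Real.rpow_natCast, ← Real.rpow_add hm, hA]
    congr 1
    push_cast
    ring
  have h1 : ∀ i, (linTransport α b lam u m i x - linDrift α b lam u m i x) * (t * ξ i)
      = -(α * A * s * (pderiv i u x * ξ i)) := fun i => by
    rw [linTransport, linDrift, div_rpow_eq hm, ht, ← e1]
    ring
  have h2 : α * gradSq u x / (2 * m x ^ (α + 1)) * t ^ 2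
      = ∑ i, α / 2 * A * s ^ 2 * pderiv i u x ^ 2 := by
    rw [← Finset.mul_sum, ht, ← e2, gradSq]
    have : m x ^ (α + 1) ≠ 0 := (Real.rpow_pos_of_pos hm _).ne'
    field_simp
  have h3 := mul_le_mul_of_nonneg_right (linPotential_ge hdata hlam hpos (u := u) x) (sq_nonneg t)
  rw [h2] at h3
  have h4 : (1 - α / 2) * A * ∑ i, ξ i ^ 2
      ≤ ∑ i, (A * ξ i ^ 2 + -(α * A * s * (pderiv i u x * ξ i))
        + α / 2 * A * s ^ 2 * pderiv i u x ^ 2) := by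
    rw [Finset.mul_sum]
    refine Finset.sum_le_sum fun i _ => ?_
    have h5 : 0 ≤ α / 2 * A * (ξ i - s * pderiv i u x) ^ 2 :=
      mul_nonneg (mul_nonneg (by linarith [hdata.alpha_nonneg]) hA0.le) (sq_nonneg _)
    nlinarith [h5]
  simp only [h1]
  rw [Finset.sum_add_distrib, Finset.sum_add_distrib] at h4
  linarith

end MFG

theorem lemma3p5 (d : ℕ) (hd : 1 ≤ d) (α : ℝ) (V : MFG.Torus d → ℝ → ℝ)
    (b : Fin d → MFG.Torus d → ℝ) (hdata : MFG.IsData α V b)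
    (k₀ : ℕ) (hk₀ : (d : ℝ) / 2 < k₀)
    (lam : ℝ) (hlam : lam ∈ Set.Icc (0 : ℝ) 1) (u m : MFG.Torus d → ℝ)
    (hsol : MFG.IsSolution k₀ α V b lam u m) (k : ℕ) (hk : 2 ≤ k) :
    ∃ L : MFG.E d (k + 2) ≃L[ℝ] MFG.E d k, ∀ w : MFG.E d (k + 2),
      (L w).1.toL2 = MFG.linFst α V b lam u m w.1.toL2 w.2.toL2 ∧
      (L w).2.toL2 = MFG.linSnd α b lam u m w.1.toL2 w.2.toL2 := by
  have hdk : d < 2 * k₀ := by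
    have h : (d : ℝ) < 2 * k₀ := by linarith
    exact_mod_cast h
  have hpos := hsol.m_pos
  have hu1 : MFG.TorusContDiff 1 u := hsol.u_C2.of_le (by norm_num)
  have hm1 : MFG.TorusContDiff 1 m := hsol.m_C2.of_le (by norm_num)
  have hm : MFG.SmoothCoef m := ⟨hm1, fun s => (hsol.sobCont hdata hdk s).2⟩
  have hDu : ∀ i, MFG.SmoothCoef (MFG.pderiv i u) := fun i =>
    ⟨hsol.u_C2.pderiv (by norm_num) i, fun s => (hsol.sobCont hdata hdk (s + 1)).1.pderiv hu1 i⟩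
  have hb : ∀ i, MFG.SmoothCoef (b i) := fun i => (hdata.b_smooth i).smoothCoef
  have hV : MFG.SmoothCoef fun x =>
      lam * deriv (V x) (m x) + (1 - lam) * deriv Real.arctan (m x) :=
    ((hm.comp hpos (MFG.SmoothOnPos.deriv hdata.V_smooth)).const_mul lam).add
      ((hm.comp hpos MFG.smoothOnPos_arctan.deriv).const_mul (1 - lam))
  obtain ⟨p1, p2, p3⟩ := MFG.smoothCoef_linearized_terms (α := α) hDu hm hpos
  have hβ : ∀ i, MFG.SmoothCoef (MFG.linDrift α b lam u m i) := fun i =>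
    (p1 i).add ((hb i).const_mul lam)
  have hγ : MFG.SmoothCoef (MFG.linPotential α V lam u m) := p2.add hV
  have ha : MFG.SmoothCoef fun x => m x ^ (1 - α) := hm.comp hpos (MFG.smoothOnPos_rpow (1 - α))
  have hc : ∀ i, MFG.SmoothCoef (MFG.linTransport α b lam u m i) := fun i =>
    ((p3 i).const_mul (1 - α)).add ((hb i).const_mul lam)
  obtain ⟨L, hL⟩ := MFG.exists_continuousLinearEquiv hβ hγ ha hc (fun v f hv hf h1 h2 =>
    MFG.sys_kernel_trivial (fun i => (hβ i).C1.continuous) hγ.C1.continuous ha.C1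
      (fun i => (hc i).C1)
      (fun x => mul_pos (by linarith [hdata.alpha_lt_one]) (Real.rpow_pos_of_pos (hpos x) (1 - α)))
      (MFG.lin_quadratic_form hdata hlam hpos) hv hf h1 h2) k
  refine ⟨L, fun w => ?_⟩
  rw [MFG.linFst_eq_sysFst (fun i => (p1 i).C1.continuous) (fun i => (hb i).C1.continuous)
    p2.C1.continuous hV.C1.continuous, MFG.linSnd_eq_sysSnd (fun i => (p3 i).C1)
    (fun i => (hb i).C1) _ (w.2.memH.mono (by omega))]
  exact hL w
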